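/- **Conventions.** Let $A$ be a nonunital $C^*$-algebra with a $\sigma$-unit of projections $(e_n)_{n\ge 0}$, that is, a sequence of projections in $A$ with $0\ne e_0$ and $e_n<e_{n+1}$ for all $n$ such that $e_na\to a$ and $ae_n\to a$ in norm for every $a\in A$. (So $A$ is $\sigma$-unital.) Let $M(A)$ be the multiplier algebra of $A$, $Q(A)=M(A)/A$ the corona algebra and $\pi:M(A)\to Q(A)$ the quotient map. Put $f_0=e_0$ and $f_n=e_n-e_{n-1}$ for $n\ge1$, and for $X\subseteq\mathbb N$ let $p_X\in M(A)$ be the limit, in the strict topology, of $\sum_{n\in X,\,n\le m}f_n$ as $m\to\infty$. A state on a $C^*$-algebra $C$ is a positive linear functional of norm one; a pure state is an extreme point of the set of states. For a state $\varphi$ on $C$ let $\mathscr F_\varphi=\{a\in C: a\ge 0,\ \|a\|=1,\ \varphi(a)=1\}$, and for a state $\varphi$ on $Q(A)$ let $\mathscr X_\varphi=\{X\subseteq\mathbb N:\varphi(\pi(p_X))=1\}$. For positive norm-one elements write $a\ll b$ if $ab=a$. A quantum filter in $C$ is a set $\mathscr F$ of positive norm-one elements such that $\|a_1\cdots a_k\|=1$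 whenever $k\ge1$ and $a_1,\dots,a_k\in\mathscr F$; it is maximal if it is not properly contained in another quantum filter. A state $\varphi$ is a *P-state* if $\mathscr F_\varphi$ is a maximal quantum filter that is upwards closed for $\ll$ among the positive norm-one elements and such that for every countable family $(b_n)$ in $\mathscr F_\varphi$ there is $a\in\mathscr F_\varphi$ with $a\ll b_n$ for all $n$. An ultrafilter $\mathcal U$ on $\mathbb N$ is a *P-point* if it is upwards closed under inclusion modulo finite sets and for every countable family $(X_n)$ in $\mathcal U$ there is $Y\in\mathcal U$ with $Y\setminus X_n$ finite for all $n$. **Theorem.** There are pure states $\psi_n$ of $A$ with $\psi_n(f_n)=1$ for every $n\ge 0$. For every such sequence $(\psi_n)$, each $\psi_n$ extends to exactly one state $\tilde\psi_n$ of $M(A)$, this extension is pure, and there is an injective map $\mathcal U\mapsto\varphi_{\mathcal U}$ from $\beta\mathbb N\setminus\mathbb N$ (the nonprincipal ultrafilters on $\mathbb N$) into the pure states of $Q(A)$ such that for every $\mathcal U\in\beta\mathbb N\setminus\mathbb N$: 1. $\varphi_{\mathcal U}(\pi(m))=\lim_{n\to\mathcal U}\tilde\psi_n(m)$ for every $m\in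 M(A)$; 2. $\mathscr X_{\varphi_{\mathcal U}}=\mathcal U$; 3. $\varphi_{\mathcal U}$ is a P-state if and only if $\mathcal U$ is a P-point. -/

import Mathlib

open Filter Topology
open scoped MultiplierAlgebra

noncomputable section

/-! ### Multiplier algebra, strict topology and corona algebra -/

section Corona

variable (A : Type*) [NonUnitalCStarAlgebra A]

/-- The canonical embedding of `A` into its multiplier algebra `M(A) = 𝓜(ℂ, A)`. -/
abbrev toMultiplier : A →⋆ₙₐ[ℂ] 𝓜(ℂ, A) := DoubleCentralizer.coeHom

variable {A}

lemma mul_toMultiplier (m : 𝓜(ℂ, A)) (a : A) : m * toMultiplier A a = toMultiplier A (m.fst a) := by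
  ext x
  · have h : m.fst a * x = m.fst (a * x) := by
      have key : ∀ y : A, y * (m.fst a * x - m.fst (a * x)) = 0 := by
        intro y
        rw [mul_sub, ← mul_assoc, ← m.central, ← m.central, mul_assoc, sub_self]
      have := key (star (m.fst a * x - m.fst (a * x)))
      rw [CStarRing.star_mul_self_eq_zero_iff] at this
      exact sub_eq_zero.1 this
    simpa using h.symm
  · simpa using m.central x a

lemma toMultiplier_mul (m : 𝓜(ℂ, A)) (a : A) : toMultiplier A a * m = toMultiplier A (m.snd a) := by
  have h := congrArg star (mul_toMultiplier (star m) (star a))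
  rw [star_mul, star_star, map_star, star_star, DoubleCentralizer.star_fst, star_star, map_star,
    star_star] at h
  exact h

variable (A)

/-- The image of `A` in `M(A)`, as an ideal. -/
def multiplierIdeal : Ideal 𝓜(ℂ, A) where
  carrier := Set.range (toMultiplier A)
  add_mem' := by
    rintro _ _ ⟨a, rfl⟩ ⟨b, rfl⟩
    exact ⟨a + b, map_add _ a b⟩
  zero_mem' := ⟨0, map_zero _⟩
  smul_mem' := by
    rintro m _ ⟨a, rfl⟩
    exact ⟨m.fst a, (mul_toMultiplier m a).symm⟩

variable {A}

lemma mem_multiplierIdeal {m : 𝓜(ℂ, A)} :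
    m ∈ multiplierIdeal A ↔ ∃ a : A, toMultiplier A a = m := Iff.rfl

lemma multiplierIdeal_star_mem {m : 𝓜(ℂ, A)} (hm : m ∈ multiplierIdeal A) :
    star m ∈ multiplierIdeal A := by
  obtain ⟨a, rfl⟩ := hm
  exact ⟨star a, map_star _ a⟩

variable (A)

instance multiplierIdeal_isTwoSided : (multiplierIdeal A).IsTwoSided where
  mul_mem_of_left := by
    intro a b ha
    have h := (multiplierIdeal A).mul_mem_left (star b) (multiplierIdeal_star_mem ha)
    rw [← star_mul] at h
    simpa using multiplierIdeal_star_mem h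

lemma multiplierCoe_isometry :
    Isometry (toMultiplier A) := by
  refine AddMonoidHomClass.isometry_of_norm _ fun a => ?_
  rw [← DoubleCentralizer.norm_fst]
  exact ContinuousLinearMap.opNorm_mul_apply ℂ A a

instance multiplierIdeal_isClosed : IsClosed (multiplierIdeal A : Set 𝓜(ℂ, A)) :=
  (multiplierCoe_isometry A).isClosedEmbedding.isClosed_range

/-- The corona algebra `Q(A) = M(A) / A`, with the quotient norm. -/
def Corona : Type _ := 𝓜(ℂ, A) ⧸ multiplierIdeal A

namespace Corona

instance : Ring (Corona A) := inferInstanceAs (Ring (𝓜(ℂ, A) ⧸ multiplierIdeal A))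

instance : NormedAddCommGroup (Corona A) :=
  inferInstanceAs (NormedAddCommGroup (𝓜(ℂ, A) ⧸ multiplierIdeal A))

instance : NormedSpace ℂ (Corona A) :=
  inferInstanceAs (NormedSpace ℂ (𝓜(ℂ, A) ⧸ multiplierIdeal A))

instance : CompleteSpace (Corona A) :=
  inferInstanceAs (CompleteSpace (𝓜(ℂ, A) ⧸ multiplierIdeal A))

/-- The quotient map `𝓜(ℂ, A) → Corona A`, as a ring homomorphism. -/
def mkRingHom : 𝓜(ℂ, A) →+* Corona A := Ideal.Quotient.mk (multiplierIdeal A)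

variable {A}

lemma mkRingHom_surjective : Function.Surjective (mkRingHom A) := Ideal.Quotient.mk_surjective

lemma mkRingHom_eq_zero {m : 𝓜(ℂ, A)} : mkRingHom A m = 0 ↔ ∃ a : A, toMultiplier A a = m :=
  Ideal.Quotient.eq_zero_iff_mem

lemma norm_mkRingHom_le (m : 𝓜(ℂ, A)) : ‖mkRingHom A m‖ ≤ ‖m‖ :=
  Submodule.Quotient.norm_mk_le (multiplierIdeal A) m

lemma exists_norm_lt (x : Corona A) {ε : ℝ} (hε : 0 < ε) :
    ∃ m : 𝓜(ℂ, A), mkRingHom A m = x ∧ ‖m‖ < ‖x‖ + ε :=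
  Submodule.Quotient.norm_mk_lt (S := multiplierIdeal A) x hε

lemma mkRingHom_smul (c : ℂ) (m : 𝓜(ℂ, A)) : mkRingHom A (c • m) = c • mkRingHom A m := rfl

instance : NormedRing (Corona A) :=
  { (inferInstance : Ring (Corona A)), (inferInstance : NormedAddCommGroup (Corona A)) with
    norm_mul_le := fun x y => by
      refine le_of_forall_pos_le_add fun ε hε => ?_
      have hc : ContinuousAt (fun t : ℝ => (‖x‖ + t) * (‖y‖ + t)) 0 := by fun_prop
      have h1 : ∀ᶠ t in 𝓝[>] (0 : ℝ), (‖x‖ + t) * (‖y‖ + t) < ‖x‖ * ‖y‖ + ε := by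
        refine (hc.tendsto.mono_left nhdsWithin_le_nhds).eventually_lt_const ?_
        simpa using hε
      obtain ⟨t, ht, ht0⟩ := (h1.and self_mem_nhdsWithin).exists
      obtain ⟨a, rfl, ha⟩ := exists_norm_lt x ht0
      obtain ⟨b, rfl, hb⟩ := exists_norm_lt y ht0
      calc ‖mkRingHom A a * mkRingHom A b‖ = ‖mkRingHom A (a * b)‖ := by rw [map_mul]
        _ ≤ ‖a * b‖ := norm_mkRingHom_le _
        _ ≤ ‖a‖ * ‖b‖ := norm_mul_le a b
        _ ≤ _ := mul_le_mul ha.le hb.le (norm_nonneg _) ((norm_nonneg _).trans ha.le)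
        _ ≤ _ := ht.le }

instance : NormedAlgebra ℂ (Corona A) :=
  { (inferInstance : NormedSpace ℂ (Corona A)) with
    algebraMap := (mkRingHom A).comp (algebraMap ℂ 𝓜(ℂ, A))
    commutes' := fun c x => by
      obtain ⟨m, rfl⟩ := mkRingHom_surjective x
      simp only [RingHom.comp_apply]
      rw [← map_mul, ← map_mul, Algebra.commutes]
    smul_def' := fun c x => by
      obtain ⟨m, rfl⟩ := mkRingHom_surjective x
      rw [← mkRingHom_smul, Algebra.smul_def, map_mul]
      rfl }

instance : Star (Corona A) where
  star := QuotientAddGroup.map (multiplierIdeal A).toAddSubgroup (multiplierIdeal A).toAddSubgroup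
    (starAddEquiv : 𝓜(ℂ, A) ≃+ 𝓜(ℂ, A)).toAddMonoidHom fun _ hm => multiplierIdeal_star_mem hm

lemma mkRingHom_star (m : 𝓜(ℂ, A)) : mkRingHom A (star m) = star (mkRingHom A m) := rfl

instance : StarRing (Corona A) where
  star_involutive x := by
    obtain ⟨m, rfl⟩ := mkRingHom_surjective x
    rw [← mkRingHom_star, ← mkRingHom_star, star_star]
  star_mul x y := by
    obtain ⟨m, rfl⟩ := mkRingHom_surjective x
    obtain ⟨n, rfl⟩ := mkRingHom_surjective y
    rw [← mkRingHom_star, ← mkRingHom_star, ← map_mul, ← map_mul, ← mkRingHom_star, star_mul]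
  star_add x y := by
    obtain ⟨m, rfl⟩ := mkRingHom_surjective x
    obtain ⟨n, rfl⟩ := mkRingHom_surjective y
    rw [← mkRingHom_star, ← mkRingHom_star, ← map_add, ← map_add, ← mkRingHom_star, star_add]

instance : StarModule ℂ (Corona A) where
  star_smul c x := by
    obtain ⟨m, rfl⟩ := mkRingHom_surjective x
    rw [← mkRingHom_star, ← mkRingHom_smul, ← mkRingHom_smul, ← mkRingHom_star, star_smul]

instance : CStarRing (Corona A) where
  norm_mul_self_le x := by
    obtain ⟨m, rfl⟩ := mkRingHom_surjective x
    rw [← mkRingHom_star, ← map_mul]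
    refine le_of_forall_pos_le_add fun ε hε => ?_
    obtain ⟨n, hn, hn'⟩ := exists_norm_lt (mkRingHom A (star m * m)) (half_pos hε)
    obtain ⟨a, ha⟩ : ∃ a : A, toMultiplier A a = star m * m - n :=
      mkRingHom_eq_zero.1 (by rw [map_sub, hn, sub_self])
    let := CStarAlgebra.spectralOrder A
    let := CStarAlgebra.spectralOrderedRing A
    let := CStarAlgebra.spectralOrder 𝓜(ℂ, A)
    let := CStarAlgebra.spectralOrderedRing 𝓜(ℂ, A)
    have hl := CStarAlgebra.increasingApproximateUnit A
    have hne := hl.neBot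
    have h2 : ∀ᶠ u in CStarAlgebra.approximateUnit A, ‖a - a * u‖ < ε / 2 := by
      have := (tendsto_const_nhds (x := a)).sub (hl.tendsto_mul_left a) |>.norm
      simp only [sub_self, norm_zero] at this
      exact this.eventually_lt_const (half_pos hε)
    obtain ⟨u, ⟨hu, hu0⟩, hu1⟩ := (h2.and hl.eventually_nonneg).and hl.eventually_norm |>.exists
    set v : 𝓜(ℂ, A) := toMultiplier A u with hv
    have hv0 : 0 ≤ v := map_nonneg (toMultiplier A) hu0
    have hvn : ‖v‖ ≤ 1 := by
      rw [hv, (AddMonoidHomClass.isometry_iff_norm _).1 (multiplierCoe_isometry A)]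
      exact hu1
    have hv1 : v ≤ 1 := (CStarAlgebra.norm_le_one_iff_of_nonneg v hv0).1 hvn
    have hw : ‖1 - v‖ ≤ 1 :=
      (CStarAlgebra.norm_le_one_iff_of_nonneg (1 - v) (sub_nonneg.2 hv1)).2
        (sub_le_self 1 hv0)
    have hws : star (1 - v) = 1 - v := (IsSelfAdjoint.of_nonneg (sub_nonneg.2 hv1)).star_eq
    have hmv : mkRingHom A (m * (1 - v)) = mkRingHom A m := by
      have : mkRingHom A v = 0 := mkRingHom_eq_zero.2 ⟨u, rfl⟩
      rw [map_mul, map_sub, this, sub_zero, map_one, mul_one]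
    have haw : ‖toMultiplier A a * (1 - v)‖ = ‖a - a * u‖ := by
      rw [← (AddMonoidHomClass.isometry_iff_norm _).1 (multiplierCoe_isometry A) (a - a * u),
        map_sub, map_mul, mul_sub, mul_one]
    calc ‖mkRingHom A m‖ * ‖mkRingHom A m‖
        = ‖mkRingHom A (m * (1 - v))‖ * ‖mkRingHom A (m * (1 - v))‖ := by rw [hmv]
      _ ≤ ‖m * (1 - v)‖ * ‖m * (1 - v)‖ :=
          mul_self_le_mul_self (norm_nonneg _) (norm_mkRingHom_le _)
      _ = ‖star (m * (1 - v)) * (m * (1 - v))‖ := CStarRing.norm_star_mul_self.symm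
      _ = ‖(1 - v) * (n * (1 - v)) + (1 - v) * (toMultiplier A a * (1 - v))‖ := by
          rw [star_mul, hws, ha]; congr 1; noncomm_ring
      _ ≤ ‖(1 - v) * (n * (1 - v))‖ + ‖(1 - v) * (toMultiplier A a * (1 - v))‖ := norm_add_le _ _
      _ ≤ ‖n‖ + ‖a - a * u‖ := by
          gcongr
          · calc _ ≤ ‖1 - v‖ * (‖n‖ * ‖1 - v‖) :=
                  (norm_mul_le _ _).trans (by gcongr; exact norm_mul_le _ _)
              _ ≤ 1 * (‖n‖ * 1) := by gcongr
              _ = ‖n‖ := by ring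
          · calc _ ≤ ‖1 - v‖ * ‖toMultiplier A a * (1 - v)‖ := norm_mul_le _ _
              _ ≤ 1 * ‖toMultiplier A a * (1 - v)‖ := by gcongr
              _ = _ := by rw [one_mul, haw]
      _ ≤ _ := by linarith

instance : CStarAlgebra (Corona A) where

variable (A)

/-- The quotient map `π : M(A) → Q(A)`. -/
def mk : 𝓜(ℂ, A) →⋆ₐ[ℂ] Corona A where
  toFun := mkRingHom A
  map_one' := map_one _
  map_mul' := map_mul _
  map_zero' := map_zero _
  map_add' := map_add _
  commutes' _ := rfl
  map_star' := mkRingHom_star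

end Corona

/-- Convergence of a sequence in the strict topology of the multiplier algebra. -/
def StrictTendsto {A : Type*} [NonUnitalCStarAlgebra A] (u : ℕ → 𝓜(ℂ, A)) (T : 𝓜(ℂ, A)) : Prop :=
  ∀ h : A, Tendsto (fun m => ‖(u m - T) * toMultiplier A h‖) atTop (𝓝 0) ∧
    Tendsto (fun m => ‖toMultiplier A h * (u m - T)‖) atTop (𝓝 0)

end Corona

/-! ### States, pure states, quantum filters, P-states and P-points -/

section States

variable {C : Type*} [NonUnitalCStarAlgebra C]

open scoped ComplexOrder in
/-- The state space of a (possibly nonunital) C⋆-algebra: positive functionals of norm one. -/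
def stateSpace (C : Type*) [NonUnitalCStarAlgebra C] : Set (C →L[ℂ] ℂ) :=
  {φ | (∀ x : C, 0 ≤ φ (star x * x)) ∧ ‖φ‖ = 1}

/-- The pure states: the extreme points of the state space. -/
def pureStates (C : Type*) [NonUnitalCStarAlgebra C] : Set (C →L[ℂ] ℂ) :=
  (stateSpace C).extremePoints ℝ

/-- The positive elements of norm one. -/
def posUnitSphere (C : Type*) [NonUnitalCStarAlgebra C] : Set C :=
  {a | (∃ x : C, a = star x * x) ∧ ‖a‖ = 1}

/-- The relation `a ≪ b`. -/
def MulBelow (a b : C) : Prop := a * b = a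

/-- The set of positive norm-one elements at which `φ` takes the value one. -/
def quantumFilter (φ : C →L[ℂ] ℂ) : Set C := {a ∈ posUnitSphere C | φ a = 1}

/-- Every nonempty finite product `a * b₁ * ⋯ * bₙ` of members of a quantum filter has norm one. -/
def IsQuantumFilter (F : Set C) : Prop :=
  F ⊆ posUnitSphere C ∧ ∀ a ∈ F, ∀ l : List C, (∀ b ∈ l, b ∈ F) → ‖l.foldl (· * ·) a‖ = 1

def IsMaximalQuantumFilter (F : Set C) : Prop := Maximal IsQuantumFilter F

/-- A maximal quantum filter that is upwards closed and countably downwards directed for `≪`. -/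
def IsQuantumPPoint (F : Set C) : Prop :=
  IsMaximalQuantumFilter F ∧
  (∀ a ∈ F, ∀ b ∈ posUnitSphere C, MulBelow a b → b ∈ F) ∧
  ∀ b : ℕ → C, (∀ n, b n ∈ F) → ∃ a ∈ F, ∀ n, MulBelow a (b n)

def IsPState (φ : C →L[ℂ] ℂ) : Prop := IsQuantumPPoint (quantumFilter φ)

/-- An ultrafilter on `ℕ` that is upwards closed and countably downwards directed for inclusion
modulo finite sets. -/
def IsPPoint (U : Ultrafilter ℕ) : Prop :=
  (∀ X ∈ U, ∀ Y : Set ℕ, (X \ Y).Finite → Y ∈ U) ∧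
  ∀ X : ℕ → Set ℕ, (∀ n, X n ∈ U) → ∃ Y ∈ U, ∀ n, (Y \ X n).Finite

end States

/-! ### σ-units of projections -/

section SigmaUnit

variable {A : Type*} [NonUnitalCStarAlgebra A]

/-- `e` is a σ-unit of projections: a strictly increasing sequence of nonzero projections which is
an approximate unit. For projections, `p ≤ q` means `p * q = p`. -/
structure IsSigmaUnitOfProjections (e : ℕ → A) : Prop where
  isStarProjection : ∀ n, IsStarProjection (e n)
  ne_zero : e 0 ≠ 0
  le_succ : ∀ n, e n * e (n + 1) = e n
  ne_succ : ∀ n, e n ≠ e (n + 1)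
  tendsto_mul_left : ∀ a, Tendsto (fun n => e n * a) atTop (𝓝 a)
  tendsto_mul_right : ∀ a, Tendsto (fun n => a * e n) atTop (𝓝 a)

/-- The differences `f n = e n - e (n - 1)`, where `e (-1) = 0`. -/
def increment (e : ℕ → A) : ℕ → A
  | 0 => e 0
  | n + 1 => e (n + 1) - e n

/-- The partial sum of the `f n` over the `n ∈ X` with `n ≤ m`. -/
def partialProj (e : ℕ → A) (X : Set ℕ) (m : ℕ) : A :=
  ∑ n ∈ Finset.range (m + 1), X.indicator (increment e) n

open Classical in
/-- `p_X`: the strict limit in `M(A)` of the partial sums (it exists by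
`IsSigmaUnitOfProjections.strictTendsto_multiplierProj`). -/
def multiplierProj (e : ℕ → A) (X : Set ℕ) : 𝓜(ℂ, A) :=
  if h : ∃ T, StrictTendsto (fun m => toMultiplier A (partialProj e X m)) T then h.choose else 0

namespace IsSigmaUnitOfProjections

variable {e : ℕ → A}

lemma succ_mul (he : IsSigmaUnitOfProjections e) (n : ℕ) : e (n + 1) * e n = e n := by
  have := congrArg star (he.le_succ n)
  rwa [star_mul, (he.isStarProjection _).isSelfAdjoint.star_eq,
    (he.isStarProjection _).isSelfAdjoint.star_eq] at this

lemma mul_of_le (he : IsSigmaUnitOfProjections e) {m n : ℕ} (h : m ≤ n) : e n * e m = e m := by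
  induction n, h using Nat.le_induction with
  | base => exact (he.isStarProjection m).isIdempotentElem
  | succ n _ ih => rw [← ih, ← mul_assoc, he.succ_mul]

lemma isSelfAdjoint_increment (he : IsSigmaUnitOfProjections e) (n : ℕ) :
    IsSelfAdjoint (increment e n) := by
  cases n with
  | zero => exact (he.isStarProjection 0).isSelfAdjoint
  | succ n => exact (he.isStarProjection _).isSelfAdjoint.sub (he.isStarProjection _).isSelfAdjoint

lemma increment_mul_of_le (he : IsSigmaUnitOfProjections e) {m n : ℕ} (h : n ≤ m) :
    increment e n * e m = increment e n := by
  have key : e m * increment e n = increment e n := by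
    cases n with
    | zero => exact he.mul_of_le h
    | succ n =>
      simp only [increment, mul_sub]
      rw [he.mul_of_le h, he.mul_of_le (Nat.le_of_succ_le h)]
  have := congrArg star key
  rwa [star_mul, (he.isStarProjection _).isSelfAdjoint.star_eq,
    (he.isSelfAdjoint_increment _).star_eq] at this

lemma increment_mul_of_lt (he : IsSigmaUnitOfProjections e) {m n : ℕ} (h : m < n) :
    increment e n * e m = 0 := by
  cases n with
  | zero => omega
  | succ n =>
    simp only [increment, sub_mul]
    rw [he.mul_of_le h.le, he.mul_of_le (Nat.lt_succ_iff.1 h), sub_self]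

lemma increment_mul_increment (he : IsSigmaUnitOfProjections e) (n : ℕ) :
    increment e n * increment e n = increment e n := by
  cases n with
  | zero => exact (he.isStarProjection 0).isIdempotentElem
  | succ n =>
    have h1 := he.increment_mul_of_le (le_refl (n + 1))
    have h2 := he.increment_mul_of_lt (Nat.lt_succ_self n)
    conv_lhs => rw [show increment e (n + 1) * increment e (n + 1)
      = increment e (n + 1) * e (n + 1) - increment e (n + 1) * e n from mul_sub _ _ _]
    rw [h1, h2, sub_zero]

lemma partialProj_mul_of_le (he : IsSigmaUnitOfProjections e) (X : Set ℕ) {m N : ℕ} (h : N ≤ m) :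
    partialProj e X m * e N = partialProj e X N := by
  induction m, h using Nat.le_induction with
  | base =>
    simp only [partialProj, Finset.sum_mul]
    refine Finset.sum_congr rfl fun n hn => ?_
    by_cases hX : n ∈ X
    · simpa [hX] using he.increment_mul_of_le (Nat.lt_succ_iff.1 (Finset.mem_range.1 hn))
    · simp [hX]
  | succ m hm ih =>
    rw [partialProj, Finset.sum_range_succ, add_mul]
    rw [partialProj] at ih
    rw [ih]
    by_cases hX : m + 1 ∈ X
    · simp [hX, he.increment_mul_of_lt (Nat.lt_succ_of_le hm)]
    · simp [hX]

lemma isSelfAdjoint_partialProj (he : IsSigmaUnitOfProjections e) (X : Set ℕ) (m : ℕ) :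
    IsSelfAdjoint (partialProj e X m) := by
  refine isSelfAdjoint_sum _ fun n _ => ?_
  by_cases hX : n ∈ X
  · simpa [hX] using he.isSelfAdjoint_increment n
  · simp [hX]

lemma partialProj_mul_self (he : IsSigmaUnitOfProjections e) (X : Set ℕ) (m : ℕ) :
    partialProj e X m * partialProj e X m = partialProj e X m := by
  induction m with
  | zero =>
    by_cases hX : 0 ∈ X
    · simpa [partialProj, hX] using he.increment_mul_increment 0
    · simp [partialProj, hX]
  | succ m ih =>
    have hs : partialProj e X (m + 1)
        = partialProj e X m + X.indicator (increment e) (m + 1) := by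
      simp [partialProj, Finset.sum_range_succ]
    rw [hs]
    by_cases hX : m + 1 ∈ X
    · have hz : partialProj e X m * increment e (m + 1) = 0 := by
        rw [increment, mul_sub, he.partialProj_mul_of_le X le_rfl]
        nth_rw 1 [← he.partialProj_mul_of_le X le_rfl]
        rw [mul_assoc, he.le_succ, he.partialProj_mul_of_le X le_rfl, sub_self]
      have hz' : increment e (m + 1) * partialProj e X m = 0 := by
        have := congrArg star hz
        rwa [star_mul, (he.isSelfAdjoint_increment _).star_eq,
          (he.isSelfAdjoint_partialProj X m).star_eq, star_zero] at this
      simp [hX, add_mul, mul_add, hz, hz', ih, he.increment_mul_increment]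
    · simp [hX, ih]

lemma norm_partialProj_le (he : IsSigmaUnitOfProjections e) (X : Set ℕ) (m : ℕ) :
    ‖partialProj e X m‖ ≤ 1 :=
  IsStarProjection.norm_le _
    ⟨he.partialProj_mul_self X m, he.isSelfAdjoint_partialProj X m⟩

lemma exists_tendsto_partialProj_mul (he : IsSigmaUnitOfProjections e) (X : Set ℕ) (a : A) :
    ∃ b, Tendsto (fun m => partialProj e X m * a) atTop (𝓝 b) := by
  refine cauchySeq_tendsto_of_complete (Metric.cauchySeq_iff'.2 fun ε hε => ?_)
  have h1 : ∀ᶠ n in atTop, ‖e n * a - a‖ < ε / 3 := by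
    simpa [dist_eq_norm] using
      (Metric.tendsto_nhds.1 (he.tendsto_mul_left a)) (ε / 3) (by positivity)
  obtain ⟨N, hN⟩ := h1.exists
  have hb : ∀ m, ‖partialProj e X m * (e N * a - a)‖ ≤ ε / 3 := fun m =>
    calc _ ≤ ‖partialProj e X m‖ * ‖e N * a - a‖ := norm_mul_le _ _
      _ ≤ 1 * (ε / 3) := by
        gcongr
        exact he.norm_partialProj_le X m
      _ = ε / 3 := one_mul _
  refine ⟨N, fun m hm => ?_⟩
  have hd : partialProj e X m * a - partialProj e X N * a
      = partialProj e X N * (e N * a - a) - partialProj e X m * (e N * a - a) := by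
    rw [mul_sub, mul_sub, ← mul_assoc, ← mul_assoc, he.partialProj_mul_of_le X hm,
      he.partialProj_mul_of_le X le_rfl]
    abel
  rw [dist_eq_norm, hd]
  calc _ ≤ _ := norm_sub_le _ _
    _ ≤ ε / 3 + ε / 3 := add_le_add (hb N) (hb m)
    _ < ε := by linarith

lemma exists_tendsto_mul_partialProj (he : IsSigmaUnitOfProjections e) (X : Set ℕ) (a : A) :
    ∃ b, Tendsto (fun m => a * partialProj e X m) atTop (𝓝 b) := by
  obtain ⟨b, hb⟩ := he.exists_tendsto_partialProj_mul X (star a)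
  refine ⟨star b, ?_⟩
  simpa [star_mul, (he.isSelfAdjoint_partialProj X _).star_eq] using hb.star

lemma exists_strictTendsto (he : IsSigmaUnitOfProjections e) (X : Set ℕ) :
    ∃ T, StrictTendsto (fun m => toMultiplier A (partialProj e X m)) T := by
  choose L hL using he.exists_tendsto_partialProj_mul X
  choose R hR using he.exists_tendsto_mul_partialProj X
  have hL' : Tendsto (fun m x => ContinuousLinearMap.mul ℂ A (partialProj e X m) x) atTop (𝓝 L) :=
    tendsto_pi_nhds.2 hL
  have hR' : Tendsto (fun m x => (ContinuousLinearMap.mul ℂ A).flip (partialProj e X m) x)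
      atTop (𝓝 R) := tendsto_pi_nhds.2 hR
  let T : 𝓜(ℂ, A) :=
    { fst := continuousLinearMapOfTendsto _ hL'
      snd := continuousLinearMapOfTendsto _ hR'
      central := fun x y => by
        have h1 := (hR x).mul_const y
        simp only [mul_assoc] at h1
        exact tendsto_nhds_unique h1 ((hL y).const_mul x) }
  have hn := (AddMonoidHomClass.isometry_iff_norm _).1 (multiplierCoe_isometry A)
  refine ⟨T, fun h => ⟨?_, ?_⟩⟩
  · have hc : ∀ m, ‖(toMultiplier A (partialProj e X m) - T) * toMultiplier A h‖
        = ‖partialProj e X m * h - L h‖ := fun m => by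
      rw [mul_toMultiplier, hn]
      rfl
    simp only [hc]
    simpa using ((hL h).sub_const (L h)).norm
  · have hc : ∀ m, ‖toMultiplier A h * (toMultiplier A (partialProj e X m) - T)‖
        = ‖h * partialProj e X m - R h‖ := fun m => by
      rw [toMultiplier_mul, hn]
      rfl
    simp only [hc]
    simpa using ((hR h).sub_const (R h)).norm

lemma strictTendsto_multiplierProj (he : IsSigmaUnitOfProjections e) (X : Set ℕ) :
    StrictTendsto (fun m => toMultiplier A (partialProj e X m)) (multiplierProj e X) := by
  rw [multiplierProj, dif_pos (he.exists_strictTendsto X)]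
  exact (he.exists_strictTendsto X).choose_spec

end IsSigmaUnitOfProjections

/-- The family `𝒳_φ` of the sets `X ⊆ ℕ` with `φ (π p_X) = 1`. -/
def coronaSets (e : ℕ → A) (φ : Corona A →L[ℂ] ℂ) : Set (Set ℕ) :=
  {X | φ (Corona.mk A (multiplierProj e X)) = 1}

end SigmaUnit
end

/-! Cutting down. Let `ψ n` be a pure state with value one at the projection `f n`. Cauchy–Schwarz
gives `ψ n (a) = ψ n (f n * a * f n)`, and any state of `M(A)` with value one at `f n` has the same
property. Since `f n * m * f n` lies in `A`, this formula defines the extension and forces its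
uniqueness; purity passes up because the value one at `f n` is inherited by the components of a
convex combination. Along a nonprincipal ultrafilter the extensions tend to zero on `A`, as `‖a * f
n‖ → 0`, so the limit lives on the corona. The `n`-th extension takes the value one or zero at `p_X`
according to whether `n ∈ X`; this recovers the ultrafilter, hence injectivity.

Purity of the limit. It suffices that a state `Θ` with `α Θ ≤ Φ` for some `α > 0` vanishes at every
self-adjoint `m` with `Φ m = 0` (`eq_zero_of_dominated`). Excision of each pure extension yields a
positive contraction `b n` in the corner of `f n`, at which the state is almost one and for which `m
* b n ^ 2 * m` has a small value along the ultrafilter. The values of the `n`-th state at `m * b k ^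
2 * m` with `k ≠ n` need not be small, but they are summable in `k` with a uniform bound. A
colouring of `ℕ` by `r ^ 2` colours (`exists_coloring`) makes the sum over `k ≠ n` of the colour of
`n` at most a constant times `2 / r`. Let `T` be the block-diagonal sum of the `b k` over the colour
chosen by the ultrafilter. Then `Φ` and `Θ` are one at `T`, so `Θ m = Θ (T * m)`, while `Φ (m * T ^
2 * m) = O(1 / r)`; let `r → ∞`.

P-points. The quantum filter of a pure state is always maximal and upwards closed: a pure state is
determined by its filter (`eq_of_quantumFilter_subset`), and a quantum filter containing the unit
lies in the filter of a state. Only countable directedness depends on the ultrafilter. A lower bound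
of the projections `π(p_X)` yields a pseudo-intersection. Conversely, countably many members of the
filter are coded by one positive `D` with limit value zero. A P-point gives a set along which the
values at `D` decay to zero in the ordinary sense. Grouping the `f n` into long blocks makes `D`
almost tridiagonal, and cut-offs of its diagonal blocks, taken over the blocks of one parity,
annihilate `D` modulo `A` (`exists_annihilator_of_isPPoint`). -/

noncomputable section

/-! ### Positive functionals -/

section PositiveFunctionals

open scoped ComplexOrder

/-- Positivity of a bounded functional on a C⋆-algebra. -/
def IsPosFunctional {C : Type*} [NonUnitalCStarAlgebra C] (φ : C →L[ℂ] ℂ) : Prop :=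
  ∀ x : C, 0 ≤ φ (star x * x)

namespace IsPosFunctional

section NonUnital

variable {C : Type*} [NonUnitalCStarAlgebra C] {φ : C →L[ℂ] ℂ}

section Order

variable [PartialOrder C] [StarOrderedRing C]

lemma nonneg (h : IsPosFunctional φ) {x : C} (hx : 0 ≤ x) : 0 ≤ φ x := by
  obtain ⟨y, rfl⟩ := CStarAlgebra.nonneg_iff_eq_star_mul_self.1 hx
  exact h y

lemma re_nonneg (h : IsPosFunctional φ) {x : C} (hx : 0 ≤ x) : 0 ≤ (φ x).re :=
  (Complex.le_def.1 (h.nonneg hx)).1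

lemma re_mono (h : IsPosFunctional φ) {x y : C} (hxy : x ≤ y) : (φ x).re ≤ (φ y).re := by
  have := h.re_nonneg (sub_nonneg.2 hxy)
  rw [map_sub, Complex.sub_re] at this
  linarith

lemma of_nonneg (h : ∀ x : C, 0 ≤ x → 0 ≤ φ x) : IsPosFunctional φ :=
  fun x => h _ (star_mul_self_nonneg x)

variable (φ) in
/-- A positive functional as a positive linear map. -/
def toPositiveLinearMap (h : IsPosFunctional φ) : C →ₚ[ℂ] ℂ :=
  PositiveLinearMap.mk₀ φ.toLinearMap fun _ hx => h.nonneg hx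

end Order

lemma map_star (h : IsPosFunctional φ) (x : C) : φ (star x) = star (φ x) := by
  let := CStarAlgebra.spectralOrder C
  let := CStarAlgebra.spectralOrderedRing C
  exact StarHomClass.map_star (h.toPositiveLinearMap φ) x

lemma im_eq_zero (h : IsPosFunctional φ) {x : C} (hx : IsSelfAdjoint x) : (φ x).im = 0 := by
  have := h.map_star x
  rw [hx.star_eq] at this
  exact Complex.conj_eq_iff_im.1 this.symm

lemma ofReal_re (h : IsPosFunctional φ) {x : C} (hx : IsSelfAdjoint x) : ((φ x).re : ℂ) = φ x :=
  Complex.ext rfl (by simp [h.im_eq_zero hx])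

lemma self_re_nonneg (h : IsPosFunctional φ) (x : C) : 0 ≤ (φ (star x * x)).re :=
  (Complex.le_def.1 (h x)).1

/-- The Cauchy–Schwarz inequality. -/
lemma norm_sq_le (h : IsPosFunctional φ) (x y : C) :
    ‖φ (star x * y)‖ ^ 2 ≤ (φ (star x * x)).re * (φ (star y * y)).re := by
  let := CStarAlgebra.spectralOrder C
  let := CStarAlgebra.spectralOrderedRing C
  let f := h.toPositiveLinearMap φ
  have key := norm_inner_le_norm (𝕜 := ℂ) (f.toPreGNS x) (f.toPreGNS y)
  have h1 : ‖φ (star x * y)‖ ≤ √(φ (star x * x)).re * √(φ (star y * y)).re := key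
  calc _ ≤ (√(φ (star x * x)).re * √(φ (star y * y)).re) ^ 2 := by gcongr
    _ = _ := by rw [mul_pow, Real.sq_sqrt (h.self_re_nonneg x), Real.sq_sqrt (h.self_re_nonneg y)]

lemma mul_eq_zero_of_self (h : IsPosFunctional φ) {z : C} (hz : (φ (star z * z)).re = 0) (w : C) :
    φ (w * z) = 0 := by
  have := h.norm_sq_le (star w) z
  rw [hz, mul_zero, star_star] at this
  simpa using this

lemma star_mul_eq_zero_of_self (h : IsPosFunctional φ) {z : C} (hz : (φ (star z * z)).re = 0)
    (w : C) : φ (star z * w) = 0 := by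
  have := h.norm_sq_le z w
  rw [hz, zero_mul] at this
  simpa using this

end NonUnital

section Unital

variable {C : Type*} [CStarAlgebra C] {φ : C →L[ℂ] ℂ}

lemma norm_sq_le_one (h : IsPosFunctional φ) (h1 : φ 1 = 1) (x : C) :
    ‖φ x‖ ^ 2 ≤ (φ (star x * x)).re := by
  simpa [h1] using h.norm_sq_le 1 x

lemma self_le (h : IsPosFunctional φ) (x : C) :
    (φ (star x * x)).re ≤ (φ 1).re * ‖x‖ ^ 2 := by
  let := CStarAlgebra.spectralOrder C
  let := CStarAlgebra.spectralOrderedRing C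
  have := h.re_mono (CStarAlgebra.star_mul_le_algebraMap_norm_sq (a := x))
  rw [Algebra.algebraMap_eq_smul_one, ← Complex.coe_smul, map_smul, smul_eq_mul,
    Complex.re_ofReal_mul] at this
  linarith

lemma one_re_nonneg (h : IsPosFunctional φ) : 0 ≤ (φ 1).re := by
  simpa using h.self_re_nonneg 1

lemma norm_le_one_re (h : IsPosFunctional φ) : ‖φ‖ ≤ (φ 1).re := by
  refine φ.opNorm_le_bound h.one_re_nonneg fun x => ?_
  have h1 := h.norm_sq_le 1 x
  have h2 := h.self_le x
  simp only [star_one, one_mul] at h1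
  refine abs_le_of_sq_le_sq' ?_ (mul_nonneg h.one_re_nonneg (norm_nonneg _)) |>.2
  nlinarith [h.one_re_nonneg]

lemma norm_eq_one (h : IsPosFunctional φ) (h1 : φ 1 = 1) : ‖φ‖ = 1 := by
  refine le_antisymm (h.norm_le_one_re.trans (by simp [h1])) ?_
  have := φ.le_opNorm 1
  rw [h1, norm_one] at this
  have h2 : ‖(1 : C)‖ ≤ 1 := (IsStarProjection.one (R := C)).norm_le _
  nlinarith [norm_nonneg φ]

lemma apply_one_of_norm (h : IsPosFunctional φ) (hn : ‖φ‖ = 1) : φ 1 = 1 := by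
  have h1 := h.norm_le_one_re
  have h2 := φ.le_opNorm 1
  have h3 : ‖(1 : C)‖ ≤ 1 := (IsStarProjection.one (R := C)).norm_le _
  have h4 := Complex.re_le_norm (φ 1)
  rw [hn] at h1 h2
  rw [← h.ofReal_re (IsSelfAdjoint.one C)]
  have : (φ 1).re = 1 := by linarith
  simp [this]

end Unital

end IsPosFunctional

lemma mem_stateSpace_iff {C : Type*} [CStarAlgebra C] {φ : C →L[ℂ] ℂ} :
    φ ∈ stateSpace C ↔ IsPosFunctional φ ∧ φ 1 = 1 :=
  ⟨fun h => ⟨h.1, IsPosFunctional.apply_one_of_norm h.1 h.2⟩, fun h => ⟨h.1, h.1.norm_eq_one h.2⟩⟩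

section Unital

variable {C : Type*} [CStarAlgebra C] [PartialOrder C] [StarOrderedRing C] {φ : C →L[ℂ] ℂ}

lemma sq_le_self_of_mem_Icc {a : C} (h0 : 0 ≤ a) (h1 : a ≤ 1) : a * a ≤ a := by
  have := CStarAlgebra.pow_antitone h0 h1 (show 1 ≤ 2 by norm_num)
  simpa [pow_two] using this

lemma one_sub_sq_le {a : C} (h0 : 0 ≤ a) (h1 : a ≤ 1) : (1 - a) * (1 - a) ≤ 1 - a :=
  sq_le_self_of_mem_Icc (sub_nonneg.2 h1) (sub_le_self 1 h0)

namespace IsPosFunctional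

/-- Since `(1 - a)² ≤ 1 - a`, the element `1 - a` lies in the left kernel of `φ`. Consequently a
positive contraction at which a state is one can be inserted or removed on either side. -/
lemma apply_mul_one_sub (h : IsPosFunctional φ) {a : C} (h0 : 0 ≤ a) (h1 : a ≤ 1)
    (ha : (φ a).re = (φ 1).re) (x : C) : φ (x * (1 - a)) = 0 := by
  refine h.mul_eq_zero_of_self (le_antisymm ?_ (h.self_re_nonneg _)) x
  rw [((IsSelfAdjoint.one C).sub (IsSelfAdjoint.of_nonneg h0)).star_eq]
  refine (h.re_mono (one_sub_sq_le h0 h1)).trans ?_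
  simp [ha]

lemma apply_mul_right (h : IsPosFunctional φ) {a : C} (h0 : 0 ≤ a) (h1 : a ≤ 1)
    (ha : (φ a).re = (φ 1).re) (x : C) : φ (x * a) = φ x := by
  have := h.apply_mul_one_sub h0 h1 ha x
  rw [mul_sub, mul_one, map_sub, sub_eq_zero] at this
  exact this.symm

lemma apply_mul_left (h : IsPosFunctional φ) {a : C} (h0 : 0 ≤ a) (h1 : a ≤ 1)
    (ha : (φ a).re = (φ 1).re) (x : C) : φ (a * x) = φ x := by
  have := h.apply_mul_right h0 h1 ha (star x)
  rw [← (IsSelfAdjoint.of_nonneg h0).star_eq, ← star_mul, h.map_star, h.map_star] at this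
  exact star_injective this

lemma re_le_one (h : IsPosFunctional φ) (h1 : φ 1 = 1) {a : C} (ha : a ≤ 1) : (φ a).re ≤ 1 := by
  simpa [h1] using h.re_mono ha

end IsPosFunctional

/-- A functional of norm at most one which takes the value one at a positive contraction is a
state. -/
lemma mem_stateSpace_of_apply_eq_one {η : C →L[ℂ] ℂ} (hη : ‖η‖ ≤ 1) {s : C} (h0 : 0 ≤ s)
    (h1 : s ≤ 1) (hs : η s = 1) : η ∈ stateSpace C := by
  have hss : IsSelfAdjoint s := .of_nonneg h0
  have hone : η 1 = 1 := by
    obtain ⟨z, hz, hz'⟩ : ∃ z : ℂ, ‖z‖ = 1 ∧ z * η (1 - s) = ‖η (1 - s)‖ := by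
      by_cases h : η (1 - s) = 0
      · exact ⟨1, by simp [h]⟩
      · exact ⟨‖η (1 - s)‖ / η (1 - s), by rw [norm_div, Complex.norm_real, norm_norm, div_self (norm_ne_zero_iff.2 h)], by field_simp⟩
    -- In the commutative algebra generated by `s` and `1` this is a pointwise convex combination of
    -- `1` and `z`. Applying `η` then gives `1 + ‖η (1 - s)‖ ≤ 1`.
    have hnorm : ‖s + z • (1 - s)‖ ≤ 1 := by
      have hp : 0 ≤ s * (1 - s) := by
        have := sub_nonneg.2 (sq_le_self_of_mem_Icc h0 h1)
        simpa [mul_sub] using this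
      have hzr : (2 * z.re : ℝ) ≤ 2 := by
        have := Complex.re_le_norm z; linarith
      have hstar : star (s + z • (1 - s)) * (s + z • (1 - s))
          = s * s + (1 - s) * (1 - s) + (2 * z.re : ℝ) • (s * (1 - s)) := by
        have hzz : star z * z = 1 := by
          rw [Complex.star_def, mul_comm, Complex.mul_conj, Complex.normSq_eq_norm_sq, hz]; simp
        have hcm : (1 - s) * s = s * (1 - s) := by noncomm_ring
        have hzr' : ((2 * z.re : ℝ) : ℂ) = z + star z := by
          rw [Complex.star_def, Complex.add_conj]
        rw [star_add, star_smul, star_sub, star_one, hss.star_eq, ← Complex.coe_smul, hzr',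
          add_mul, mul_add, mul_add, smul_mul_smul_comm, hzz, one_smul, mul_smul_comm,
          smul_mul_assoc, hcm, add_smul]
        abel
      have hle : star (s + z • (1 - s)) * (s + z • (1 - s)) ≤ 1 := by
        rw [hstar]
        calc _ ≤ s * s + (1 - s) * (1 - s) + (2 : ℝ) • (s * (1 - s)) := by
              gcongr
          _ = 1 := by rw [two_smul]; noncomm_ring
      have := (CStarAlgebra.norm_le_one_iff_of_nonneg _ (star_mul_self_nonneg _)).2 hle
      rw [CStarRing.norm_star_mul_self] at this
      nlinarith [norm_nonneg (s + z • (1 - s))]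
    have h2 : ‖η (s + z • (1 - s))‖ ≤ 1 :=
      (η.le_opNorm _).trans (mul_le_one₀ hη (norm_nonneg _) hnorm)
    rw [map_add, map_smul, hs, smul_eq_mul, hz'] at h2
    have h3 := (Complex.re_le_norm _).trans h2
    have h4 : ‖η (1 - s)‖ = 0 := by
      simp at h3
      simp [h3]
    rw [norm_eq_zero, map_sub, hs, sub_eq_zero] at h4
    exact h4
  have him : ∀ x : C, IsSelfAdjoint x → (η x).im = 0 := by
    intro x hx
    -- Evaluate `η` at `x + i t`; after cancelling `t ^ 2` the left side is unbounded in `t` unless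
    -- the imaginary part is zero.
    have key : ∀ t : ℝ, ((η x).im + t) ^ 2 ≤ ‖x‖ ^ 2 + t ^ 2 := by
      intro t
      have e1 : star (x + (Complex.I * t) • (1 : C)) * (x + (Complex.I * t) • (1 : C))
          = x * x + ((t ^ 2 : ℝ) : ℂ) • (1 : C) := by
        rw [star_add, star_smul, hx.star_eq, star_one, add_mul, mul_add, mul_add,
          smul_mul_smul_comm, mul_smul_comm, smul_mul_assoc]
        have : star (Complex.I * t) = -(Complex.I * t) := by simp
        have e2 : -(Complex.I * t) * (Complex.I * t) = ((t ^ 2 : ℝ) : ℂ) := by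
          push_cast; linear_combination (-(t : ℂ) ^ 2) * Complex.I_sq
        rw [this, e2]
        simp
      have e3 : ‖x + (Complex.I * t) • (1 : C)‖ ^ 2 ≤ ‖x‖ ^ 2 + t ^ 2 := by
        rw [sq, ← CStarRing.norm_star_mul_self, e1]
        refine (norm_add_le _ _).trans ?_
        have h3 : ‖(1 : C)‖ ≤ 1 := (IsStarProjection.one (R := C)).norm_le _
        refine add_le_add (by simpa [sq] using norm_mul_le x x) ?_
        rw [norm_smul, Complex.norm_real, Real.norm_of_nonneg (sq_nonneg t)]
        nlinarith [sq_nonneg t]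
      have e4 : ‖η (x + (Complex.I * t) • (1 : C))‖ ≤ ‖x + (Complex.I * t) • (1 : C)‖ :=
        (η.le_opNorm _).trans (mul_le_of_le_one_left (norm_nonneg _) hη)
      have e5 : |(η x).im + t| ≤ ‖η (x + (Complex.I * t) • (1 : C))‖ := by
        refine le_trans (le_of_eq ?_) (Complex.abs_im_le_norm _)
        simp [hone]
      calc ((η x).im + t) ^ 2 = |(η x).im + t| ^ 2 := (sq_abs _).symm
        _ ≤ ‖x + (Complex.I * t) • (1 : C)‖ ^ 2 := by gcongr; exact e5.trans e4
        _ ≤ _ := e3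
    by_contra hne
    -- For this `t` the cross term equals `‖x‖ ^ 2 + 1`, which exceeds the bound.
    have := key ((‖x‖ ^ 2 + 1) / (2 * (η x).im))
    have e : 2 * (η x).im * ((‖x‖ ^ 2 + 1) / (2 * (η x).im)) = ‖x‖ ^ 2 + 1 := by field_simp
    nlinarith [sq_nonneg (η x).im]
  rw [mem_stateSpace_iff]
  refine ⟨?_, hone⟩
  refine IsPosFunctional.of_nonneg fun x hx => ?_
  have hsx : IsSelfAdjoint x := .of_nonneg hx
  rw [Complex.le_def]
  refine ⟨?_, (him x hsx).symm⟩
  by_cases hx0 : x = 0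
  · simp [hx0]
  have hnx : 0 < ‖x‖ := norm_pos_iff.2 hx0
  have hle : x ≤ algebraMap ℝ C ‖x‖ := hsx.le_algebraMap_norm_self
  -- The value `η x` lies within `‖x‖` of `‖x‖`, so its real part is nonnegative.
  have h5 : ‖algebraMap ℝ C ‖x‖ - x‖ ≤ ‖x‖ := by
    rw [CStarAlgebra.norm_le_iff_le_algebraMap _ hnx.le (sub_nonneg.2 hle)]
    exact sub_le_self _ hx
  have h6 : ‖η (algebraMap ℝ C ‖x‖ - x)‖ ≤ ‖x‖ :=
    ((η.le_opNorm _).trans (mul_le_of_le_one_left (norm_nonneg _) hη)).trans h5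
  rw [map_sub, Algebra.algebraMap_eq_smul_one, ← Complex.coe_smul, map_smul, hone] at h6
  have h7 := (Complex.re_le_norm _).trans h6
  simp at h7
  simpa using h7

end Unital

end PositiveFunctionals

/-! ### Excision of pure states -/

section Excision

open scoped ComplexOrder ComplexStarModule

variable {C : Type*} [CStarAlgebra C]

/-- The Radon–Nikodym property of pure states. -/
lemma eq_smul_of_add_eq_pure {φ F₁ F₂ : C →L[ℂ] ℂ} (hφ : φ ∈ pureStates C)
    (h₁ : IsPosFunctional F₁) (h₂ : IsPosFunctional F₂) (h : F₁ + F₂ = φ) :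
    F₁ = (F₁ 1).re • φ := by
  have hφs := (mem_stateSpace_iff.1 hφ.1)
  have hsum : (F₁ 1).re + (F₂ 1).re = 1 := by
    have := congrArg Complex.re (congrArg (fun f : C →L[ℂ] ℂ => f 1) h)
    simpa [hφs.2] using this
  rcases h₁.one_re_nonneg.eq_or_lt with ht | ht
  · have : F₁ = 0 := by
      have := h₁.norm_le_one_re
      rw [← ht] at this
      exact norm_le_zero_iff.1 this
    rw [← ht, this]
    ext x
    simp
  rcases h₂.one_re_nonneg.eq_or_lt with hs | hs
  · have h0 : F₂ = 0 := by
      have := h₂.norm_le_one_re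
      rw [← hs] at this
      exact norm_le_zero_iff.1 this
    rw [← hs, add_zero] at hsum
    rw [hsum, one_smul, ← h, h0, add_zero]
  have hst : ∀ F : C →L[ℂ] ℂ, IsPosFunctional F → 0 < (F 1).re →
      (F 1).re⁻¹ • F ∈ stateSpace C := by
    intro F hF hF0
    refine mem_stateSpace_iff.2 ⟨fun x => ?_, ?_⟩
    · have := hF x
      rw [_root_.smul_apply]
      exact smul_nonneg (by positivity) this
    · rw [_root_.smul_apply, ← hF.ofReal_re (IsSelfAdjoint.one C), Complex.real_smul]
      simp only [Complex.ofReal_re]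
      push_cast
      field_simp
  have hmem : φ ∈ openSegment ℝ ((F₁ 1).re⁻¹ • F₁) ((F₂ 1).re⁻¹ • F₂) := by
    refine ⟨(F₁ 1).re, (F₂ 1).re, ht, hs, hsum, ?_⟩
    rw [smul_smul, smul_smul, mul_inv_cancel₀ ht.ne', mul_inv_cancel₀ hs.ne', one_smul, one_smul, h]
  have := (mem_extremePoints.1 hφ).2 _ (hst _ h₁ ht) _ (hst _ h₂ hs) hmem
  rw [← this.1, smul_smul, mul_inv_cancel₀ ht.ne', one_smul]

variable [PartialOrder C] [StarOrderedRing C]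

/-- A real-linear functional that is positive and vanishes at skew-adjoint elements is the real
part of a positive functional. -/
lemma exists_isPosFunctional_re_eq (θ : C →ₗ[ℝ] ℝ) (h0 : ∀ x, 0 ≤ x → 0 ≤ θ x)
    (hI : ∀ x, IsSelfAdjoint x → θ (Complex.I • x) = 0) :
    ∃ F : C →L[ℂ] ℂ, IsPosFunctional F ∧ ∀ x, (F x).re = θ x := by
  let f : C →ₗ[ℂ] ℂ := Module.Dual.extendRCLike θ
  have hf : ∀ x, f x = θ x - Complex.I * θ (Complex.I • x) := fun x =>
    Module.Dual.extendRCLike_apply (𝕜 := ℂ) θ x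
  have hpos : ∀ x, 0 ≤ x → 0 ≤ f x := by
    intro x hx
    rw [hf, hI x (.of_nonneg hx)]
    simpa using h0 x hx
  let p : C →ₚ[ℂ] ℂ := PositiveLinearMap.mk₀ f hpos
  have hc : Continuous p := map_continuous p
  refine ⟨⟨f, hc⟩, IsPosFunctional.of_nonneg hpos, fun x => ?_⟩
  change (f x).re = _
  rw [hf]
  simp

/-- The values of `φ` at the self-adjoint upper bounds of the real parts of two elements. -/
def upperBoundValues (φ : C →L[ℂ] ℂ) (y : C × C) : Set ℝ :=
  {r | ∃ h : C, (ℜ y.1 : C) ≤ h ∧ (ℜ y.2 : C) ≤ h ∧ (φ h).re = r}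

variable {φ : C →L[ℂ] ℂ}

lemma upperBoundValues_nonempty (y : C × C) : (upperBoundValues φ y).Nonempty := by
  refine ⟨_, algebraMap ℝ C (max ‖(ℜ y.1 : C)‖ ‖(ℜ y.2 : C)‖), ?_, ?_, rfl⟩
  · exact (ℜ y.1).2.le_algebraMap_norm_self.trans (algebraMap_mono C (le_max_left _ _))
  · exact (ℜ y.2).2.le_algebraMap_norm_self.trans (algebraMap_mono C (le_max_right _ _))

lemma upperBoundValues_bddBelow (hφ : IsPosFunctional φ) (y : C × C) :
    BddBelow (upperBoundValues φ y) := by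
  refine ⟨(φ (ℜ y.1 : C)).re, ?_⟩
  rintro _ ⟨h, h1, -, rfl⟩
  exact hφ.re_mono h1

lemma upperBoundValues_smul_le (hφ : IsPosFunctional φ) {c : ℝ} (hc : 0 < c) (y : C × C) :
    sInf (upperBoundValues φ (c • y)) ≤ c * sInf (upperBoundValues φ y) := by
  rw [← div_le_iff₀' hc]
  refine le_csInf (upperBoundValues_nonempty y) ?_
  rintro _ ⟨h, h1, h2, rfl⟩
  rw [div_le_iff₀' hc]
  refine csInf_le (upperBoundValues_bddBelow hφ _) ⟨c • h, ?_, ?_, ?_⟩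
  · simpa using smul_le_smul_of_nonneg_left h1 hc.le
  · simpa using smul_le_smul_of_nonneg_left h2 hc.le
  · rw [← Complex.coe_smul, map_smul, smul_eq_mul, Complex.re_ofReal_mul]

/-- A self-adjoint element at which a pure state vanishes has upper bounds, common with its
negative, at which the state is arbitrarily small. -/
lemma exists_abs_le_of_pure (hφ : φ ∈ pureStates C) {y : C} (hy : IsSelfAdjoint y)
    (hy0 : φ y = 0) {ε : ℝ} (hε : 0 < ε) : ∃ h : C, y ≤ h ∧ -y ≤ h ∧ (φ h).re ≤ ε := by
  have hpos : IsPosFunctional φ := hφ.1.1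
  by_cases hy' : y = 0
  · exact ⟨0, by simp [hy'], by simp [hy'], by simpa using hε.le⟩
  -- The claim amounts to `N (y, -y) ≤ 0`. As `N` is sublinear, Hahn–Banach gives a linear
  -- functional below `N` that attains `N (y, -y)`; its two coordinates turn out to be positive
  -- functionals with sum `φ`.
  let N : C × C → ℝ := fun y => sInf (upperBoundValues φ y)
  have hN_le : ∀ (z : C × C) (h : C), (ℜ z.1 : C) ≤ h → (ℜ z.2 : C) ≤ h → N z ≤ (φ h).re :=
    fun z h h1 h2 => csInf_le (upperBoundValues_bddBelow hpos _) ⟨h, h1, h2, rfl⟩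
  have hN_hom : ∀ c : ℝ, 0 < c → ∀ x, N (c • x) = c * N x := by
    intro c hc x
    refine le_antisymm (upperBoundValues_smul_le hpos hc x) ?_
    have := upperBoundValues_smul_le hpos (inv_pos.2 hc) (c • x)
    rw [smul_smul, inv_mul_cancel₀ hc.ne', one_smul] at this
    rwa [← le_inv_mul_iff₀ hc]
  have hN_add : ∀ x z, N (x + z) ≤ N x + N z := by
    intro x z
    rw [← sub_le_iff_le_add]
    refine le_csInf (upperBoundValues_nonempty x) ?_
    rintro _ ⟨h, h1, h2, rfl⟩
    rw [sub_le_comm]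
    refine le_csInf (upperBoundValues_nonempty z) ?_
    rintro _ ⟨k, k1, k2, rfl⟩
    have := hN_le (x + z) (h + k) (by simpa using add_le_add h1 k1) (by simpa using add_le_add h2 k2)
    rw [map_add, Complex.add_re] at this
    linarith
  have hN0 : N 0 = 0 := by
    have := hN_hom 2 (by norm_num) 0
    rw [smul_zero] at this
    linarith
  have hv : ((y, -y) : C × C) ≠ 0 := fun h => hy' (congrArg Prod.fst h)
  obtain ⟨g, hg, hgN⟩ := exists_extension_of_le_sublinear
    (LinearPMap.mkSpanSingleton (K := ℝ) ((y, -y) : C × C) (N (y, -y)) hv) N hN_hom hN_add (by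
      rintro ⟨x, hx⟩
      obtain ⟨c, rfl⟩ := Submodule.mem_span_singleton.1 hx
      rw [LinearPMap.mkSpanSingleton'_apply _ _ _ c hx]
      change c • N (y, -y) ≤ N (c • (y, -y))
      rw [smul_eq_mul]
      rcases lt_trichotomy c 0 with hc | rfl | hc
      · have h1 := hN_add (c • (y, -y)) ((-c) • (y, -y))
        rw [← add_smul, add_neg_cancel, zero_smul, hN0, hN_hom _ (neg_pos.2 hc)] at h1
        linarith
      · simp [hN0]
      · rw [hN_hom c hc])
  have hgv : g (y, -y) = N (y, -y) := by
    have := hg ⟨(y, -y), Submodule.mem_span_singleton_self _⟩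
    rw [this]
    exact LinearPMap.mkSpanSingleton_apply ℝ ℝ hv _
  let θ₁ : C →ₗ[ℝ] ℝ := g ∘ₗ LinearMap.inl ℝ C C
  let θ₂ : C →ₗ[ℝ] ℝ := g ∘ₗ LinearMap.inr ℝ C C
  have hθ₁ : ∀ x, (ℜ x : C) ≤ 0 → θ₁ x ≤ 0 := fun x hx => by
    have := (hgN (x, 0)).trans (hN_le _ 0 hx (by simp))
    exact this.trans_eq (by simp)
  have hθ₂ : ∀ x, (ℜ x : C) ≤ 0 → θ₂ x ≤ 0 := fun x hx => by
    have := (hgN (0, x)).trans (hN_le _ 0 (by simp) hx)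
    exact this.trans_eq (by simp)
  have key : ∀ θ : C →ₗ[ℝ] ℝ, (∀ x, (ℜ x : C) ≤ 0 → θ x ≤ 0) →
      ∃ F : C →L[ℂ] ℂ, IsPosFunctional F ∧ ∀ x, (F x).re = θ x := by
    intro θ hθ
    refine exists_isPosFunctional_re_eq θ (fun x hx => ?_) fun x hx => ?_
    · have := hθ (-x) (by
        rw [map_neg, NegMemClass.coe_neg, (IsSelfAdjoint.of_nonneg hx).coe_realPart]
        simpa using hx)
      simpa using this
    · have e : (ℜ (Complex.I • x) : C) = 0 := by
        rw [realPart_I_smul, hx.imaginaryPart]; simp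
      refine le_antisymm (hθ _ e.le) ?_
      have := hθ (-(Complex.I • x)) (by rw [map_neg, NegMemClass.coe_neg, e, neg_zero])
      simpa using this
  obtain ⟨F₁, hF₁, hF₁'⟩ := key θ₁ hθ₁
  obtain ⟨F₂, hF₂, hF₂'⟩ := key θ₂ hθ₂
  -- On the diagonal the real part of `x` is itself an admissible upper bound. Replacing `x` by `-x`
  -- turns this inequality into an equality.
  have hsum_le : ∀ x, θ₁ x + θ₂ x ≤ (φ x).re := fun x => by
    have h1 := (hgN (x, x)).trans (hN_le (x, x) (ℜ x : C) le_rfl le_rfl)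
    have h2 : θ₁ x + θ₂ x = g (x, x) := by
      simp only [θ₁, θ₂, LinearMap.comp_apply, ← map_add]
      simp
    rw [h2]
    refine h1.trans (le_of_eq ?_)
    conv_rhs => rw [← realPart_add_I_smul_imaginaryPart x]
    rw [map_add, map_smul, smul_eq_mul, Complex.add_re, Complex.I_mul_re,
      hpos.im_eq_zero (ℑ x).2]
    simp
  have hsum : F₁ + F₂ = φ := by
    have hre : ∀ x, (F₁ x + F₂ x).re = (φ x).re := fun x => by
      rw [Complex.add_re, hF₁', hF₂']
      refine le_antisymm (hsum_le x) ?_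
      have := hsum_le (-x)
      simp only [map_neg, Complex.neg_re] at this
      linarith
    ext x
    refine Complex.ext (hre x) ?_
    have := hre (Complex.I • x)
    simp only [map_smul, smul_eq_mul, ← mul_add, Complex.I_mul_re] at this
    exact neg_injective this
  have h1 := eq_smul_of_add_eq_pure hφ hF₁ hF₂ hsum
  have h2 := eq_smul_of_add_eq_pure hφ hF₂ hF₁ (by rw [add_comm, hsum])
  -- By purity both coordinates are multiples of `φ`, hence vanish at `y`.
  have hNv : N (y, -y) = 0 := by
    have e : g (y, -y) = θ₁ y - θ₂ y := by
      simp only [θ₁, θ₂, LinearMap.comp_apply, ← map_sub]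
      simp
    rw [← hgv, e, ← hF₁', ← hF₂', h1, h2]
    simp [hy0]
  obtain ⟨r, ⟨h, hh1, hh2, rfl⟩, hr⟩ := exists_lt_of_csInf_lt (upperBoundValues_nonempty (y, -y))
    (show N (y, -y) < ε by rwa [hNv])
  refine ⟨h, ?_, ?_, hr.le⟩
  · rwa [hy.coe_realPart] at hh1
  · rwa [hy.neg.coe_realPart] at hh2

lemma norm_le_of_neg_le_of_le {x : C} (hx : IsSelfAdjoint x) {r : ℝ} (hr : 0 ≤ r)
    (h1 : -algebraMap ℝ C r ≤ x) (h2 : x ≤ algebraMap ℝ C r) : ‖x‖ ≤ r := by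
  rcases subsingleton_or_nontrivial C with hC | hC
  · simpa [Subsingleton.elim x 0] using hr
  rw [← map_neg] at h1
  rw [algebraMap_le_iff_le_spectrum] at h1
  rw [le_algebraMap_iff_spectrum_le] at h2
  rcases CStarAlgebra.norm_or_neg_norm_mem_spectrum (a := x) hx with h | h
  · exact h2 _ h
  · have := h1 _ h
    linarith

/-- The cut-off function `max 0 (1 - x / t)` of a positive element. -/
lemma exists_cutoff {h : C} (hh : 0 ≤ h) {t : ℝ} (ht : 0 < t) :
    ∃ a : C, 0 ≤ a ∧ a ≤ 1 ∧ 1 - t⁻¹ • h ≤ a ∧ 1 - (2 * t⁻¹) • h ≤ a * a ∧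
      0 ≤ a * h * a ∧ a * h * a ≤ algebraMap ℝ C t := by
  have hsa : IsSelfAdjoint h := .of_nonneg hh
  let g : ℝ → ℝ := fun x => max 0 (1 - t⁻¹ * x)
  have hg : Continuous g := by fun_prop
  have hsp : ∀ x ∈ spectrum ℝ h, 0 ≤ x := fun x hx => spectrum_nonneg_of_nonneg hh hx
  have haa : cfc g h * cfc g h = cfc (fun x => g x * g x) h := by
    rw [← cfc_mul g g h]
  have haha : cfc g h * h * cfc g h = cfc (fun x => g x * x * g x) h := by
    conv_lhs => rw [← cfc_id' ℝ h]
    rw [cfc_id' ℝ h, cfc_mul (fun x => g x * x) g h, cfc_mul g (fun x => x) h, cfc_id' ℝ h]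
  have hlin : ∀ c : ℝ, 1 - c • h = cfc (fun x => 1 - c * x) h := by
    intro c
    rw [cfc_sub (fun _ => (1 : ℝ)) (fun x => c * x) h, cfc_const_one ℝ h, cfc_const_mul c (fun x => x) h,
      cfc_id' ℝ h]
  have hg0 : ∀ x, 0 ≤ g x := fun x => le_max_left _ _
  have hg1 : ∀ x, 0 ≤ x → g x ≤ 1 := fun x hx =>
    max_le zero_le_one (by have : 0 ≤ t⁻¹ * x := by positivity
                           linarith)
  have hgl : ∀ x, 1 - t⁻¹ * x ≤ g x := fun x => le_max_right _ _
  refine ⟨cfc g h, cfc_nonneg fun x _ => hg0 x, cfc_le_one g h fun x hx => hg1 x (hsp x hx),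
    ?_, ?_, ?_, ?_⟩
  · rw [hlin]
    exact cfc_mono fun x _ => hgl x
  · rw [hlin, haa]
    refine cfc_mono fun x hx => ?_
    have := hgl x
    -- Pointwise, `g² ≥ 2 g - 1 ≥ 1 - 2 x / t`.
    nlinarith [hg0 x, hg1 x (hsp x hx), sq_nonneg (1 - g x)]
  · rw [haha]
    exact cfc_nonneg fun x hx => mul_nonneg (mul_nonneg (hg0 x) (hsp x hx)) (hg0 x)
  · rw [haha]
    refine cfc_le_algebraMap _ t h fun x hx => ?_
    by_cases hxt : x ≤ t
    · have h1 := hg1 x (hsp x hx)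
      have h2 : g x * g x ≤ 1 := mul_le_one₀ h1 (hg0 x) h1
      nlinarith [hsp x hx]
    · have : g x = 0 := by
        refine max_eq_left ?_
        rw [sub_nonpos, ← div_eq_inv_mul, one_le_div ht]
        linarith
      simp [this, ht.le]

/-- Pure states can be excised. -/
lemma exists_excision (hφ : φ ∈ pureStates C) {y : C} (hy : IsSelfAdjoint y) (hy0 : φ y = 0)
    {ε : ℝ} (hε : 0 < ε) :
    ∃ a : C, 0 ≤ a ∧ a ≤ 1 ∧ 1 - ε ≤ (φ (a * a)).re ∧ ‖a * y * a‖ ≤ ε := by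
  have hst := mem_stateSpace_iff.1 hφ.1
  -- The bound `ε² / 2` absorbs the factor `2 / ε` in the lower bound for `a * a` at the cut-off
  -- level `ε`.
  obtain ⟨h, h1, h2, h3⟩ := exists_abs_le_of_pure hφ hy hy0 (show 0 < ε * ε / 2 by positivity)
  have hh : 0 ≤ h := by
    have h4 : (0 : C) ≤ (2⁻¹ : ℝ) • (h + h) := by
      refine smul_nonneg (by norm_num) ?_
      have := add_le_add h1 h2
      rwa [add_neg_cancel] at this
    rwa [← two_smul ℝ, smul_smul, inv_mul_cancel₀ two_ne_zero, one_smul] at h4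
  obtain ⟨a, a0, a1, -, a3, a4, a5⟩ := exists_cutoff hh hε
  have hsa : IsSelfAdjoint a := .of_nonneg a0
  refine ⟨a, a0, a1, ?_, ?_⟩
  · have := hst.1.re_mono a3
    rw [map_sub, hst.2, ← Complex.coe_smul, map_smul, smul_eq_mul, Complex.sub_re,
      Complex.re_ofReal_mul, Complex.one_re] at this
    have h5 : 2 * ε⁻¹ * (φ h).re ≤ ε := by
      calc 2 * ε⁻¹ * (φ h).re ≤ 2 * ε⁻¹ * (ε * ε / 2) := by gcongr
        _ = ε := by field_simp
    linarith
  · have c1 : a * y * a ≤ a * h * a := hsa.conjugate_le_conjugate h1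
    have c2 : a * (-y) * a ≤ a * h * a := hsa.conjugate_le_conjugate h2
    refine norm_le_of_neg_le_of_le (hy.conjugate_self hsa) hε.le ?_ (c1.trans a5)
    rw [neg_le]
    simpa using c2.trans a5

end Excision

/-! ### Maximality of the quantum filters of pure states -/

section Maximality

open scoped ComplexOrder

variable {C : Type*} [CStarAlgebra C]

/-- Take `z = x * a`, where `a` excises `φ` at `star x * x - φ (star x * x)`. Then `‖z‖² = ‖a * star
x * x * a‖` is almost `φ (star x * x)`, and `x - z = x * (1 - a)` is small for `φ` because `φ (a *
a)` is almost one. -/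
lemma exists_approx_of_pure {φ : C →L[ℂ] ℂ} (hφ : φ ∈ pureStates C) (x : C) {ε : ℝ} (hε : 0 < ε) :
    ∃ z : C, ‖z‖ ^ 2 ≤ (φ (star x * x)).re + ε ∧ (φ (star (x - z) * (x - z))).re ≤ ε := by
  let := CStarAlgebra.spectralOrder C
  let := CStarAlgebra.spectralOrderedRing C
  have hst := mem_stateSpace_iff.1 hφ.1
  have hp : 0 ≤ (φ (star x * x)).re := hst.1.self_re_nonneg x
  set p := (φ (star x * x)).re with hpdef
  have hδ : 0 < ε / (1 + ‖x‖ ^ 2) := by positivity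
  obtain ⟨a, a0, a1, a2, a3⟩ := exists_excision (y := star x * x - (p : ℂ) • 1) hφ
    ((IsSelfAdjoint.star_mul_self x).sub (.smul (Complex.conj_ofReal p) (.one C)))
    (by rw [map_sub, map_smul, hst.2, hpdef, hst.1.ofReal_re (IsSelfAdjoint.star_mul_self x)]; simp)
    hδ
  have hsa : IsSelfAdjoint a := .of_nonneg a0
  have hδε : ε / (1 + ‖x‖ ^ 2) ≤ ε := div_le_self hε.le (by nlinarith [sq_nonneg ‖x‖])
  have hna : ‖a‖ ≤ 1 := (CStarAlgebra.norm_le_one_iff_of_nonneg a a0).2 a1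
  refine ⟨x * a, ?_, ?_⟩
  · have e : star (x * a) * (x * a) = a * (star x * x - (p : ℂ) • 1) * a + (p : ℂ) • (a * a) := by
      rw [star_mul, hsa.star_eq, mul_sub, sub_mul, mul_smul_comm, smul_mul_assoc, mul_one]
      simp [mul_assoc]
    rw [sq, ← CStarRing.norm_star_mul_self, e]
    refine (norm_add_le _ _).trans ?_
    rw [norm_smul, Complex.norm_real, Real.norm_of_nonneg hp, add_comm]
    refine add_le_add (mul_le_of_le_one_right hp ?_) (a3.trans hδε)
    exact (norm_mul_le _ _).trans (mul_le_one₀ hna (norm_nonneg _) hna)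
  · have e : x - x * a = x * (1 - a) := by noncomm_ring
    have hs1 : IsSelfAdjoint (1 - a) := (IsSelfAdjoint.one C).sub hsa
    have e2 : star (x * (1 - a)) * (x * (1 - a)) ≤ (‖x‖ ^ 2) • ((1 - a) * (1 - a)) := by
      have := hs1.conjugate_le_conjugate (CStarAlgebra.star_mul_le_algebraMap_norm_sq (a := x))
      rw [Algebra.algebraMap_eq_smul_one] at this
      rw [star_mul, hs1.star_eq]
      simpa [mul_assoc] using this
    have e3 : (1 - a) * (1 - a) ≤ 1 - a * a :=
      (one_sub_sq_le a0 a1).trans (sub_le_sub_left (sq_le_self_of_mem_Icc a0 a1) 1)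
    have e4 := hst.1.re_mono (e2.trans (smul_le_smul_of_nonneg_left e3 (sq_nonneg ‖x‖)))
    rw [← Complex.coe_smul, map_smul, smul_eq_mul, Complex.re_ofReal_mul, map_sub, hst.2,
      Complex.sub_re, Complex.one_re] at e4
    rw [e]
    refine e4.trans ?_
    calc ‖x‖ ^ 2 * (1 - (φ (a * a)).re) ≤ ‖x‖ ^ 2 * (ε / (1 + ‖x‖ ^ 2)) := by
          gcongr; linarith
      _ ≤ (1 + ‖x‖ ^ 2) * (ε / (1 + ‖x‖ ^ 2)) := by gcongr; linarith
      _ = ε := by field_simp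

/-- The quotient norm modulo the left kernel of a pure state is the Hilbert space norm. -/
lemma exists_norm_le_of_pure {φ : C →L[ℂ] ℂ} (hφ : φ ∈ pureStates C) (x : C) {ε : ℝ} (hε : 0 < ε) :
    ∃ z : C, (φ (star (x - z) * (x - z))).re = 0 ∧
      ‖z‖ ≤ √((φ (star x * x)).re + ε ^ 2) + 2 * ε := by
  have hst := mem_stateSpace_iff.1 hφ.1
  -- The approximation is applied repeatedly to the remainder, with errors chosen so that `δ n + δ
  -- (n + 1) ≤ (ε / 2 ^ n)²`. The corrections after the first one then have total norm at most `2
  -- ε`.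
  let δ : ℕ → ℝ := fun n => ε ^ 2 / 2 * (1 / 4) ^ n
  have hδ : ∀ n, 0 < δ n := fun n => by positivity
  choose! z hz1 hz2 using fun (n : ℕ) (x : C) => exists_approx_of_pure hφ x (hδ n)
  let r : ℕ → C := fun n => Nat.rec x (fun n y => y - z n y) n
  have hr : ∀ n, r (n + 1) = r n - z n (r n) := fun n => rfl
  let w : ℕ → C := fun n => z n (r n)
  have hw0 : ‖w 0‖ ≤ √((φ (star x * x)).re + ε ^ 2) := by
    refine Real.le_sqrt_of_sq_le ((hz1 0 x).trans ?_)
    simp only [δ]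
    nlinarith [sq_nonneg ε]
  have hrn : ∀ n, (φ (star (r (n + 1)) * r (n + 1))).re ≤ δ n := fun n => hz2 n (r n)
  have hwn : ∀ n, ‖w (n + 1)‖ ≤ ε * (1 / 2) ^ n := by
    intro n
    refine abs_le_of_sq_le_sq' ?_ (by positivity) |>.2
    refine (hz1 (n + 1) (r (n + 1))).trans ?_
    have := hrn n
    have e : (ε * (1 / 2) ^ n) ^ 2 = 2 * δ n := by
      simp only [δ]
      rw [mul_pow, ← pow_mul, mul_comm n 2, pow_mul]
      norm_num
      ring
    have e2 : δ (n + 1) ≤ δ n := by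
      simp only [δ, pow_succ]
      have : 0 < ε ^ 2 / 2 * (1 / 4) ^ n := hδ n
      nlinarith
    linarith
  have hgeo : HasSum (fun n : ℕ => ε * (1 / 2) ^ n) (2 * ε) := by
    rw [mul_comm 2 ε]
    exact hasSum_geometric_two.mul_left ε
  have hsum1 : Summable fun n => ‖w (n + 1)‖ :=
    Summable.of_nonneg_of_le (fun n => norm_nonneg _) hwn hgeo.summable
  have hsum : Summable fun n => ‖w n‖ := (summable_nat_add_iff 1).1 hsum1
  refine ⟨∑' n, w n, ?_, ?_⟩
  · have hpart : ∀ n, ∑ k ∈ Finset.range n, w k = x - r n := by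
      intro n
      induction n with
      | zero => simp [r]
      | succ n ih => rw [Finset.sum_range_succ, ih, hr]; simp only [w]; abel
    have h1 : Tendsto r atTop (𝓝 (x - ∑' n, w n)) := by
      have := (tendsto_const_nhds (x := x)).sub hsum.of_norm.hasSum.tendsto_sum_nat
      simpa [hpart] using this
    have hc : Continuous fun y : C => (φ (star y * y)).re := by fun_prop
    have h2 : Tendsto (fun n => (φ (star (r (n + 1)) * r (n + 1))).re) atTop
        (𝓝 (φ (star (x - ∑' n, w n) * (x - ∑' n, w n))).re) :=
      ((hc.tendsto _).comp h1).comp (tendsto_add_atTop_nat 1)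
    have h3 : Tendsto δ atTop (𝓝 0) := by
      have := (tendsto_pow_atTop_nhds_zero_of_lt_one (r := (1 / 4 : ℝ)) (by norm_num)
        (by norm_num)).const_mul (ε ^ 2 / 2)
      rwa [mul_zero] at this
    exact le_antisymm (le_of_tendsto_of_tendsto' h2 h3 hrn) (hst.1.self_re_nonneg _)
  · refine (norm_tsum_le_tsum_norm hsum).trans ?_
    rw [hsum.tsum_eq_zero_add]
    refine add_le_add hw0 ?_
    rw [← hgeo.tsum_eq]
    exact hsum1.tsum_le_tsum hwn hgeo.summable

lemma foldl_mul_eq (a : C) (l : List C) : l.foldl (· * ·) a = a * l.prod := by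
  induction l generalizing a with
  | nil => simp
  | cons b l ih => rw [List.foldl_cons, ih, List.prod_cons, mul_assoc]

lemma norm_list_prod_le_one {l : List C} (hl : ∀ b ∈ l, b ∈ posUnitSphere C) : ‖l.prod‖ ≤ 1 := by
  induction l with
  | nil => simpa using (IsStarProjection.one (R := C)).norm_le _
  | cons b l ih =>
    rw [List.prod_cons]
    refine (norm_mul_le _ _).trans (mul_le_one₀ (hl b (by simp)).2.le (norm_nonneg _) ?_)
    exact ih fun c hc => hl c (List.mem_cons_of_mem _ hc)

variable [PartialOrder C] [StarOrderedRing C]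

lemma posUnitSphere_nonneg {a : C}
    (ha : a ∈ posUnitSphere C) : 0 ≤ a :=
  CStarAlgebra.nonneg_iff_eq_star_mul_self.2 ha.1

lemma posUnitSphere_le_one {a : C} (ha : a ∈ posUnitSphere C) : a ≤ 1 :=
  (CStarAlgebra.norm_le_one_iff_of_nonneg a (posUnitSphere_nonneg ha)).1 ha.2.le

lemma mem_quantumFilter_iff {φ : C →L[ℂ] ℂ} (hφ : φ ∈ stateSpace C) {a : C} :
    a ∈ quantumFilter φ ↔ 0 ≤ a ∧ a ≤ 1 ∧ φ a = 1 := by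
  refine ⟨fun h => ⟨posUnitSphere_nonneg h.1, posUnitSphere_le_one h.1, h.2⟩, fun h => ⟨⟨?_, ?_⟩, h.2.2⟩⟩
  · exact CStarAlgebra.nonneg_iff_eq_star_mul_self.1 h.1
  · refine le_antisymm ((CStarAlgebra.norm_le_one_iff_of_nonneg a h.1).2 h.2.1) ?_
    have := φ.le_opNorm a
    rwa [hφ.2, h.2.2, one_mul, norm_one] at this

/-- A pure state is determined by its quantum filter. -/
lemma eq_of_quantumFilter_subset {φ θ : C →L[ℂ] ℂ} (hφ : φ ∈ pureStates C) (hθ : θ ∈ stateSpace C)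
    (h : ∀ a ∈ quantumFilter φ, θ a = 1) : θ = φ := by
  have hst := mem_stateSpace_iff.1 hφ.1
  have htt := mem_stateSpace_iff.1 hθ
  -- If `φ (star z * z) = 0`, then `1 - star z * z / ‖star z * z‖` is in the filter of `φ`, so `θ`
  -- is one there: the left kernel of `φ` is contained in that of `θ`.
  have hker : ∀ z : C, (φ (star z * z)).re = 0 → (θ (star z * z)).re = 0 := by
    intro z hz
    by_cases hz0 : star z * z = 0
    · simp [hz0]
    have hn : 0 < ‖star z * z‖ := norm_pos_iff.2 hz0
    have hz' : φ (star z * z) = 0 := by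
      rw [← hst.1.ofReal_re (IsSelfAdjoint.star_mul_self z), hz, Complex.ofReal_zero]
    set u : C := ‖star z * z‖⁻¹ • (star z * z) with hu
    have hu0 : 0 ≤ u := smul_nonneg (by positivity) (star_mul_self_nonneg z)
    have hu1 : u ≤ 1 := by
      rw [← CStarAlgebra.norm_le_one_iff_of_nonneg u hu0, hu, norm_smul]
      simp [hn.ne']
    have hsm : ∀ f : C →L[ℂ] ℂ, f u = (‖star z * z‖⁻¹ : ℝ) * f (star z * z) := fun f => by
      rw [hu, ← Complex.coe_smul, map_smul, smul_eq_mul]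
    have h1 := h (1 - u) ((mem_quantumFilter_iff hφ.1).2 ⟨sub_nonneg.2 hu1, sub_le_self 1 hu0, by
      rw [map_sub, hst.2, hsm, hz', mul_zero, sub_zero]⟩)
    rw [map_sub, htt.2, sub_eq_self, hsm] at h1
    have h2 := (mul_eq_zero.1 h1).resolve_left (by
      exact Complex.ofReal_ne_zero.2 (inv_ne_zero hn.ne'))
    simp [h2]
  -- Modulo the left kernel, `x` may be replaced by `z` with `‖z‖²` close to `φ (star x * x)`, and
  -- `θ (star z * z) ≤ ‖z‖²`.
  have hle : ∀ x : C, (θ (star x * x)).re ≤ (φ (star x * x)).re := by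
    intro x
    have hb : ∀ ε : ℝ, 0 < ε → (θ (star x * x)).re ≤ (√((φ (star x * x)).re + ε ^ 2) + 2 * ε) ^ 2 := by
      intro ε hε
      obtain ⟨z, hz, hzn⟩ := exists_norm_le_of_pure hφ x hε
      have hk := hker _ hz
      have e : star x * x = star z * z + star z * (x - z) + star (x - z) * x := by
        rw [star_sub]; noncomm_ring
      have e2 : θ (star x * x) = θ (star z * z) := by
        rw [e, map_add, map_add, htt.1.mul_eq_zero_of_self hk, htt.1.star_mul_eq_zero_of_self hk,
          add_zero, add_zero]
      rw [e2]
      refine (htt.1.self_le z).trans ?_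
      rw [htt.2, Complex.one_re, one_mul]
      gcongr
    have hc : Continuous fun ε : ℝ => (√((φ (star x * x)).re + ε ^ 2) + 2 * ε) ^ 2 := by fun_prop
    have ht := (hc.tendsto 0).mono_left (nhdsWithin_le_nhds (s := Set.Ioi 0))
    simp only [ne_eq, OfNat.ofNat_ne_zero, not_false_eq_true, zero_pow, add_zero, mul_zero] at ht
    rw [Real.sq_sqrt (hst.1.self_re_nonneg x)] at ht
    exact ge_of_tendsto ht (eventually_mem_nhdsWithin.mono fun ε hε => hb ε hε)
  have hd : IsPosFunctional (φ - θ) := by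
    intro x
    rw [_root_.sub_apply, Complex.le_def]
    refine ⟨by simpa using hle x, ?_⟩
    simp [hst.1.im_eq_zero (IsSelfAdjoint.star_mul_self x),
      htt.1.im_eq_zero (IsSelfAdjoint.star_mul_self x)]
  -- The positive functional `φ - θ` vanishes at the unit, hence is zero.
  have hn := hd.norm_le_one_re
  rw [_root_.sub_apply, hst.2, htt.2, sub_self, Complex.zero_re] at hn
  exact (sub_eq_zero.1 (norm_le_zero_iff.1 hn)).symm

/-- Factors at which the state is one can be stripped off one by one, so the state is one at every
finite product, whose norm is therefore at least one. -/
lemma isQuantumFilter_of_state {φ : C →L[ℂ] ℂ} (hφ : φ ∈ stateSpace C) :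
    IsQuantumFilter (quantumFilter φ) := by
  have hst := mem_stateSpace_iff.1 hφ
  refine ⟨fun a ha => ha.1, fun a ha l hl => ?_⟩
  have hprod : ∀ (l : List C), (∀ b ∈ l, b ∈ quantumFilter φ) → φ l.prod = 1 := by
    intro l
    induction l with
    | nil => intro; simpa using hst.2
    | cons b l ih =>
      intro hl
      obtain ⟨h0, h1, h2⟩ := (mem_quantumFilter_iff hφ).1 (hl b (by simp))
      rw [List.prod_cons, hst.1.apply_mul_left h0 h1 (by rw [h2, hst.2])]
      exact ih fun c hc => hl c (List.mem_cons_of_mem _ hc)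
  have hmem : ∀ b ∈ a :: l, b ∈ quantumFilter φ := List.forall_mem_cons.2 ⟨ha, hl⟩
  rw [foldl_mul_eq, ← List.prod_cons]
  refine le_antisymm (norm_list_prod_le_one fun b hb => (hmem b hb).1) ?_
  have := φ.le_opNorm (a :: l).prod
  rwa [hφ.2, hprod _ hmem, one_mul, norm_one] at this

/-- The value at the first factor `a` is one because `a * (P * star P) * a ≤ a * a ≤ a` for the
remaining product `P`. Then `a` can be removed on both sides, and the argument repeats. -/
lemma apply_eq_one_of_list {η : C →L[ℂ] ℂ} (hη : η ∈ stateSpace C) :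
    ∀ l : List C, (∀ b ∈ l, b ∈ posUnitSphere C) → η (l.prod * star l.prod) = 1 →
      ∀ b ∈ l, η b = 1 := by
  have hst := mem_stateSpace_iff.1 hη
  intro l
  induction l with
  | nil => simp
  | cons a l ih =>
    intro hl h1
    have ha := hl a (by simp)
    have ha0 := posUnitSphere_nonneg ha
    have ha1 := posUnitSphere_le_one ha
    have hsa : IsSelfAdjoint a := .of_nonneg ha0
    have hl' : ∀ b ∈ l, b ∈ posUnitSphere C := fun c hc => hl c (List.mem_cons_of_mem _ hc)
    have e : (a :: l).prod * star (a :: l).prod = a * (l.prod * star l.prod) * a := by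
      rw [List.prod_cons, star_mul, hsa.star_eq]; simp only [mul_assoc]
    have hle : l.prod * star l.prod ≤ 1 := by
      rw [← CStarAlgebra.norm_le_one_iff_of_nonneg _ (mul_star_self_nonneg _),
        CStarRing.norm_self_mul_star]
      exact mul_le_one₀ (norm_list_prod_le_one hl') (norm_nonneg _) (norm_list_prod_le_one hl')
    rw [e] at h1
    have hηa : (η a).re = 1 := by
      refine le_antisymm (hst.1.re_le_one hst.2 ha1) ?_
      have h2 := hst.1.re_mono ((hsa.conjugate_le_conjugate hle).trans
        (by simpa using sq_le_self_of_mem_Icc ha0 ha1))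
      rwa [h1, Complex.one_re] at h2
    have hηa' : (η a).re = (η 1).re := by rw [hηa, hst.2, Complex.one_re]
    rw [hst.1.apply_mul_right ha0 ha1 hηa', hst.1.apply_mul_left ha0 ha1 hηa'] at h1
    refine List.forall_mem_cons.2 ⟨?_, ih hl' h1⟩
    rw [← hst.1.ofReal_re hsa, hηa, Complex.ofReal_one]

/-- A quantum filter containing the unit is contained in the quantum filter of a state. -/
lemma IsQuantumFilter.exists_state {F : Set C} (hF : IsQuantumFilter F) (h1 : (1 : C) ∈ F) :
    ∃ θ ∈ stateSpace C, ∀ b ∈ F, θ b = 1 := by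
  have hcpt := WeakDual.isCompact_closedBall (𝕜 := ℂ) (E := C) 0 1
  -- By weak-star compactness of the unit ball, finitely many members of `F` at a time suffice. For
  -- these, a functional norming `P * star P`, with `P` their product, is a state that is one at
  -- each factor.
  obtain ⟨θ, hθ, hθF⟩ := hcpt.inter_iInter_nonempty (fun b : F => {η : WeakDual ℂ C | η b = 1})
    (fun b => isClosed_eq (WeakDual.eval_continuous (b : C)) continuous_const) (by
      intro u
      let l : List C := u.toList.map Subtype.val
      have hl : ∀ b ∈ l, b ∈ F := by
        intro b hb
        obtain ⟨c, -, rfl⟩ := List.mem_map.1 hb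
        exact c.2
      have hl' : ∀ b ∈ l, b ∈ posUnitSphere C := fun b hb => hF.1 (hl b hb)
      have hn : ‖l.prod * star l.prod‖ = 1 := by
        have := hF.2 1 h1 l hl
        rw [foldl_mul_eq, one_mul] at this
        rw [CStarRing.norm_self_mul_star, this, one_mul]
      obtain ⟨η, hη, hη1⟩ := exists_dual_vector ℂ (l.prod * star l.prod) (by rw [hn]; exact one_ne_zero)
      have hη1' : η (l.prod * star l.prod) = 1 := by rw [hη1, hn]; simp
      have hηs : η ∈ stateSpace C := mem_stateSpace_of_apply_eq_one hη.le (mul_star_self_nonneg _)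
        ((CStarAlgebra.norm_le_one_iff_of_nonneg _ (mul_star_self_nonneg _)).1 hn.le) hη1'
      refine ⟨StrongDual.toWeakDual η, by simpa using hη.le, ?_⟩
      simp only [Set.mem_iInter]
      intro b hb
      exact apply_eq_one_of_list hηs l hl' hη1' b
        (List.mem_map.2 ⟨b, Finset.mem_toList.2 hb, rfl⟩))
  simp only [Set.mem_iInter] at hθF
  refine ⟨WeakDual.toStrongDual θ, ?_, fun b hb => hθF ⟨b, hb⟩⟩
  have hone := hF.1 h1
  refine mem_stateSpace_of_apply_eq_one (by simpa using hθ) (posUnitSphere_nonneg hone)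
    (posUnitSphere_le_one hone) (hθF ⟨1, h1⟩)

/-- A larger quantum filter is contained in the filter of some state, and that state is `φ` since it
is one on the filter of `φ`. -/
lemma isMaximalQuantumFilter_of_pure {φ : C →L[ℂ] ℂ} (hφ : φ ∈ pureStates C) :
    IsMaximalQuantumFilter (quantumFilter φ) := by
  have hst := mem_stateSpace_iff.1 hφ.1
  refine ⟨isQuantumFilter_of_state hφ.1, fun F hF hle b hb => ?_⟩
  have hone : (1 : C) ∈ quantumFilter φ :=
    (mem_quantumFilter_iff hφ.1).2 ⟨zero_le_one, le_rfl, hst.2⟩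
  obtain ⟨θ, hθ, hθF⟩ := hF.exists_state (hle hone)
  have : θ = φ := eq_of_quantumFilter_subset hφ hθ fun a ha => hθF a (hle ha)
  exact ⟨hF.1 hb, this ▸ hθF b hb⟩

lemma mem_quantumFilter_of_mulBelow {φ : C →L[ℂ] ℂ} (hφ : φ ∈ stateSpace C) {a b : C}
    (ha : a ∈ quantumFilter φ) (hb : b ∈ posUnitSphere C) (hab : MulBelow a b) :
    b ∈ quantumFilter φ := by
  have hst := mem_stateSpace_iff.1 hφ
  obtain ⟨h0, h1, h2⟩ := (mem_quantumFilter_iff hφ).1 ha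
  refine ⟨hb, ?_⟩
  rw [← hst.1.apply_mul_left h0 h1 (by rw [h2, hst.2]), hab, h2]

end Maximality

/-! ### Block-diagonal multipliers -/

section Multiplier

variable {A : Type*} [NonUnitalCStarAlgebra A]

lemma norm_toMultiplier (a : A) : ‖toMultiplier A a‖ = ‖a‖ :=
  (AddMonoidHomClass.isometry_iff_norm _).1 (multiplierCoe_isometry A) a

/-- The norm of a multiplier is the norm of its left action, so the left action determines it. -/
lemma multiplier_ext {m m' : 𝓜(ℂ, A)} (h : ∀ x, m * toMultiplier A x = m' * toMultiplier A x) :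
    m = m' := by
  have hz : (m - m').fst = 0 := by
    ext x
    have := h x
    rw [mul_toMultiplier, mul_toMultiplier] at this
    have h2 := (multiplierCoe_isometry A).injective this
    simp [h2]
  rw [← sub_eq_zero, ← norm_eq_zero, ← DoubleCentralizer.norm_fst, hz, norm_zero]

/-- The member `e n` of a σ-unit as a multiplier. -/
abbrev unitProj (e : ℕ → A) (n : ℕ) : 𝓜(ℂ, A) := toMultiplier A (e n)

/-- The increment `f n` of a σ-unit as a multiplier. -/
abbrev incProj (e : ℕ → A) (n : ℕ) : 𝓜(ℂ, A) := toMultiplier A (increment e n)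

lemma sum_increment (e : ℕ → A) (N : ℕ) : ∑ n ∈ Finset.range (N + 1), increment e n = e N := by
  induction N with
  | zero => simp [increment]
  | succ N ih => rw [Finset.sum_range_succ, ih, increment]; abel

lemma sum_incProj (e : ℕ → A) (N : ℕ) : ∑ n ∈ Finset.range (N + 1), incProj e n = unitProj e N := by
  rw [← map_sum, sum_increment]

lemma StrictTendsto.tendsto_mul {u : ℕ → 𝓜(ℂ, A)} {T : 𝓜(ℂ, A)} (h : StrictTendsto u T) (a : A) :
    Tendsto (fun m => u m * toMultiplier A a) atTop (𝓝 (T * toMultiplier A a)) := by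
  rw [tendsto_iff_norm_sub_tendsto_zero]
  simpa [sub_mul] using (h a).1

namespace IsSigmaUnitOfProjections

variable {e : ℕ → A}

lemma isStarProjection_unitProj (he : IsSigmaUnitOfProjections e) (n : ℕ) : IsStarProjection (unitProj e n) :=
  (he.isStarProjection n).map (toMultiplier A)

lemma isStarProjection_increment (he : IsSigmaUnitOfProjections e) (n : ℕ) : IsStarProjection (increment e n) :=
  ⟨he.increment_mul_increment n, he.isSelfAdjoint_increment n⟩

lemma isStarProjection_incProj (he : IsSigmaUnitOfProjections e) (n : ℕ) : IsStarProjection (incProj e n) :=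
  (he.isStarProjection_increment n).map (toMultiplier A)

lemma increment_ne_zero (he : IsSigmaUnitOfProjections e) (n : ℕ) : increment e n ≠ 0 := by
  cases n with
  | zero => exact he.ne_zero
  | succ n => exact sub_ne_zero.2 (he.ne_succ n).symm

lemma norm_increment (he : IsSigmaUnitOfProjections e) (n : ℕ) : ‖increment e n‖ = 1 := by
  have h := CStarRing.norm_star_mul_self (x := increment e n)
  rw [(he.isSelfAdjoint_increment n).star_eq, he.increment_mul_increment n] at h
  have h0 := norm_ne_zero_iff.2 (he.increment_ne_zero n)
  exact (mul_left_cancel₀ h0 (by rw [mul_one]; exact h)).symm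

lemma increment_mul_eq_zero (he : IsSigmaUnitOfProjections e) {m n : ℕ} (hmn : m ≠ n) : increment e m * increment e n = 0 := by
  have key : ∀ {m n : ℕ}, m < n → increment e n * increment e m = 0 := by
    intro m n h
    cases m with
    | zero => exact he.increment_mul_of_lt h
    | succ m =>
      rw [increment, mul_sub, he.increment_mul_of_lt h, he.increment_mul_of_lt (m := m) (by omega),
        sub_zero]
  rcases lt_or_gt_of_ne hmn with h | h
  · have := congrArg star (key h)
    rwa [star_mul, (he.isSelfAdjoint_increment _).star_eq, (he.isSelfAdjoint_increment _).star_eq,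
      star_zero] at this
  · exact key h

lemma incProj_mul_eq_zero (he : IsSigmaUnitOfProjections e) {m n : ℕ} (hmn : m ≠ n) : incProj e m * incProj e n = 0 := by
  rw [← map_mul, he.increment_mul_eq_zero hmn, map_zero]

lemma incProj_mul_self (he : IsSigmaUnitOfProjections e) (n : ℕ) : incProj e n * incProj e n = incProj e n :=
  (he.isStarProjection_incProj n).isIdempotentElem

lemma unitProj_mul_incProj_of_le (he : IsSigmaUnitOfProjections e) {m n : ℕ} (h : n ≤ m) :
    unitProj e m * incProj e n = incProj e n := by
  have := congrArg star (he.increment_mul_of_le h)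
  rw [star_mul, (he.isSelfAdjoint_increment _).star_eq,
    (he.isStarProjection m).isSelfAdjoint.star_eq] at this
  rw [← map_mul, this]

lemma unitProj_mul_incProj_of_lt (he : IsSigmaUnitOfProjections e) {m n : ℕ} (h : m < n) : unitProj e m * incProj e n = 0 := by
  have := congrArg star (he.increment_mul_of_lt h)
  rw [star_mul, (he.isSelfAdjoint_increment _).star_eq,
    (he.isStarProjection m).isSelfAdjoint.star_eq, star_zero] at this
  rw [← map_mul, this, map_zero]

lemma tendsto_unitProj_mul (he : IsSigmaUnitOfProjections e) (m : 𝓜(ℂ, A)) (a : A) :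
    Tendsto (fun N => unitProj e N * (m * toMultiplier A a)) atTop (𝓝 (m * toMultiplier A a)) := by
  rw [mul_toMultiplier]
  have := ((multiplierCoe_isometry A).continuous.tendsto _).comp (he.tendsto_mul_left (m.fst a))
  exact this.congr fun N => map_mul _ _ _

lemma tendsto_mul_unitProj (he : IsSigmaUnitOfProjections e) (m : 𝓜(ℂ, A)) (a : A) :
    Tendsto (fun N => toMultiplier A a * m * unitProj e N) atTop (𝓝 (toMultiplier A a * m)) := by
  rw [toMultiplier_mul]
  have := ((multiplierCoe_isometry A).continuous.tendsto _).comp (he.tendsto_mul_right (m.snd a))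
  exact this.congr fun N => map_mul _ _ _

lemma ext_unitProj (he : IsSigmaUnitOfProjections e) {m m' : 𝓜(ℂ, A)} (h : ∀ N, m * unitProj e N = m' * unitProj e N) : m = m' := by
  refine multiplier_ext fun x => ?_
  have h1 := he.tendsto_unitProj_mul 1 x
  rw [one_mul] at h1
  refine tendsto_nhds_unique (h1.const_mul m) ((h1.const_mul m').congr fun N => ?_)
  rw [← mul_assoc, ← mul_assoc, h]

lemma ext_incProj (he : IsSigmaUnitOfProjections e) {m m' : 𝓜(ℂ, A)} (h : ∀ n, m * incProj e n = m' * incProj e n) : m = m' := by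
  refine he.ext_unitProj fun N => ?_
  rw [← sum_incProj, Finset.mul_sum, Finset.mul_sum]
  exact Finset.sum_congr rfl fun n _ => h n

/-- A bounded coherent sequence of self-adjoint elements converges strictly. -/
lemma exists_strict_limit (he : IsSigmaUnitOfProjections e) (s : ℕ → A) (hsa : ∀ m, IsSelfAdjoint (s m)) (hn : ∀ m, ‖s m‖ ≤ 1)
    (hs : ∀ m N, N ≤ m → s m * e N = s N) :
    ∃ T : 𝓜(ℂ, A), IsSelfAdjoint T ∧ ‖T‖ ≤ 1 ∧ ∀ N, T * unitProj e N = toMultiplier A (s N) := by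
  have hex : ∀ a, ∃ b, Tendsto (fun m => s m * a) atTop (𝓝 b) := by
    intro a
    refine cauchySeq_tendsto_of_complete (Metric.cauchySeq_iff'.2 fun ε hε => ?_)
    have h1 : ∀ᶠ n in atTop, ‖e n * a - a‖ < ε / 3 := by
      simpa [dist_eq_norm] using
        (Metric.tendsto_nhds.1 (he.tendsto_mul_left a)) (ε / 3) (by positivity)
    obtain ⟨N, hN⟩ := h1.exists
    have hb : ∀ m, ‖s m * (e N * a - a)‖ ≤ ε / 3 := fun m =>
      calc _ ≤ ‖s m‖ * ‖e N * a - a‖ := norm_mul_le _ _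
        _ ≤ 1 * (ε / 3) := by
          gcongr
          exact hn m
        _ = ε / 3 := one_mul _
    refine ⟨N, fun m hm => ?_⟩
    -- Both `s m * e N` and `s N * e N` equal `s N`, so the difference involves `a` only through `e
    -- N * a - a`.
    have hd : s m * a - s N * a = s N * (e N * a - a) - s m * (e N * a - a) := by
      rw [mul_sub, mul_sub, ← mul_assoc, ← mul_assoc, hs m N hm, hs N N le_rfl]
      abel
    rw [dist_eq_norm, hd]
    calc _ ≤ _ := norm_sub_le _ _
      _ ≤ ε / 3 + ε / 3 := add_le_add (hb N) (hb m)
      _ < ε := by linarith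
  choose L hL using hex
  -- The `s m` are self-adjoint, so right multiplication converges to the adjoint of the left limit.
  let R : A → A := fun a => star (L (star a))
  have hR : ∀ a, Tendsto (fun m => a * s m) atTop (𝓝 (R a)) := fun a => by
    simpa [star_mul, (hsa _).star_eq] using (hL (star a)).star
  have hL' : Tendsto (fun m x => ContinuousLinearMap.mul ℂ A (s m) x) atTop (𝓝 L) :=
    tendsto_pi_nhds.2 hL
  have hR' : Tendsto (fun m x => (ContinuousLinearMap.mul ℂ A).flip (s m) x)
      atTop (𝓝 R) := tendsto_pi_nhds.2 hR
  let T : 𝓜(ℂ, A) :=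
    { fst := continuousLinearMapOfTendsto _ hL'
      snd := continuousLinearMapOfTendsto _ hR'
      central := fun x y => by
        have h1 := (hR x).mul_const y
        simp only [mul_assoc] at h1
        exact tendsto_nhds_unique h1 ((hL y).const_mul x) }
  have hT : ∀ x, T.fst x = L x := fun x => rfl
  refine ⟨T, ?_, ?_, fun N => ?_⟩
  · refine multiplier_ext fun x => ?_
    rw [mul_toMultiplier, mul_toMultiplier, DoubleCentralizer.star_fst, hT]
    congr 1
    change star (R (star x)) = L x
    simp [R]
  · rw [← DoubleCentralizer.norm_fst]
    refine ContinuousLinearMap.opNorm_le_bound _ zero_le_one fun x => ?_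
    rw [hT]
    refine le_of_tendsto (hL x).norm (Eventually.of_forall fun m => ?_)
    exact (norm_mul_le _ _).trans (mul_le_mul_of_nonneg_right (hn m) (norm_nonneg _))
  · rw [mul_toMultiplier, hT]
    congr 1
    refine tendsto_nhds_unique (hL (e N)) (tendsto_const_nhds.congr' ?_)
    filter_upwards [eventually_ge_atTop N] with m hm
    exact (hs m N hm).symm

/-- A sequence of positive contractions has a block-diagonal compression. -/
lemma exists_blockDiagonal (he : IsSigmaUnitOfProjections e)
    [PartialOrder 𝓜(ℂ, A)] [StarOrderedRing 𝓜(ℂ, A)]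
    (c : ℕ → 𝓜(ℂ, A)) (hc0 : ∀ n, 0 ≤ c n) (hc1 : ∀ n, c n ≤ 1) :
    ∃ T : 𝓜(ℂ, A), IsSelfAdjoint T ∧ ‖T‖ ≤ 1 ∧
      ∀ n, T * incProj e n = incProj e n * c n * incProj e n := by
  let d : ℕ → A := fun n => increment e n * (c n).fst (increment e n)
  have hd : ∀ n, toMultiplier A (d n) = incProj e n * c n * incProj e n := fun n => by
    rw [map_mul, mul_assoc, mul_toMultiplier (c n)]
  have hsd : ∀ n, IsSelfAdjoint (incProj e n) := fun n =>
    (he.isStarProjection_incProj n).isSelfAdjoint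
  have hd0 : ∀ n, 0 ≤ toMultiplier A (d n) := fun n => by
    rw [hd]; exact (hsd n).conjugate_nonneg (hc0 n)
  have hdle : ∀ n, toMultiplier A (d n) ≤ incProj e n := fun n => by
    rw [hd]
    have := (hsd n).conjugate_le_conjugate (hc1 n)
    rwa [mul_one, he.incProj_mul_self] at this
  let s : ℕ → A := fun N => ∑ n ∈ Finset.range (N + 1), d n
  have hs0 : ∀ N, 0 ≤ toMultiplier A (s N) := fun N => by
    rw [map_sum]; exact Finset.sum_nonneg fun n _ => hd0 n
  have hs1 : ∀ N, toMultiplier A (s N) ≤ 1 := fun N => by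
    rw [map_sum]
    refine (Finset.sum_le_sum fun n _ => hdle n).trans ?_
    rw [sum_incProj]
    exact (he.isStarProjection_unitProj N).le_one
  have hde : ∀ n m, n ≤ m → d n * e m = d n := fun n m h => by
    apply (multiplierCoe_isometry A).injective
    rw [map_mul, hd, mul_assoc, ← map_mul, he.increment_mul_of_le h]
  have hde' : ∀ n m, m < n → d n * e m = 0 := fun n m h => by
    apply (multiplierCoe_isometry A).injective
    rw [map_mul, hd, mul_assoc, ← map_mul, he.increment_mul_of_lt h, map_zero, mul_zero]
  have hs : ∀ m N, N ≤ m → s m * e N = s N := by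
    intro m N h
    simp only [s, Finset.sum_mul]
    rw [← Finset.sum_subset (Finset.range_mono (Nat.succ_le_succ h))]
    · exact Finset.sum_congr rfl fun n hn => hde n N (Nat.lt_succ_iff.1 (Finset.mem_range.1 hn))
    · intro n _ hn
      refine hde' n N ?_
      simpa using hn
  have hssa : ∀ m, IsSelfAdjoint (s m) := fun m => by
    apply (multiplierCoe_isometry A).injective
    rw [map_star]
    exact (IsSelfAdjoint.of_nonneg (hs0 m)).star_eq
  obtain ⟨T, hT, hT1, hT2⟩ := he.exists_strict_limit s hssa (fun m => by
    rw [← norm_toMultiplier]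
    exact (CStarAlgebra.norm_le_one_iff_of_nonneg _ (hs0 m)).2 (hs1 m)) hs
  refine ⟨T, hT, hT1, fun n => ?_⟩
  rw [← hd]
  cases n with
  | zero =>
    rw [incProj, increment, hT2]
    simp [s]
  | succ n =>
    rw [incProj, increment, map_sub, mul_sub, hT2, hT2, ← map_sub]
    simp [s, Finset.sum_range_succ _ (n + 1)]

/-- A multiplier whose columns are absolutely summable belongs to the algebra. -/
lemma exists_toMultiplier_eq_of_summable (he : IsSigmaUnitOfProjections e) {m : 𝓜(ℂ, A)} (h : Summable fun n => ‖m * incProj e n‖) :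
    ∃ a : A, toMultiplier A a = m := by
  have hcl : IsClosed (Set.range (toMultiplier A)) :=
    (multiplierCoe_isometry A).isClosedEmbedding.isClosed_range
  -- The partial sums of the columns lie in the closed subspace `A`; their norm limit has the same
  -- columns as `m`.
  have hsum := h.of_norm.hasSum.tendsto_sum_nat
  have hmem : ∀ N, ∑ n ∈ Finset.range N, m * incProj e n ∈ Set.range (toMultiplier A) := by
    intro N
    refine ⟨∑ n ∈ Finset.range N, m.fst (increment e n), ?_⟩
    rw [map_sum]
    exact Finset.sum_congr rfl fun n _ => (mul_toMultiplier _ _).symm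
  obtain ⟨a, ha⟩ := hcl.mem_of_tendsto hsum (Eventually.of_forall hmem)
  refine ⟨a, ?_⟩
  rw [ha]
  refine he.ext_incProj fun k => ?_
  refine tendsto_nhds_unique (hsum.mul_const (incProj e k)) (tendsto_const_nhds.congr' ?_)
  filter_upwards [eventually_gt_atTop k] with N hN
  rw [Finset.sum_mul, Finset.sum_eq_single k]
  · rw [mul_assoc, he.incProj_mul_self]
  · intro n _ hn
    rw [mul_assoc, he.incProj_mul_eq_zero hn, mul_zero]
  · intro h
    exact absurd (Finset.mem_range.2 hN) h

/-- `a * f n` is the difference of two consecutive terms of the convergent sequence `a * e n`. This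
is how elements of `A` become negligible along the `f n`. -/
lemma tendsto_mul_incProj (he : IsSigmaUnitOfProjections e) (a : A) :
    Tendsto (fun n => ‖toMultiplier A a * incProj e n‖) atTop (𝓝 0) := by
  have h1 := he.tendsto_mul_unitProj 1 a
  rw [mul_one] at h1
  have h2 := ((h1.comp (tendsto_add_atTop_nat 1)).sub h1).norm
  rw [sub_self, norm_zero] at h2
  rw [← tendsto_add_atTop_iff_nat 1]
  refine h2.congr fun n => ?_
  rw [incProj, increment, map_sub, mul_sub]
  rfl

lemma partialProj_mul_increment (he : IsSigmaUnitOfProjections e) (X : Set ℕ) {m n : ℕ} (h : n ≤ m) :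
    partialProj e X m * increment e n = X.indicator (increment e) n := by
  cases n with
  | zero =>
    rw [increment, he.partialProj_mul_of_le X h]
    simp [partialProj]
  | succ n =>
    rw [increment, mul_sub, he.partialProj_mul_of_le X h,
      he.partialProj_mul_of_le X (Nat.le_of_succ_le h)]
    simp [partialProj, Finset.sum_range_succ _ (n + 1)]

lemma multiplierProj_mul_incProj (he : IsSigmaUnitOfProjections e) (X : Set ℕ) (n : ℕ) :
    multiplierProj e X * incProj e n = toMultiplier A (X.indicator (increment e) n) := by
  refine tendsto_nhds_unique ((he.strictTendsto_multiplierProj X).tendsto_mul _)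
    (tendsto_const_nhds.congr' ?_)
  filter_upwards [eventually_ge_atTop n] with m hm
  rw [← map_mul, he.partialProj_mul_increment X hm]

lemma multiplierProj_mul_incProj_of_mem (he : IsSigmaUnitOfProjections e) {X : Set ℕ} {n : ℕ} (hn : n ∈ X) :
    multiplierProj e X * incProj e n = incProj e n := by
  rw [he.multiplierProj_mul_incProj, Set.indicator_of_mem hn]

lemma multiplierProj_mul_incProj_of_notMem (he : IsSigmaUnitOfProjections e) {X : Set ℕ} {n : ℕ} (hn : n ∉ X) :
    multiplierProj e X * incProj e n = 0 := by
  rw [he.multiplierProj_mul_incProj, Set.indicator_of_notMem hn, map_zero]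

lemma isStarProjection_multiplierProj (he : IsSigmaUnitOfProjections e) (X : Set ℕ) : IsStarProjection (multiplierProj e X) := by
  refine ⟨he.ext_incProj fun n => ?_, ?_⟩
  · by_cases hn : n ∈ X
    · rw [mul_assoc, he.multiplierProj_mul_incProj_of_mem hn,
        he.multiplierProj_mul_incProj_of_mem hn]
    · rw [mul_assoc, he.multiplierProj_mul_incProj_of_notMem hn, mul_zero]
  · refine multiplier_ext fun x => ?_
    have h := he.strictTendsto_multiplierProj X
    refine tendsto_nhds_unique ?_ (h.tendsto_mul x)
    rw [tendsto_iff_norm_sub_tendsto_zero]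
    refine (h (star x)).2.congr fun m => ?_
    rw [← norm_star, star_mul, star_sub, map_star, star_star, ← map_star,
      (he.isSelfAdjoint_partialProj X m).star_eq, sub_mul]

end IsSigmaUnitOfProjections

end Multiplier

/-! ### Colourings with small monochromatic row sums -/

section Coloring

/-- Greedy colouring in the order of `ρ`: the row sum of the new point splits over `r` colours, so
some colour receives at most `1 / r`. The new point is `ρ`-maximal, so the sums already controlled
do not see it. -/
lemma exists_coloring_finset {ι : Type*} [DecidableEq ι] (ρ : ι → ℤ) {w : ι → ι → ℝ}
    (hw0 : ∀ n k, 0 ≤ w n k)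
    (hw : ∀ n (t : Finset ι), ∑ k ∈ t, w n k ≤ 1) {r : ℕ} (hr : 0 < r) (s : Finset ι) :
    ∃ c : ι → Fin r, ∀ n ∈ s, ∑ k ∈ s with ρ k < ρ n ∧ c k = c n, w n k ≤ 1 / r := by
  induction s using Finset.induction_on_max_value ρ with
  | empty => exact ⟨fun _ => ⟨0, hr⟩, by simp⟩
  | insert a s has ha ih =>
    obtain ⟨c, hc⟩ := ih
    obtain ⟨i, -, hi⟩ : ∃ i ∈ (Finset.univ : Finset (Fin r)),
        ∑ k ∈ s with c k = i, w a k ≤ 1 / r := by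
      have : Nonempty (Fin r) := ⟨⟨0, hr⟩⟩
      refine Finset.exists_le_of_sum_le Finset.univ_nonempty ?_
      rw [Finset.sum_fiberwise]
      refine (hw a s).trans (le_of_eq ?_)
      have : (r : ℝ) ≠ 0 := by positivity
      simp [this]
    have hca : ∀ k ∈ s, Function.update c a i k = c k := fun k hk =>
      Function.update_of_ne (fun h : k = a => has (h ▸ hk)) _ _
    refine ⟨Function.update c a i, fun n hn => ?_⟩
    rcases Finset.mem_insert.1 hn with rfl | hn
    · rw [Function.update_self]
      refine (Finset.sum_le_sum_of_subset_of_nonneg ?_ fun _ _ _ => hw0 _ _).trans hi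
      intro k hk
      rw [Finset.mem_filter, Finset.mem_insert] at hk
      obtain ⟨hk1, hk2, hk3⟩ := hk
      have hks := hk1.resolve_left fun h => hk2.ne (congrArg ρ h)
      exact Finset.mem_filter.2 ⟨hks, by rw [← hk3, hca k hks]⟩
    · rw [hca n hn]
      refine (Finset.sum_le_sum_of_subset_of_nonneg ?_ fun _ _ _ => hw0 _ _).trans (hc n hn)
      intro k hk
      rw [Finset.mem_filter, Finset.mem_insert] at hk
      obtain ⟨hk1, hk2, hk3⟩ := hk
      have hks := hk1.resolve_left (fun h => hk2.not_ge (h ▸ ha n hn))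
      exact Finset.mem_filter.2 ⟨hks, hk2, by rw [← hk3, hca k hks]⟩

/-- The pair of the greedy colourings for the increasing and the decreasing order controls the
smaller and the larger indices at once. -/
lemma exists_coloring_range {w : ℕ → ℕ → ℝ} (hw0 : ∀ n k, 0 ≤ w n k)
    (hw : ∀ n (t : Finset ℕ), ∑ k ∈ t, w n k ≤ 1) {r : ℕ} (hr : 0 < r) (N : ℕ) :
    ∃ c : ℕ → Fin r × Fin r, ∀ n < N,
      ∑ k ∈ Finset.range N with k ≠ n ∧ c k = c n, w n k ≤ 2 / r := by
  obtain ⟨c, hc⟩ := exists_coloring_finset (fun n : ℕ => (n : ℤ)) hw0 hw hr (Finset.range N)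
  obtain ⟨d, hd⟩ : ∃ d : ℕ → Fin r, ∀ n ∈ Finset.range N,
      ∑ k ∈ Finset.range N with n < k ∧ d k = d n, w n k ≤ 1 / r := by
    obtain ⟨d, hd⟩ := exists_coloring_finset (fun n : ℕ => -(n : ℤ)) hw0 hw hr (Finset.range N)
    exact ⟨d, fun n hn => by simpa using hd n hn⟩
  refine ⟨fun n => (c n, d n), fun n hn => ?_⟩
  have h1 := hc n (Finset.mem_range.2 hn)
  simp only [Nat.cast_lt] at h1
  have h2 := hd n (Finset.mem_range.2 hn)
  calc _ ≤ ∑ k ∈ (Finset.range N).filter (fun k => k < n ∧ c k = c n) ∪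
          (Finset.range N).filter (fun k => n < k ∧ d k = d n), w n k := by
        refine Finset.sum_le_sum_of_subset_of_nonneg ?_ fun _ _ _ => hw0 _ _
        intro k hk
        simp only [Finset.mem_filter, Finset.mem_union, Prod.mk.injEq] at hk ⊢
        rcases lt_or_gt_of_ne hk.2.1 with h | h
        · exact Or.inl ⟨hk.1, h, hk.2.2.1⟩
        · exact Or.inr ⟨hk.1, h, hk.2.2.2⟩
    _ ≤ 1 / r + 1 / r := by
        have h3 := Finset.sum_union_inter (f := w n)
          (s₁ := (Finset.range N).filter (fun k => k < n ∧ c k = c n))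
          (s₂ := (Finset.range N).filter (fun k => n < k ∧ d k = d n))
        have h4 : 0 ≤ ∑ k ∈ (Finset.range N).filter (fun k => k < n ∧ c k = c n) ∩
          (Finset.range N).filter (fun k => n < k ∧ d k = d n), w n k :=
          Finset.sum_nonneg fun _ _ => hw0 _ _
        linarith
    _ = 2 / r := by ring

lemma Ultrafilter.exists_eventually_eq {α β : Type*} [Finite β] (U : Ultrafilter α) (c : α → β) :
    ∃ i, ∀ᶠ n in U, c n = i := by
  obtain ⟨i, hi⟩ := Ultrafilter.eq_pure_of_finite (U.map c)
  refine ⟨i, ?_⟩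
  have : ({i} : Set β) ∈ U.map c := by rw [hi]; exact Ultrafilter.mem_pure.2 rfl
  exact this

/-- Compactness: each colour is the limit, along an ultrafilter, of the colours in the finite
solutions, and every condition involves only finitely many indices. -/
lemma exists_coloring {w : ℕ → ℕ → ℝ} (hw0 : ∀ n k, 0 ≤ w n k)
    (hw : ∀ n (t : Finset ℕ), ∑ k ∈ t, w n k ≤ 1) {r : ℕ} (hr : 0 < r) :
    ∃ c : ℕ → Fin r × Fin r, ∀ n K,
      ∑ k ∈ Finset.range K with k ≠ n ∧ c k = c n, w n k ≤ 2 / r := by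
  choose c hc using exists_coloring_range hw0 hw hr
  choose d hd using fun n => (hyperfilter ℕ).exists_eventually_eq (fun N => c N n)
  refine ⟨d, fun n K => ?_⟩
  have hat : ∀ m, ∀ᶠ N in (hyperfilter ℕ : Filter ℕ), m < N := fun m =>
    (Nat.hyperfilter_le_atTop) (eventually_gt_atTop m)
  have hK : ∀ᶠ N in (hyperfilter ℕ : Filter ℕ), ∀ k ∈ Finset.range K, c N k = d k :=
    (Filter.eventually_all_finset _).2 fun k _ => hd k
  obtain ⟨N, hN1, hN2, hN3, hN4⟩ := ((hat n).and ((hat K).and ((hd n).and hK))).exists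
  refine (Finset.sum_le_sum_of_subset_of_nonneg ?_ fun _ _ _ => hw0 _ _).trans (hc N n hN1)
  intro k hk
  rw [Finset.mem_filter] at hk ⊢
  refine ⟨Finset.range_mono hN2.le hk.1, hk.2.1, ?_⟩
  rw [hN3, hN4 k hk.1, hk.2.2]

end Coloring

/-! ### Pure states concentrated at a projection -/

section Corner

open scoped ComplexOrder

variable {A : Type*} [NonUnitalCStarAlgebra A]

/-- The compression `m ↦ f m f` from the multiplier algebra to the algebra. -/
def compress (f : A) : 𝓜(ℂ, A) →L[ℂ] A :=
  LinearMap.mkContinuous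
    { toFun := fun m => f * m.fst f
      map_add' := fun m n => by simp [mul_add]
      map_smul' := fun c m => by simp [mul_smul_comm] } (‖f‖ * ‖f‖) fun m => by
    change ‖f * m.fst f‖ ≤ _
    calc ‖f * m.fst f‖ ≤ ‖f‖ * (‖m.fst‖ * ‖f‖) :=
          (norm_mul_le _ _).trans (by gcongr; exact m.fst.le_opNorm f)
      _ = ‖f‖ * ‖f‖ * ‖m‖ := by rw [DoubleCentralizer.norm_fst]; ring

lemma compress_apply (f : A) (m : 𝓜(ℂ, A)) : compress f m = f * m.fst f := rfl

lemma toMultiplier_compress (f : A) (m : 𝓜(ℂ, A)) :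
    toMultiplier A (compress f m) = toMultiplier A f * m * toMultiplier A f := by
  rw [compress_apply, map_mul, mul_assoc, mul_toMultiplier m f]

lemma IsPosFunctional.comp_toMultiplier {θ : 𝓜(ℂ, A) →L[ℂ] ℂ} (h : IsPosFunctional θ)
    {ψ : A →L[ℂ] ℂ} (hψ : ∀ a, ψ a = θ (toMultiplier A a)) : IsPosFunctional ψ := fun x => by
  rw [hψ, map_mul, StarHomClass.map_star]
  exact h _

/-- The restriction of a functional on the multiplier algebra to the algebra. -/
def restrictFunctional (θ : 𝓜(ℂ, A) →L[ℂ] ℂ) : A →L[ℂ] ℂ :=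
  LinearMap.mkContinuous
    { toFun := fun a => θ (toMultiplier A a)
      map_add' := fun a b => by rw [map_add, map_add]
      map_smul' := fun c a => by rw [map_smul, map_smul]; rfl } ‖θ‖ fun a => by
    have := θ.le_opNorm (toMultiplier A a)
    rwa [norm_toMultiplier] at this

lemma norm_restrictFunctional_le (θ : 𝓜(ℂ, A) →L[ℂ] ℂ) : ‖restrictFunctional θ‖ ≤ ‖θ‖ :=
  LinearMap.mkContinuous_norm_le _ (norm_nonneg _) _

lemma norm_eq_one_of_apply {ψ : A →L[ℂ] ℂ} (hψ : ‖ψ‖ ≤ 1) {f : A} (hf : ‖f‖ = 1) (h : ψ f = 1) :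
    ‖ψ‖ = 1 := by
  refine le_antisymm hψ ?_
  have := ψ.le_opNorm f
  rwa [h, hf, mul_one, norm_one] at this

lemma re_le_one_of_projection {ψ : A →L[ℂ] ℂ} (hψ : ψ ∈ stateSpace A) {f : A}
    (hf : IsStarProjection f) : (ψ f).re ≤ 1 := by
  refine (Complex.re_le_norm _).trans ((ψ.le_opNorm f).trans ?_)
  rw [hψ.2, one_mul]
  exact hf.norm_le _

lemma IsPosFunctional.projection_re {C : Type*} [NonUnitalCStarAlgebra C] {ψ : C →L[ℂ] ℂ}
    (hψ : IsPosFunctional ψ) {f : C} (hf : IsStarProjection f) : ((ψ f).re : ℂ) = ψ f :=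
  hψ.ofReal_re hf.isSelfAdjoint

/-- If a convex combination of two states is one at a projection, so are both states. -/
lemma apply_eq_one_of_openSegment {ψ θ₁ θ₂ : A →L[ℂ] ℂ} (h₁ : θ₁ ∈ stateSpace A)
    (h₂ : θ₂ ∈ stateSpace A) {f : A} (hf : IsStarProjection f) (hψ : ψ f = 1)
    (h : ψ ∈ openSegment ℝ θ₁ θ₂) : θ₁ f = 1 ∧ θ₂ f = 1 := by
  obtain ⟨a, b, ha, hb, hab, rfl⟩ := h
  have h3 := re_le_one_of_projection h₁ hf
  have h4 := re_le_one_of_projection h₂ hf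
  have h5 := congrArg Complex.re hψ
  simp only [_root_.add_apply, _root_.smul_apply, Complex.add_re, Complex.smul_re, smul_eq_mul,
    Complex.one_re] at h5
  have h6 : (θ₁ f).re = 1 := by nlinarith
  have h7 : (θ₂ f).re = 1 := by nlinarith
  rw [← IsPosFunctional.projection_re h₁.1 hf, ← IsPosFunctional.projection_re h₂.1 hf, h6, h7]
  simp

/-- Provides the real local convexity needed for Krein–Milman, by pulling back the product topology
under evaluation. -/
instance : LocallyConvexSpace ℝ (WeakDual ℂ A) :=
  LocallyConvexSpace.induced (𝕜 := ℝ) (F := A → ℂ)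
    { toFun := fun (η : WeakDual ℂ A) x => η x
      map_add' := fun _ _ => rfl
      map_smul' := fun _ _ => rfl }

/-- There is a pure state which is one at a given nonzero projection. -/
lemma exists_pureState_apply_eq_one {f : A} (hf : IsStarProjection f) (hf1 : ‖f‖ = 1) :
    ∃ ψ ∈ pureStates A, ψ f = 1 := by
  let := CStarAlgebra.spectralOrder 𝓜(ℂ, A)
  let := CStarAlgebra.spectralOrderedRing 𝓜(ℂ, A)
  -- These are the states with value one at `f`. The condition `η f = 1` forces norm one, so the
  -- closed ball can replace the sphere, which need not be weak-star closed.
  let K : Set (WeakDual ℂ A) := WeakDual.toStrongDual ⁻¹' Metric.closedBall 0 1 ∩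
    ({η | η f = 1} ∩ ⋂ x : A, {η | 0 ≤ η (star x * x)})
  have hKmem : ∀ η : A →L[ℂ] ℂ, StrongDual.toWeakDual η ∈ K ↔ η ∈ stateSpace A ∧ η f = 1 := by
    intro η
    constructor
    · rintro ⟨h1, h2, h3⟩
      exact ⟨⟨fun x => Set.mem_iInter.1 h3 x,
        norm_eq_one_of_apply (by simpa using h1) hf1 h2⟩, h2⟩
    · rintro ⟨h1, h2⟩
      exact ⟨by simpa using h1.2.le, h2, Set.mem_iInter.2 fun x => h1.1 x⟩
  have hK : IsCompact K := by
    refine (WeakDual.isCompact_closedBall (𝕜 := ℂ) (E := A) 0 1).inter_right ?_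
    refine (isClosed_eq (WeakDual.eval_continuous f) continuous_const).inter ?_
    refine isClosed_iInter fun x => ?_
    have : IsClosed {z : ℂ | 0 ≤ z} := isClosed_Ici
    exact this.preimage (WeakDual.eval_continuous (star x * x))
  have hq := hf.map (toMultiplier A)
  have hne : K.Nonempty := by
    -- A norming functional at `f` in the unital algebra `M(A)` is automatically a state; it is then
    -- restricted to `A`.
    obtain ⟨g, hg, hg1⟩ := exists_dual_vector ℂ (toMultiplier A f)
      (by rw [norm_toMultiplier, hf1]; exact one_ne_zero)
    rw [norm_toMultiplier, hf1] at hg1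
    have hgs : g ∈ stateSpace 𝓜(ℂ, A) :=
      mem_stateSpace_of_apply_eq_one hg.le hq.nonneg hq.le_one (by simpa using hg1)
    have h1 : restrictFunctional g f = 1 := hg1.trans (by simp)
    refine ⟨StrongDual.toWeakDual (restrictFunctional g), (hKmem _).2 ⟨⟨?_, ?_⟩, h1⟩⟩
    · exact IsPosFunctional.comp_toMultiplier hgs.1 fun a => rfl
    · exact norm_eq_one_of_apply ((norm_restrictFunctional_le g).trans hg.le) hf1 h1
  obtain ⟨η, hη⟩ := hK.extremePoints_nonempty hne
  have hη1 := (hKmem (WeakDual.toStrongDual η)).1 hη.1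
  refine ⟨WeakDual.toStrongDual η, mem_extremePoints.2 ⟨hη1.1, fun θ₁ h₁ θ₂ h₂ h => ?_⟩, hη1.2⟩
  -- `K` is a face of the state space, so its extreme points are pure states.
  obtain ⟨h3, h4⟩ := apply_eq_one_of_openSegment h₁ h₂ hf hη1.2 h
  exact (mem_extremePoints.1 hη).2 (StrongDual.toWeakDual θ₁) ((hKmem θ₁).2 ⟨h₁, h3⟩)
    (StrongDual.toWeakDual θ₂) ((hKmem θ₂).2 ⟨h₂, h4⟩) h

end Corner

/-! ### Extension of pure states from the algebra to its multiplier algebra -/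

section Extension

open scoped ComplexOrder

variable {A : Type*} [NonUnitalCStarAlgebra A] {e : ℕ → A}

namespace IsSigmaUnitOfProjections

lemma isStarProjection_sub_increment (he : IsSigmaUnitOfProjections e) {n N : ℕ} (h : n ≤ N) :
    IsStarProjection (e N - increment e n) := by
  have h1 := he.increment_mul_of_le h
  have h2 := congrArg star h1
  rw [star_mul, (he.isSelfAdjoint_increment _).star_eq,
    (he.isStarProjection N).isSelfAdjoint.star_eq] at h2
  refine ⟨?_, (he.isStarProjection N).isSelfAdjoint.sub (he.isSelfAdjoint_increment n)⟩
  have h3 := (he.isStarProjection N).isIdempotentElem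
  rw [IsIdempotentElem, sub_mul, mul_sub, mul_sub, h1, h2, he.increment_mul_increment, h3.eq]
  abel

/-- The projections `e N - f n` play the role of `1 - f n`: as `ψ (e N) ≤ 1 = ψ (f n)`, they lie in
the left kernel of `ψ` for `N ≥ n`, so `ψ (a * e N) = ψ (a * f n)`. Let `N → ∞`. -/
lemma state_apply_mul_increment (he : IsSigmaUnitOfProjections e) {n : ℕ} {ψ : A →L[ℂ] ℂ}
    (hψ : ψ ∈ stateSpace A) (h1 : ψ (increment e n) = 1) (a : A) :
    ψ (a * increment e n) = ψ a := by
  have hpos : IsPosFunctional ψ := hψ.1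
  refine tendsto_nhds_unique (tendsto_const_nhds.congr' ?_)
    ((ψ.continuous.tendsto _).comp (he.tendsto_mul_right a))
  filter_upwards [eventually_ge_atTop n] with N hN
  have hp := he.isStarProjection_sub_increment hN
  have hself : star (e N - increment e n) * (e N - increment e n) = e N - increment e n := by
    rw [hp.isSelfAdjoint.star_eq, hp.isIdempotentElem.eq]
  have h0 : (ψ (star (e N - increment e n) * (e N - increment e n))).re = 0 := by
    refine le_antisymm ?_ (hpos.self_re_nonneg _)
    rw [hself, map_sub, h1, Complex.sub_re, Complex.one_re, sub_nonpos]
    exact re_le_one_of_projection hψ (he.isStarProjection N)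
  have := hpos.mul_eq_zero_of_self h0 a
  rw [mul_sub, map_sub, sub_eq_zero] at this
  exact this.symm

lemma state_apply_compress (he : IsSigmaUnitOfProjections e) {n : ℕ} {ψ : A →L[ℂ] ℂ}
    (hψ : ψ ∈ stateSpace A) (h1 : ψ (increment e n) = 1) (a : A) :
    ψ (compress (increment e n) (toMultiplier A a)) = ψ a := by
  have hpos : IsPosFunctional ψ := hψ.1
  have e1 : compress (increment e n) (toMultiplier A a) = increment e n * (a * increment e n) := by
    apply (multiplierCoe_isometry A).injective
    rw [toMultiplier_compress, map_mul, map_mul, mul_assoc]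
  have e2 : increment e n * (a * increment e n)
      = star (star (a * increment e n) * increment e n) := by
    rw [star_mul, star_star, (he.isSelfAdjoint_increment n).star_eq]
  rw [e1, e2, hpos.map_star, he.state_apply_mul_increment hψ h1, hpos.map_star, star_star,
    he.state_apply_mul_increment hψ h1]

lemma apply_incProj_mul (he : IsSigmaUnitOfProjections e) {n : ℕ} {θ : 𝓜(ℂ, A) →L[ℂ] ℂ}
    (hθ : θ ∈ stateSpace 𝓜(ℂ, A)) (h1 : θ (incProj e n) = 1) (m : 𝓜(ℂ, A)) :
    θ (incProj e n * m) = θ m := by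
  let := CStarAlgebra.spectralOrder 𝓜(ℂ, A)
  let := CStarAlgebra.spectralOrderedRing 𝓜(ℂ, A)
  have hst := mem_stateSpace_iff.1 hθ
  exact hst.1.apply_mul_left (he.isStarProjection_incProj n).nonneg
    (he.isStarProjection_incProj n).le_one (by rw [h1, hst.2]) m

lemma apply_mul_incProj (he : IsSigmaUnitOfProjections e) {n : ℕ} {θ : 𝓜(ℂ, A) →L[ℂ] ℂ}
    (hθ : θ ∈ stateSpace 𝓜(ℂ, A)) (h1 : θ (incProj e n) = 1) (m : 𝓜(ℂ, A)) :
    θ (m * incProj e n) = θ m := by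
  let := CStarAlgebra.spectralOrder 𝓜(ℂ, A)
  let := CStarAlgebra.spectralOrderedRing 𝓜(ℂ, A)
  have hst := mem_stateSpace_iff.1 hθ
  exact hst.1.apply_mul_right (he.isStarProjection_incProj n).nonneg
    (he.isStarProjection_incProj n).le_one (by rw [h1, hst.2]) m

/-- A state with value one at `f n` does not change under compression by `f n`, and the compressed
element lies in `A`, where `θ` is prescribed. -/
lemma eq_comp_compress (he : IsSigmaUnitOfProjections e) {n : ℕ} {ψ : A →L[ℂ] ℂ}
    (h1 : ψ (increment e n) = 1) {θ : 𝓜(ℂ, A) →L[ℂ] ℂ} (hθ : θ ∈ stateSpace 𝓜(ℂ, A))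
    (h : ∀ a, θ (toMultiplier A a) = ψ a) : θ = ψ.comp (compress (increment e n)) := by
  have hθ1 : θ (incProj e n) = 1 := by rw [h, h1]
  ext m
  rw [ContinuousLinearMap.comp_apply, ← h, toMultiplier_compress, he.apply_mul_incProj hθ hθ1,
    he.apply_incProj_mul hθ hθ1]

lemma comp_compress_mem_stateSpace (he : IsSigmaUnitOfProjections e) {n : ℕ} {ψ : A →L[ℂ] ℂ}
    (hψ : ψ ∈ stateSpace A) (h1 : ψ (increment e n) = 1) :
    ψ.comp (compress (increment e n)) ∈ stateSpace 𝓜(ℂ, A) := by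
  refine mem_stateSpace_iff.2 ⟨fun x => ?_, ?_⟩
  · have e1 : compress (increment e n) (star x * x)
        = star (x.fst (increment e n)) * x.fst (increment e n) := by
      apply (multiplierCoe_isometry A).injective
      rw [toMultiplier_compress, map_mul, map_star, ← mul_toMultiplier, star_mul,
        (he.isStarProjection_incProj n).isSelfAdjoint.star_eq]
      simp only [mul_assoc]
    rw [ContinuousLinearMap.comp_apply, e1]
    exact hψ.1 _
  · have e1 : compress (increment e n) (1 : 𝓜(ℂ, A)) = increment e n := by
      apply (multiplierCoe_isometry A).injective
      rw [toMultiplier_compress, mul_one, he.incProj_mul_self]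
    rw [ContinuousLinearMap.comp_apply, e1, h1]

lemma restrictFunctional_mem_stateSpace (he : IsSigmaUnitOfProjections e) {n : ℕ}
    {θ : 𝓜(ℂ, A) →L[ℂ] ℂ} (hθ : θ ∈ stateSpace 𝓜(ℂ, A)) (h1 : θ (incProj e n) = 1) :
    restrictFunctional θ ∈ stateSpace A :=
  ⟨IsPosFunctional.comp_toMultiplier hθ.1 fun _ => rfl,
    norm_eq_one_of_apply ((norm_restrictFunctional_le θ).trans hθ.2.le) (he.norm_increment n) h1⟩

/-- A pure state which is one at some `f n` has a pure extension to the multiplier algebra. -/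
lemma comp_compress_mem_pureStates (he : IsSigmaUnitOfProjections e) {n : ℕ} {ψ : A →L[ℂ] ℂ}
    (hψ : ψ ∈ pureStates A) (h1 : ψ (increment e n) = 1) :
    ψ.comp (compress (increment e n)) ∈ pureStates 𝓜(ℂ, A) := by
  refine mem_extremePoints.2 ⟨he.comp_compress_mem_stateSpace hψ.1 h1, fun θ₁ h₁ θ₂ h₂ h => ?_⟩
  have h3 : ψ.comp (compress (increment e n)) (incProj e n) = 1 := by
    rw [ContinuousLinearMap.comp_apply, he.state_apply_compress hψ.1 h1, h1]
  -- Both components are one at `f n`, so each is determined by its restriction to `A`, which equals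
  -- `ψ` by purity.
  obtain ⟨h4, h5⟩ := apply_eq_one_of_openSegment h₁ h₂ (he.isStarProjection_incProj n) h3 h
  have hseg : ψ ∈ openSegment ℝ (restrictFunctional θ₁) (restrictFunctional θ₂) := by
    obtain ⟨a, b, ha, hb, hab, hs⟩ := h
    refine ⟨a, b, ha, hb, hab, ?_⟩
    ext x
    have := congrArg (fun f : 𝓜(ℂ, A) →L[ℂ] ℂ => f (toMultiplier A x)) hs
    simp only [ContinuousLinearMap.comp_apply, he.state_apply_compress hψ.1 h1] at this
    exact this
  obtain ⟨h6, h7⟩ := (mem_extremePoints.1 hψ).2 _ (he.restrictFunctional_mem_stateSpace h₁ h4) _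
    (he.restrictFunctional_mem_stateSpace h₂ h5) hseg
  exact ⟨he.eq_comp_compress h1 h₁ fun a => by rw [← h6]; rfl,
    he.eq_comp_compress h1 h₂ fun a => by rw [← h7]; rfl⟩

end IsSigmaUnitOfProjections

end Extension

/-! ### Limits along ultrafilters -/

section Limit

open scoped ComplexOrder

lemma Ultrafilter.le_cofinite_of_ne_pure {U : Ultrafilter ℕ} (hU : ∀ n, U ≠ pure n) :
    (U : Filter ℕ) ≤ cofinite := by
  rcases U.le_cofinite_or_eq_pure with h | ⟨n, hn⟩
  · exact h
  · exact absurd hn (hU n)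

/-- Banach–Alaoglu along an ultrafilter. In a unital algebra the normalisation is the condition `χ 1
= 1`, which survives pointwise limits. -/
lemma exists_state_tendsto {C : Type*} [CStarAlgebra C] {χ : ℕ → C →L[ℂ] ℂ}
    (hχ : ∀ n, χ n ∈ stateSpace C) (U : Ultrafilter ℕ) :
    ∃ Θ ∈ stateSpace C, ∀ m, Tendsto (fun n => χ n m) U (𝓝 (Θ m)) := by
  obtain ⟨Θ, -, hΘ⟩ := (WeakDual.isCompact_closedBall (𝕜 := ℂ) (E := C) 0 1).ultrafilter_le_nhds'
    (U.map fun n => StrongDual.toWeakDual (χ n)) (by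
      refine Ultrafilter.mem_map.2 (Filter.univ_mem' fun n => ?_)
      simpa using (hχ n).2.le)
  have ht : ∀ m, Tendsto (fun n => χ n m) U (𝓝 (Θ m)) := fun m =>
    ((WeakDual.eval_continuous m).tendsto Θ).comp
      (show Tendsto (fun n => StrongDual.toWeakDual (χ n)) U (𝓝 Θ) from hΘ)
  refine ⟨WeakDual.toStrongDual Θ, mem_stateSpace_iff.2 ⟨fun x => ?_, ?_⟩, ht⟩
  · have hc : IsClosed {z : ℂ | 0 ≤ z} := isClosed_Ici
    exact hc.mem_of_tendsto (ht _) (Eventually.of_forall fun n => (hχ n).1 x)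
  · refine tendsto_nhds_unique (ht 1) (tendsto_const_nhds.congr fun n => ?_)
    exact ((mem_stateSpace_iff.1 (hχ n)).2).symm

variable {A : Type*} [NonUnitalCStarAlgebra A]

lemma Corona.mk_surjective : Function.Surjective (Corona.mk A) := Corona.mkRingHom_surjective

lemma Corona.mk_eq_zero {m : 𝓜(ℂ, A)} : Corona.mk A m = 0 ↔ ∃ a : A, toMultiplier A a = m :=
  Corona.mkRingHom_eq_zero

lemma Corona.norm_mk_le (m : 𝓜(ℂ, A)) : ‖Corona.mk A m‖ ≤ ‖m‖ := Corona.norm_mkRingHom_le m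

/-- A functional on the multiplier algebra vanishing on the algebra descends to the corona. -/
lemma Corona.exists_lift {Θ : 𝓜(ℂ, A) →L[ℂ] ℂ} (h : ∀ a, Θ (toMultiplier A a) = 0) :
    ∃ Φ : Corona A →L[ℂ] ℂ, ∀ m, Φ (Corona.mk A m) = Θ m := by
  let g : Corona A → ℂ := fun x => Θ (Function.surjInv Corona.mk_surjective x)
  have hg : ∀ m, g (Corona.mk A m) = Θ m := by
    intro m
    have h1 : Corona.mk A (Function.surjInv Corona.mk_surjective (Corona.mk A m) - m) = 0 := by
      rw [map_sub, Function.surjInv_eq Corona.mk_surjective, sub_self]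
    obtain ⟨a, ha⟩ := Corona.mk_eq_zero.1 h1
    have := h a
    rwa [ha, map_sub, sub_eq_zero] at this
  let G : Corona A →ₗ[ℂ] ℂ :=
    { toFun := g
      map_add' := fun x y => by
        obtain ⟨m, rfl⟩ := Corona.mk_surjective x
        obtain ⟨m', rfl⟩ := Corona.mk_surjective y
        rw [← map_add, hg, hg, hg, map_add]
      map_smul' := fun c x => by
        obtain ⟨m, rfl⟩ := Corona.mk_surjective x
        rw [← map_smul, hg, hg, map_smul]
        rfl }
  refine ⟨LinearMap.mkContinuous G ‖Θ‖ fun x => ?_, hg⟩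
  refine le_of_forall_pos_le_add fun ε hε => ?_
  obtain ⟨m, rfl, hm⟩ := Corona.exists_norm_lt x (show 0 < ε / (‖Θ‖ + 1) by positivity)
  change ‖g (Corona.mk A m)‖ ≤ _
  rw [hg]
  calc ‖Θ m‖ ≤ ‖Θ‖ * ‖m‖ := Θ.le_opNorm m
    _ ≤ ‖Θ‖ * (‖Corona.mk A m‖ + ε / (‖Θ‖ + 1)) := by gcongr; exact hm.le
    _ = ‖Θ‖ * ‖Corona.mk A m‖ + ‖Θ‖ * (ε / (‖Θ‖ + 1)) := by ring
    _ ≤ ‖Θ‖ * ‖Corona.mk A m‖ + (‖Θ‖ + 1) * (ε / (‖Θ‖ + 1)) := by gcongr; linarith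
    _ = ‖Θ‖ * ‖Corona.mk A m‖ + ε := by field_simp

lemma Corona.comp_mk_mem_stateSpace {Φ : Corona A →L[ℂ] ℂ} {Θ : 𝓜(ℂ, A) →L[ℂ] ℂ}
    (h : ∀ m, Φ (Corona.mk A m) = Θ m) : Φ ∈ stateSpace (Corona A) ↔ Θ ∈ stateSpace 𝓜(ℂ, A) := by
  rw [mem_stateSpace_iff, mem_stateSpace_iff]
  refine and_congr ⟨fun hp x => ?_, fun hp x => ?_⟩ ?_
  · rw [← h, map_mul, StarHomClass.map_star]
    exact hp _
  · obtain ⟨m, rfl⟩ := Corona.mk_surjective x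
    rw [← StarHomClass.map_star, ← map_mul, h]
    exact hp m
  · rw [← h, map_one (Corona.mk A)]

/-- The pullback of a functional on the corona to the multiplier algebra. -/
def Corona.pullback (Φ : Corona A →L[ℂ] ℂ) : 𝓜(ℂ, A) →L[ℂ] ℂ :=
  LinearMap.mkContinuous
    { toFun := fun m => Φ (Corona.mk A m)
      map_add' := fun a b => by rw [map_add, map_add]
      map_smul' := fun c a => by rw [map_smul, map_smul]; rfl } ‖Φ‖ fun m =>
    (Φ.le_opNorm _).trans (mul_le_mul_of_nonneg_left (Corona.norm_mk_le m) (norm_nonneg _))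

lemma Corona.pullback_apply (Φ : Corona A →L[ℂ] ℂ) (m : 𝓜(ℂ, A)) :
    Corona.pullback Φ m = Φ (Corona.mk A m) := rfl

variable {e : ℕ → A}

namespace IsSigmaUnitOfProjections

/-- The value at `a` equals the value at `a * f n`, whose norm tends to zero. -/
lemma tendsto_apply_toMultiplier (he : IsSigmaUnitOfProjections e) {χ : ℕ → 𝓜(ℂ, A) →L[ℂ] ℂ}
    (hχ : ∀ n, χ n ∈ stateSpace 𝓜(ℂ, A)) (h1 : ∀ n, χ n (incProj e n) = 1) (a : A) :
    Tendsto (fun n => χ n (toMultiplier A a)) atTop (𝓝 0) := by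
  refine squeeze_zero_norm (fun n => ?_) (he.tendsto_mul_incProj a)
  rw [← he.apply_mul_incProj (hχ n) (h1 n)]
  have := (χ n).le_opNorm (toMultiplier A a * incProj e n)
  rwa [(hχ n).2, one_mul] at this

/-- The limit along a nonprincipal ultrafilter of states concentrated at the `f n` is a state of
the corona. -/
lemma exists_coronaState (he : IsSigmaUnitOfProjections e) {χ : ℕ → 𝓜(ℂ, A) →L[ℂ] ℂ}
    (hχ : ∀ n, χ n ∈ stateSpace 𝓜(ℂ, A)) (h1 : ∀ n, χ n (incProj e n) = 1)
    {U : Ultrafilter ℕ} (hU : (U : Filter ℕ) ≤ cofinite) :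
    ∃ Φ ∈ stateSpace (Corona A), ∀ m, Tendsto (fun n => χ n m) U (𝓝 (Φ (Corona.mk A m))) := by
  obtain ⟨Θ, hΘ, ht⟩ := exists_state_tendsto hχ U
  obtain ⟨Φ, hΦ⟩ := Corona.exists_lift (Θ := Θ) fun a =>
    tendsto_nhds_unique (ht _) ((he.tendsto_apply_toMultiplier hχ h1 a).mono_left
      (by rwa [← Nat.cofinite_eq_atTop]))
  exact ⟨Φ, (Corona.comp_mk_mem_stateSpace hΦ).2 hΘ, fun m => by rw [hΦ]; exact ht m⟩

lemma apply_multiplierProj_of_mem (he : IsSigmaUnitOfProjections e) {χ : 𝓜(ℂ, A) →L[ℂ] ℂ}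
    (hχ : χ ∈ stateSpace 𝓜(ℂ, A)) {n : ℕ} (h1 : χ (incProj e n) = 1) {X : Set ℕ} (hn : n ∈ X) :
    χ (multiplierProj e X) = 1 := by
  rw [← he.apply_mul_incProj hχ h1, he.multiplierProj_mul_incProj_of_mem hn, h1]

lemma apply_multiplierProj_of_notMem (he : IsSigmaUnitOfProjections e) {χ : 𝓜(ℂ, A) →L[ℂ] ℂ}
    (hχ : χ ∈ stateSpace 𝓜(ℂ, A)) {n : ℕ} (h1 : χ (incProj e n) = 1) {X : Set ℕ} (hn : n ∉ X) :
    χ (multiplierProj e X) = 0 := by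
  rw [← he.apply_mul_incProj hχ h1, he.multiplierProj_mul_incProj_of_notMem hn, map_zero]

/-- The numbers `χ n (p_X)` are the values of the indicator function of `X`, whose limit along `U`
is one exactly when `X ∈ U`. -/
lemma coronaSets_eq (he : IsSigmaUnitOfProjections e) {χ : ℕ → 𝓜(ℂ, A) →L[ℂ] ℂ}
    (hχ : ∀ n, χ n ∈ stateSpace 𝓜(ℂ, A)) (h1 : ∀ n, χ n (incProj e n) = 1)
    {U : Ultrafilter ℕ} {Φ : Corona A →L[ℂ] ℂ}
    (ht : ∀ m, Tendsto (fun n => χ n m) U (𝓝 (Φ (Corona.mk A m)))) :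
    coronaSets e Φ = {X | X ∈ U} := by
  ext X
  change Φ _ = 1 ↔ X ∈ U
  constructor
  · intro h
    by_contra hX
    have hX' : ∀ᶠ n in U, n ∉ X := Ultrafilter.compl_mem_iff_notMem.2 hX
    have := tendsto_nhds_unique (ht (multiplierProj e X)) (tendsto_const_nhds.congr'
      (hX'.mono fun n hn => (he.apply_multiplierProj_of_notMem (hχ n) (h1 n) hn).symm))
    rw [h] at this
    exact one_ne_zero this
  · intro hX
    have hX' : ∀ᶠ n in U, n ∈ X := hX
    exact tendsto_nhds_unique (ht (multiplierProj e X)) (tendsto_const_nhds.congr'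
      (hX'.mono fun n hn => (he.apply_multiplierProj_of_mem (hχ n) (h1 n) hn).symm))

end IsSigmaUnitOfProjections

end Limit

/-! ### Purity of the limit states -/

section Purity

open scoped ComplexOrder

namespace IsPosFunctional

variable {C : Type*} [CStarAlgebra C] {φ : C →L[ℂ] ℂ}

lemma add_self_le (h : IsPosFunctional φ) (x y : C) :
    (φ (star (x + y) * (x + y))).re ≤ 2 * (φ (star x * x)).re + 2 * (φ (star y * y)).re := by
  have h1 := h.self_re_nonneg (x - y)
  have e : star (x + y) * (x + y) + star (x - y) * (x - y)
      = star x * x + star x * x + (star y * y + star y * y) := by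
    rw [star_add, star_sub]; noncomm_ring
  have h2 := congrArg (fun z => (φ z).re) e
  simp only [map_add, Complex.add_re] at h2
  linarith

lemma mul_self_le (h : IsPosFunctional φ) (x y : C) :
    (φ (star (x * y) * (x * y))).re ≤ ‖x‖ ^ 2 * (φ (star y * y)).re := by
  let := CStarAlgebra.spectralOrder C
  let := CStarAlgebra.spectralOrderedRing C
  have h1 := star_left_conjugate_le_conjugate
    (CStarAlgebra.star_mul_le_algebraMap_norm_sq (a := x)) y
  have e1 : star (x * y) * (x * y) = star y * (star x * x) * y := by
    rw [star_mul]; simp only [mul_assoc]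
  have e2 : star y * algebraMap ℝ C (‖x‖ ^ 2) * y = ((‖x‖ ^ 2 : ℝ) : ℂ) • (star y * y) := by
    rw [Algebra.algebraMap_eq_smul_one, mul_smul_comm, smul_mul_assoc, mul_one, Complex.coe_smul]
  rw [← e1, e2] at h1
  have := h.re_mono h1
  rwa [map_smul, smul_eq_mul, Complex.re_ofReal_mul] at this

end IsPosFunctional

variable {A : Type*} [NonUnitalCStarAlgebra A] {e : ℕ → A}

namespace IsSigmaUnitOfProjections

lemma mul_incProj_mul (he : IsSigmaUnitOfProjections e) {T : 𝓜(ℂ, A)} (hT : IsSelfAdjoint T)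
    {k : ℕ} {c : 𝓜(ℂ, A)} (hc : IsSelfAdjoint c)
    (h : T * incProj e k = incProj e k * c * incProj e k) :
    T * incProj e k * T
      = incProj e k * c * incProj e k * (incProj e k * c * incProj e k) := by
  have hs := (he.isStarProjection_incProj k).isSelfAdjoint
  have h2 := congrArg star h
  simp only [star_mul, hT.star_eq, hs.star_eq, hc.star_eq] at h2
  rw [← mul_assoc] at h2
  nth_rewrite 1 [← he.incProj_mul_self k]
  rw [← mul_assoc, mul_assoc (T * incProj e k), h, h2]

/-- Since `y * f n` lies in `A`, a state concentrated at `f n` allows the approximate unit to be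
inserted between two multipliers. This expands values at products into sums over blocks. -/
lemma tendsto_apply_mul_unitProj (he : IsSigmaUnitOfProjections e) {n : ℕ}
    {χ : 𝓜(ℂ, A) →L[ℂ] ℂ} (hχ : χ ∈ stateSpace 𝓜(ℂ, A)) (h1 : χ (incProj e n) = 1)
    (x y : 𝓜(ℂ, A)) : Tendsto (fun K => χ (x * unitProj e K * y)) atTop (𝓝 (χ (x * y))) := by
  have h2 := (he.tendsto_unitProj_mul y (increment e n)).const_mul x
  have h3 := (χ.continuous.tendsto _).comp h2
  rw [← mul_assoc, he.apply_mul_incProj hχ h1] at h3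
  refine h3.congr fun K => ?_
  rw [Function.comp_apply, ← mul_assoc, ← mul_assoc, he.apply_mul_incProj hχ h1]

section Order

variable [PartialOrder 𝓜(ℂ, A)] [StarOrderedRing 𝓜(ℂ, A)]

/-- Here `c = a * a`, where `a` excises `χ` at the compression of `m - χ m` by `f n`. It controls
the diagonal term of the block-diagonal element built later: that term is small as soon as `χ m` is.
-/
lemma exists_corner_excision (he : IsSigmaUnitOfProjections e) {n : ℕ} {χ : 𝓜(ℂ, A) →L[ℂ] ℂ}
    (hχ : χ ∈ pureStates 𝓜(ℂ, A)) (h1 : χ (incProj e n) = 1) {m : 𝓜(ℂ, A)}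
    (hm : IsSelfAdjoint m) {ε : ℝ} (hε : 0 < ε) :
    ∃ c : 𝓜(ℂ, A), 0 ≤ c ∧ c ≤ 1 ∧ 1 - ε ≤ (χ (incProj e n * c * incProj e n)).re ∧
      (χ (m * (incProj e n * c * incProj e n * (incProj e n * c * incProj e n)) * m)).re
        ≤ ε + 2 * (χ m).re ^ 2 := by
  have hst := mem_stateSpace_iff.1 hχ.1
  set q := incProj e n with hq
  have hqp : IsStarProjection q := he.isStarProjection_incProj n
  have hqs : IsSelfAdjoint q := hqp.isSelfAdjoint
  have hqq : q * q = q := hqp.isIdempotentElem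
  set t : ℝ := (χ m).re with ht
  have htm : (t : ℂ) = χ m := hst.1.ofReal_re hm
  set y : 𝓜(ℂ, A) := q * (m - (t : ℂ) • 1) * q with hy
  have hys : IsSelfAdjoint y :=
    (hm.sub (.smul (Complex.conj_ofReal t) (.one _))).conjugate_self hqs
  have hqmq : ∀ x, χ (q * x * q) = χ x := fun x => by
    rw [he.apply_mul_incProj hχ.1 h1, he.apply_incProj_mul hχ.1 h1]
  have hy0 : χ y = 0 := by
    rw [hy, hqmq, map_sub, map_smul, hst.2, htm]; simp
  set δ : ℝ := min 1 (ε / (4 + 4 * ‖y‖ ^ 2)) with hδ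
  have hδ0 : 0 < δ := lt_min one_pos (by positivity)
  have hδ1 : δ ≤ 1 := min_le_left _ _
  have hδε : δ * (4 + 4 * ‖y‖ ^ 2) ≤ ε := by
    rw [← le_div_iff₀ (by positivity)]; exact min_le_right _ _
  obtain ⟨a, a0, a1, a2, a3⟩ := exists_excision hχ hys hy0 hδ0
  have has : IsSelfAdjoint a := .of_nonneg a0
  have haa0 : 0 ≤ a * a := by simpa [has.star_eq] using star_mul_self_nonneg a
  have haa1 : a * a ≤ 1 := (sq_le_self_of_mem_Icc a0 a1).trans a1
  have hna : ‖a‖ ≤ 1 := (CStarAlgebra.norm_le_one_iff_of_nonneg a a0).2 a1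
  refine ⟨a * a, haa0, haa1, ?_, ?_⟩
  · rw [hqmq]
    nlinarith [sq_nonneg ‖y‖]
  have hb0 : 0 ≤ q * (a * a) * q := hqs.conjugate_nonneg haa0
  have hb1 : q * (a * a) * q ≤ 1 := by
    refine (hqs.conjugate_le_conjugate haa1).trans ?_
    rw [mul_one, hqq]
    exact hqp.le_one
  have hle : (χ (m * (q * (a * a) * q * (q * (a * a) * q)) * m)).re
      ≤ (χ (m * (q * (a * a) * q) * m)).re :=
    hst.1.re_mono (hm.conjugate_le_conjugate (sq_le_self_of_mem_Icc hb0 hb1))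
  refine hle.trans ?_
  -- With `y` the excised element, `a * (q * m * q) = a * y + t • (a * q)`. The first summand is
  -- small and the second contributes at most `t ^ 2`.
  have e1 : χ (m * (q * (a * a) * q) * m)
      = χ (star (a * y + (t : ℂ) • (a * q)) * (a * y + (t : ℂ) • (a * q))) := by
    have e2 : a * y + (t : ℂ) • (a * q) = a * (q * m * q) := by
      rw [hy, mul_sub, sub_mul, mul_smul_comm, smul_mul_assoc, mul_one, hqq, mul_sub,
        mul_smul_comm]
      abel
    rw [e2, ← hqmq]
    congr 1
    simp only [star_mul, has.star_eq, hqs.star_eq, hm.star_eq, mul_assoc]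
  rw [e1]
  have h2 := hst.1.add_self_le (a * y) ((t : ℂ) • (a * q))
  have h3 : (χ (star ((t : ℂ) • (a * q)) * ((t : ℂ) • (a * q)))).re ≤ t ^ 2 := by
    have e3 : star ((t : ℂ) • (a * q)) * ((t : ℂ) • (a * q))
        = ((t ^ 2 : ℝ) : ℂ) • (star (a * q) * (a * q)) := by
      rw [star_smul, smul_mul_smul_comm, Complex.star_def, Complex.conj_ofReal]
      push_cast
      rw [sq]
    rw [e3, map_smul, smul_eq_mul, Complex.re_ofReal_mul]
    refine mul_le_of_le_one_right (sq_nonneg t) ?_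
    refine (hst.1.mul_self_le a q).trans ?_
    rw [hqs.star_eq, hqq, h1, Complex.one_re, mul_one]
    exact pow_le_one₀ (norm_nonneg _) hna
  have h4 : (χ (star (a * y) * (a * y))).re ≤ 2 * δ + 2 * (‖y‖ ^ 2 * δ) := by
    have e4 : a * y = a * y * a + a * y * (1 - a) := by noncomm_ring
    rw [e4]
    refine (hst.1.add_self_le _ _).trans ?_
    have h5 : (χ (star (a * y * a) * (a * y * a))).re ≤ δ := by
      refine (hst.1.self_le _).trans ?_
      rw [hst.2, Complex.one_re, one_mul]
      nlinarith [norm_nonneg (a * y * a)]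
    have h6 : (χ (star (a * y * (1 - a)) * (a * y * (1 - a)))).re ≤ ‖y‖ ^ 2 * δ := by
      refine (hst.1.mul_self_le _ _).trans ?_
      have h7 : ‖a * y‖ ≤ ‖y‖ :=
        (norm_mul_le _ _).trans (mul_le_of_le_one_left (norm_nonneg _) hna)
      have h8 : (χ (star (1 - a) * (1 - a))).re ≤ δ := by
        rw [((IsSelfAdjoint.one _).sub has).star_eq]
        have := hst.1.re_mono ((one_sub_sq_le a0 a1).trans
          (sub_le_sub_left (sq_le_self_of_mem_Icc a0 a1) 1))
        rw [map_sub χ 1 (a * a), hst.2, Complex.sub_re, Complex.one_re] at this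
        linarith
      exact mul_le_mul (pow_le_pow_left₀ (norm_nonneg _) h7 2) h8 (hst.1.self_re_nonneg _)
        (sq_nonneg _)
    linarith
  linarith

/-- For each `r`, a contraction `T` is found such that `Θ m = Θ (T * m)` and `Φ (m * T * (T * m))`
is at most a constant times `2 / r`. Domination transfers this bound to `Θ`, up to the factor `1 /
α`. -/
lemma eq_zero_of_dominated (he : IsSigmaUnitOfProjections e) {χ : ℕ → 𝓜(ℂ, A) →L[ℂ] ℂ}
    (hχ : ∀ n, χ n ∈ pureStates 𝓜(ℂ, A)) (h1 : ∀ n, χ n (incProj e n) = 1)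
    {U : Ultrafilter ℕ} (hU : (U : Filter ℕ) ≤ cofinite) {Φ Θ : 𝓜(ℂ, A) →L[ℂ] ℂ}
    (ht : ∀ m, Tendsto (fun n => χ n m) U (𝓝 (Φ m))) (hΘ : Θ ∈ stateSpace 𝓜(ℂ, A))
    {α : ℝ} (hα : 0 < α) (hdom : ∀ x, α * (Θ (star x * x)).re ≤ (Φ (star x * x)).re)
    {m : 𝓜(ℂ, A)} (hm : IsSelfAdjoint m) (hm0 : Φ m = 0) : Θ m = 0 := by
  have hst := fun n => mem_stateSpace_iff.1 (hχ n).1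
  have hΘs := mem_stateSpace_iff.1 hΘ
  have hre : ∀ m, Tendsto (fun n => (χ n m).re) U (𝓝 (Φ m).re) := fun m =>
    (Complex.continuous_re.tendsto _).comp (ht m)
  have hinv : Tendsto (fun n : ℕ => 1 / ((n : ℝ) + 1)) U (𝓝 0) :=
    tendsto_one_div_add_atTop_nhds_zero_nat.mono_left (by rwa [← Nat.cofinite_eq_atTop])
  choose c hc0 hc1 hc2 hc3 using fun n =>
    he.exists_corner_excision (hχ n) (h1 n) hm (show (0 : ℝ) < 1 / ((n : ℝ) + 1) by positivity)
  let b : ℕ → 𝓜(ℂ, A) := fun k => incProj e k * c k * incProj e k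
  have hqs : ∀ k, IsSelfAdjoint (incProj e k) := fun k =>
    (he.isStarProjection_incProj k).isSelfAdjoint
  have hbs : ∀ k, IsSelfAdjoint (b k) := fun k =>
    (IsSelfAdjoint.of_nonneg (hc0 k)).conjugate_self (hqs k)
  have hb0 : ∀ k, 0 ≤ b k := fun k => (hqs k).conjugate_nonneg (hc0 k)
  have hbq : ∀ k, b k ≤ incProj e k := fun k => by
    have := (hqs k).conjugate_le_conjugate (hc1 k)
    rwa [mul_one, he.incProj_mul_self] at this
  have hbb0 : ∀ k, 0 ≤ b k * b k := fun k => by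
    simpa [(hbs k).star_eq] using star_mul_self_nonneg (b k)
  have hbb1 : ∀ k, b k * b k ≤ incProj e k := fun k =>
    (sq_le_self_of_mem_Icc (hb0 k) ((hbq k).trans (he.isStarProjection_incProj k).le_one)).trans
      (hbq k)
  set M : ℝ := ‖m‖ ^ 2 + 1 with hM
  have hM0 : 0 < M := by positivity
  -- The `b k * b k` lie below orthogonal projections with partial sums at most one, so after
  -- division by `M` every row sum is at most one.
  let w : ℕ → ℕ → ℝ := fun n k => (χ n (m * (b k * b k) * m)).re / M
  have hw0 : ∀ n k, 0 ≤ w n k := fun n k =>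
    div_nonneg ((hst n).1.re_nonneg (hm.conjugate_nonneg (hbb0 k))) hM0.le
  have hw1 : ∀ n (s : Finset ℕ), ∑ k ∈ s, w n k ≤ 1 := by
    intro n s
    obtain ⟨K, hK⟩ := s.exists_nat_subset_range
    refine (Finset.sum_le_sum_of_subset_of_nonneg (hK.trans (Finset.range_mono K.le_succ))
      fun _ _ _ => hw0 _ _).trans ?_
    simp only [w]
    rw [← Finset.sum_div, div_le_one hM0, ← Complex.re_sum, ← map_sum, ← Finset.sum_mul,
      ← Finset.mul_sum]
    have h2 : ∑ k ∈ Finset.range K.succ, b k * b k ≤ 1 := by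
      refine (Finset.sum_le_sum fun k _ => hbb1 k).trans ?_
      rw [Nat.succ_eq_add_one, sum_incProj]
      exact (he.isStarProjection_unitProj K).le_one
    refine ((hst n).1.re_mono (hm.conjugate_le_conjugate h2)).trans ?_
    have h3 := (hst n).1.self_le m
    rw [(hst n).2, Complex.one_re, one_mul, hm.star_eq] at h3
    rw [mul_one]
    linarith
  have key : ∀ r : ℕ, 0 < r → ‖Θ m‖ ^ 2 ≤ M * (2 / r) / α := by
    intro r hr
    obtain ⟨d, hd⟩ := exists_coloring hw0 hw1 hr
    obtain ⟨i, hi⟩ := U.exists_eventually_eq d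
    classical
    obtain ⟨T, hT, hT1, hTf⟩ := he.exists_blockDiagonal (fun k => if d k = i then c k else 0)
      (fun k => by split_ifs; exacts [hc0 k, le_rfl])
      (fun k => by split_ifs; exacts [hc1 k, zero_le_one])
    have hTb : ∀ k, d k = i → T * incProj e k = b k := fun k hk => by
      rw [hTf]; simp [hk, b]
    have hTT : ∀ k, T * incProj e k * T = if d k = i then b k * b k else 0 := by
      intro k
      split_ifs with hk
      · exact he.mul_incProj_mul hT (.of_nonneg (hc0 k)) (hTb k hk)
      · rw [hTf, if_neg hk]; simp
    -- `T` is one in the limit, so `1 - T` is in the left kernel of `Φ`, hence in that of `Θ`.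
    have hlow : ∀ n, d n = i → (χ n ((1 - T) * (1 - T))).re ≤ 2 * (1 / ((n : ℝ) + 1)) := by
      intro n hn
      have e1 : (1 - T) * (1 - T) = 1 - (T + T) + star T * T := by
        rw [hT.star_eq]; noncomm_ring
      have h2 : (χ n T).re ≥ 1 - 1 / ((n : ℝ) + 1) := by
        rw [← he.apply_mul_incProj (hχ n).1 (h1 n), hTb n hn]
        exact hc2 n
      have h3 := (hst n).1.self_le T
      rw [(hst n).2, Complex.one_re, one_mul] at h3
      have h4 : ‖T‖ ^ 2 ≤ 1 := pow_le_one₀ (norm_nonneg _) hT1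
      rw [e1, map_add, map_sub, map_add, (hst n).2]
      simp only [Complex.add_re, Complex.sub_re, Complex.one_re]
      linarith
    -- The terms with `k ≠ n` are bounded by the colouring, the term `k = n` by the excision.
    have hup : ∀ n, d n = i → (χ n (m * T * (T * m))).re
        ≤ M * (2 / r) + (1 / ((n : ℝ) + 1) + 2 * (χ n m).re ^ 2) := by
      intro n hn
      have h2 := (Complex.continuous_re.tendsto _).comp
        (he.tendsto_apply_mul_unitProj (hχ n).1 (h1 n) (m * T) (T * m))
      refine le_of_tendsto h2 (Eventually.of_forall fun K => ?_)
      have e1 : m * T * unitProj e K * (T * m)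
          = ∑ k ∈ Finset.range (K + 1) with d k = i, m * (b k * b k) * m := by
        have : m * T * unitProj e K * (T * m) = m * (T * unitProj e K * T) * m := by
          simp only [mul_assoc]
        rw [this, ← sum_incProj, Finset.mul_sum, Finset.sum_mul, Finset.sum_congr rfl fun k _ => hTT k,
          ← Finset.sum_filter, Finset.mul_sum, Finset.sum_mul]
      rw [Function.comp_apply, e1, map_sum, Complex.re_sum]
      have e2 : ∀ k, (χ n (m * (b k * b k) * m)).re = M * w n k := fun k => by
        simp only [w]; field_simp
      have h3 : ∑ k ∈ Finset.range (K + 1) with d k = i, (χ n (m * (b k * b k) * m)).re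
          ≤ ∑ k ∈ Finset.range (K + 1) with k ≠ n ∧ d k = d n, (χ n (m * (b k * b k) * m)).re
            + (χ n (m * (b n * b n) * m)).re := by
        rw [← Finset.sum_singleton (fun k => (χ n (m * (b k * b k) * m)).re) n,
          ← Finset.sum_union (by simp)]
        refine Finset.sum_le_sum_of_subset_of_nonneg ?_ fun k _ _ => ?_
        · intro k hk
          simp only [Finset.mem_filter, Finset.mem_union, Finset.mem_singleton] at hk ⊢
          by_cases hkn : k = n
          · exact Or.inr hkn
          · exact Or.inl ⟨hk.1, hkn, hk.2.trans hn.symm⟩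
        · exact (hst n).1.re_nonneg (hm.conjugate_nonneg (hbb0 k))
      refine h3.trans (add_le_add ?_ (hc3 n))
      simp only [e2]
      rw [← Finset.mul_sum]
      exact mul_le_mul_of_nonneg_left (hd n (K + 1)) hM0.le
    have hΘ1 : (Θ (star (1 - T) * (1 - T))).re = 0 := by
      refine le_antisymm ?_ (hΘs.1.self_re_nonneg _)
      have h2 : (Φ ((1 - T) * (1 - T))).re ≤ 0 := by
        have h3 := hinv.const_mul 2
        rw [mul_zero] at h3
        exact le_of_tendsto_of_tendsto (hre _) h3 (hi.mono hlow)
      have h3 := hdom (1 - T)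
      rw [((IsSelfAdjoint.one _).sub hT).star_eq] at h3 ⊢
      nlinarith
    have hΘ2 : (Φ (m * T * (T * m))).re ≤ M * (2 / r) := by
      have h2 := ((hinv.add (((hre m).pow 2).const_mul 2)).const_add (M * (2 / r)))
      rw [hm0] at h2
      simp only [Complex.zero_re, ne_eq, OfNat.ofNat_ne_zero, not_false_eq_true, zero_pow,
        mul_zero, add_zero] at h2
      exact le_of_tendsto_of_tendsto (hre _) h2 (hi.mono hup)
    have e3 : Θ m = Θ (T * m) := by
      have := hΘs.1.star_mul_eq_zero_of_self hΘ1 m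
      rw [((IsSelfAdjoint.one _).sub hT).star_eq, sub_mul, one_mul, map_sub, sub_eq_zero] at this
      exact this
    rw [e3, le_div_iff₀' hα]
    have h4 := hΘs.1.norm_sq_le_one hΘs.2 (T * m)
    have h5 := hdom (T * m)
    rw [star_mul, hT.star_eq, hm.star_eq] at h4 h5
    calc α * ‖Θ (T * m)‖ ^ 2 ≤ α * (Θ (m * T * (T * m))).re := by gcongr
      _ ≤ _ := h5.trans hΘ2
  have hlim : Tendsto (fun r : ℕ => M * (2 / (r : ℝ)) / α) atTop (𝓝 0) := by
    have := ((tendsto_const_div_atTop_nhds_zero_nat (2 : ℝ)).const_mul M).div_const α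
    simpa using this
  have h2 : ‖Θ m‖ ^ 2 ≤ 0 := ge_of_tendsto hlim ((eventually_gt_atTop 0).mono key)
  have h3 : ‖Θ m‖ = 0 := by nlinarith [norm_nonneg (Θ m)]
  exact norm_eq_zero.1 h3

end Order

open scoped ComplexStarModule in
/-- The limit along a nonprincipal ultrafilter of pure states concentrated at the `f n` is a pure
state of the corona. -/
lemma mem_pureStates_of_tendsto (he : IsSigmaUnitOfProjections e) {χ : ℕ → 𝓜(ℂ, A) →L[ℂ] ℂ}
    (hχ : ∀ n, χ n ∈ pureStates 𝓜(ℂ, A)) (h1 : ∀ n, χ n (incProj e n) = 1)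
    {U : Ultrafilter ℕ} (hU : (U : Filter ℕ) ≤ cofinite) {Φ : Corona A →L[ℂ] ℂ}
    (hΦ : Φ ∈ stateSpace (Corona A))
    (ht : ∀ m, Tendsto (fun n => χ n m) U (𝓝 (Φ (Corona.mk A m)))) :
    Φ ∈ pureStates (Corona A) := by
  let := CStarAlgebra.spectralOrder 𝓜(ℂ, A)
  let := CStarAlgebra.spectralOrderedRing 𝓜(ℂ, A)
  have hΦs := mem_stateSpace_iff.1 hΦ
  have hPs : Corona.pullback Φ ∈ stateSpace 𝓜(ℂ, A) :=
    (Corona.comp_mk_mem_stateSpace (fun _ => rfl)).1 hΦ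
  -- Each component of a convex decomposition of `Φ` is dominated by a multiple of `Φ`. For such a
  -- state, subtracting the scalar `Φ m` reduces the claim to `Φ m = 0`.
  have main : ∀ θ ∈ stateSpace (Corona A), ∀ α : ℝ, 0 < α →
      (∀ x, α * (θ (star x * x)).re ≤ (Φ (star x * x)).re) → θ = Φ := by
    intro θ hθ α hα hdom
    have hTs : Corona.pullback θ ∈ stateSpace 𝓜(ℂ, A) :=
      (Corona.comp_mk_mem_stateSpace (fun _ => rfl)).1 hθ
    have hTs' := mem_stateSpace_iff.1 hTs
    have hPs' := mem_stateSpace_iff.1 hPs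
    have hsa : ∀ m : 𝓜(ℂ, A), IsSelfAdjoint m →
        Corona.pullback θ m = Corona.pullback Φ m := by
      intro m hm
      have hr := hPs'.1.ofReal_re hm
      have := he.eq_zero_of_dominated hχ h1 hU (Φ := Corona.pullback Φ) ht hTs hα
        (fun x => by
          rw [Corona.pullback_apply, Corona.pullback_apply, map_mul, StarHomClass.map_star]
          exact hdom _)
        (m := m - ((Corona.pullback Φ m).re : ℂ) • 1)
        (hm.sub (.smul (Complex.conj_ofReal _) (.one _)))
        (by rw [map_sub, map_smul, hPs'.2, hr]; simp)
      rw [map_sub, map_smul, hTs'.2, hr, sub_eq_zero] at this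
      simpa using this
    ext x
    obtain ⟨m, rfl⟩ := Corona.mk_surjective x
    change Corona.pullback θ m = Corona.pullback Φ m
    rw [← realPart_add_I_smul_imaginaryPart m, map_add, map_add, map_smul, map_smul,
      hsa _ (ℜ m).2, hsa _ (ℑ m).2]
  refine mem_extremePoints.2 ⟨hΦ, fun θ₁ h₁ θ₂ h₂ h => ?_⟩
  obtain ⟨α, β, hα, hβ, -, hs⟩ := h
  have hsx : ∀ x, α * (θ₁ (star x * x)).re + β * (θ₂ (star x * x)).re = (Φ (star x * x)).re := by
    intro x
    rw [← hs]
    simp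
  have hp₁ : IsPosFunctional θ₁ := h₁.1
  have hp₂ : IsPosFunctional θ₂ := h₂.1
  refine ⟨main θ₁ h₁ α hα fun x => ?_, main θ₂ h₂ β hβ fun x => ?_⟩
  · have := mul_nonneg hβ.le (hp₂.self_re_nonneg x)
    linarith [hsx x]
  · have := mul_nonneg hα.le (hp₁.self_re_nonneg x)
    linarith [hsx x]

end IsSigmaUnitOfProjections

end Purity

/-! ### P-points and P-states -/

section PPoint

open scoped ComplexOrder

variable {A : Type*} [NonUnitalCStarAlgebra A] {e : ℕ → A}

lemma Ultrafilter.mem_of_diff_finite {U : Ultrafilter ℕ} (hU : (U : Filter ℕ) ≤ cofinite)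
    {X Y : Set ℕ} (hX : X ∈ U) (h : (X \ Y).Finite) : Y ∈ U := by
  have h1 : (X \ Y)ᶜ ∈ U := hU h.compl_mem_cofinite
  filter_upwards [hX, h1] with n hn hn'
  by_contra hY
  exact hn' ⟨hn, hY⟩

namespace IsSigmaUnitOfProjections

/-- Let `π(m)` be a `≪`-lower bound of the `π(p_X)`, and let `Y` be the set of `k` with `‖χ k m‖ > 1
/ 2`. If `k ∈ Y \ X`, then `(m * p_X - m) * f k = -m * f k` has norm above `1 / 2`; as `m * p_X - m`
lies in `A`, this happens only finitely often. -/
lemma isPPoint_of_isPState (he : IsSigmaUnitOfProjections e) {χ : ℕ → 𝓜(ℂ, A) →L[ℂ] ℂ}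
    (hχ : ∀ n, χ n ∈ stateSpace 𝓜(ℂ, A)) (h1 : ∀ n, χ n (incProj e n) = 1)
    {U : Ultrafilter ℕ} (hU : (U : Filter ℕ) ≤ cofinite) {Φ : Corona A →L[ℂ] ℂ}
    (hΦ : Φ ∈ stateSpace (Corona A))
    (ht : ∀ m, Tendsto (fun n => χ n m) U (𝓝 (Φ (Corona.mk A m)))) (hP : IsPState Φ) :
    IsPPoint U := by
  let := CStarAlgebra.spectralOrder (Corona A)
  let := CStarAlgebra.spectralOrderedRing (Corona A)
  refine ⟨fun X hX Y h => Ultrafilter.mem_of_diff_finite hU hX h, fun X hX => ?_⟩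
  have hmem : ∀ n, Corona.mk A (multiplierProj e (X n)) ∈ quantumFilter Φ := fun n => by
    have hp := (he.isStarProjection_multiplierProj (X n)).map (Corona.mk A)
    refine (mem_quantumFilter_iff hΦ).2 ⟨hp.nonneg, hp.le_one, ?_⟩
    have h2 : X n ∈ coronaSets e Φ := by
      rw [he.coronaSets_eq hχ h1 ht]; exact hX n
    exact h2
  obtain ⟨a, ha, hab⟩ := hP.2.2 _ hmem
  obtain ⟨m, rfl⟩ := Corona.mk_surjective a
  have hlim : Tendsto (fun k => ‖χ k m‖) U (𝓝 1) := by
    have := (ht m).norm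
    rwa [ha.2, norm_one] at this
  refine ⟨{k | 1 / 2 < ‖χ k m‖}, hlim.eventually_const_lt (by norm_num), fun n => ?_⟩
  have h2 : Corona.mk A (m * multiplierProj e (X n) - m) = 0 := by
    rw [map_sub, map_mul, sub_eq_zero]
    exact hab n
  obtain ⟨x, hx⟩ := Corona.mk_eq_zero.1 h2
  have h3 := (he.tendsto_mul_incProj x).eventually_lt_const (show (0 : ℝ) < 1 / 2 by norm_num)
  rw [← Nat.cofinite_eq_atTop] at h3
  refine (show {k | ¬ ‖toMultiplier A x * incProj e k‖ < 1 / 2}.Finite from h3).subset ?_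
  rintro k ⟨hk1, hk2⟩
  change ¬ _ < _
  rw [hx, sub_mul, mul_assoc, he.multiplierProj_mul_incProj_of_notMem hk2, mul_zero, zero_sub,
    norm_neg, not_lt]
  refine le_of_lt (lt_of_lt_of_le hk1 ?_)
  rw [← he.apply_mul_incProj (hχ k) (h1 k)]
  have := (χ k).le_opNorm (m * incProj e k)
  rwa [(hχ k).2, one_mul] at this

lemma mul_of_le' (he : IsSigmaUnitOfProjections e) {m n : ℕ} (h : m ≤ n) : e m * e n = e m := by
  have := congrArg star (he.mul_of_le h)
  rwa [star_mul, (he.isStarProjection m).isSelfAdjoint.star_eq,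
    (he.isStarProjection n).isSelfAdjoint.star_eq] at this

/-- The increments of the subsequence are the sums of the `f n` over consecutive blocks, so all
results on block-diagonal multipliers apply to blocks. -/
lemma comp_strictMono (he : IsSigmaUnitOfProjections e) {N : ℕ → ℕ} (hN : StrictMono N) :
    IsSigmaUnitOfProjections (e ∘ N) where
  isStarProjection n := he.isStarProjection _
  ne_zero h := by
    have h1 := he.mul_of_le (Nat.zero_le (N 0))
    rw [show e (N 0) = 0 from h, zero_mul] at h1
    exact he.ne_zero h1.symm
  le_succ n := he.mul_of_le' (hN n.lt_succ_self).le
  ne_succ n h := by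
    have h1 := he.unitProj_mul_incProj_of_lt (Nat.lt_succ_self (N n))
    have h2 := he.unitProj_mul_incProj_of_le (Nat.succ_le_of_lt (hN n.lt_succ_self))
    rw [unitProj, show e (N n.succ) = e (N n) from h.symm, h1] at h2
    have h3 := norm_toMultiplier (increment e (N n).succ)
    rw [show toMultiplier A (increment e (N n).succ) = 0 from h2.symm, norm_zero,
      he.norm_increment] at h3
    exact zero_ne_one h3
  tendsto_mul_left a := (he.tendsto_mul_left a).comp hN.tendsto_atTop
  tendsto_mul_right a := (he.tendsto_mul_right a).comp hN.tendsto_atTop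

lemma incProj_comp_mul_incProj (he : IsSigmaUnitOfProjections e) {N : ℕ → ℕ} {i n : ℕ}
    (h1 : n ≤ N i) (h2 : ∀ j < i, N j < n) :
    incProj (e ∘ N) i * incProj e n = incProj e n := by
  cases i with
  | zero => exact he.unitProj_mul_incProj_of_le h1
  | succ i =>
    rw [incProj, increment, map_sub, sub_mul]
    have h3 := he.unitProj_mul_incProj_of_le h1
    have h4 := he.unitProj_mul_incProj_of_lt (h2 i i.lt_succ_self)
    rw [unitProj] at h3 h4
    rw [Function.comp_apply, Function.comp_apply, h3, h4, sub_zero]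

/-- As `e (N i) * D` lies in `A`, it is almost fixed by right multiplication with `e N'` for large
`N'`, so `N (i + 1)` can be chosen recursively. -/
lemma exists_subsequence (he : IsSigmaUnitOfProjections e) (D : 𝓜(ℂ, A)) {p : ℕ → ℕ → Prop}
    (hp : ∀ i, ∀ᶠ n in atTop, p i n) :
    ∃ N : ℕ → ℕ, StrictMono N ∧
      (∀ i, ‖unitProj e (N i) * D * (1 - unitProj e (N (i + 1)))‖ ≤ (1 / 2) ^ i) ∧
      ∀ i, ∀ n ≥ N (i + 1), p i n := by
  have hstep : ∀ i N, ∃ N', N < N' ∧ ‖unitProj e N * D * (1 - unitProj e N')‖ ≤ (1 / 2) ^ i ∧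
      ∀ n ≥ N', p i n := by
    intro i N
    have h1 : ∀ᶠ N' in atTop, ‖unitProj e N * D * (1 - unitProj e N')‖ < (1 / 2) ^ i := by
      have h2 := ((he.tendsto_mul_unitProj D (e N)).const_sub (unitProj e N * D)).norm
      rw [sub_self, norm_zero] at h2
      refine (h2.eventually_lt_const (show (0 : ℝ) < (1 / 2) ^ i by positivity)).mono
        fun N' h => ?_
      rwa [mul_sub, mul_one]
    obtain ⟨N', h2, h3, h4⟩ :=
      ((eventually_gt_atTop N).and (h1.and (eventually_forall_ge_atTop.2 (hp i)))).exists
    exact ⟨N', h2, h3.le, h4⟩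
  choose g hg1 hg2 hg3 using hstep
  let N : ℕ → ℕ := fun i => Nat.rec 0 (fun i k => g i k) i
  exact ⟨N, strictMono_nat_of_lt_succ fun i => hg1 i (N i), fun i => hg2 i (N i),
    fun i => hg3 i (N i)⟩

section Order

variable [PartialOrder 𝓜(ℂ, A)] [StarOrderedRing 𝓜(ℂ, A)]

/-- The block-diagonal compression of cut-offs over the blocks of one parity almost annihilates
an element with rapidly decaying distant off-diagonal blocks. -/
lemma summable_norm_mul_mul (he : IsSigmaUnitOfProjections e) {D T : 𝓜(ℂ, A)}
    (hD : IsSelfAdjoint D) (hT1 : ‖T‖ ≤ 1)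
    (hoff : ∀ i, ‖unitProj e i * D * (1 - unitProj e (i + 1))‖ ≤ (1 / 2) ^ i)
    {G : ℕ → 𝓜(ℂ, A)} {ρ : Bool} (hG0 : ∀ i, 0 ≤ G i) (hG1 : ∀ i, G i ≤ 1)
    (hGD : ∀ i, ‖G i * (incProj e i * D * incProj e i) * G i‖ ≤ (1 / 2) ^ i)
    (hTf : ∀ i, Nat.bodd i = ρ → T * incProj e i = incProj e i * G i * incProj e i)
    (hTf' : ∀ i, Nat.bodd i ≠ ρ → T * incProj e i = 0) :
    Summable fun i => ‖T * D * T * incProj e i‖ := by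
  -- The shift ensures that the block `i + 2` has a neighbour on both sides and that `e i` exists
  -- below the lower one.
  rw [← summable_nat_add_iff 2]
  have hgeo : Summable fun i : ℕ => 3 * (1 / 2 : ℝ) ^ i :=
    (summable_geometric_of_lt_one (by norm_num) (by norm_num)).mul_left 3
  refine Summable.of_nonneg_of_le (fun _ => norm_nonneg _) (fun i => ?_) hgeo
  by_cases hi : Nat.bodd (i + 2) = ρ
  swap
  · rw [mul_assoc, hTf' _ hi, mul_zero, norm_zero]; positivity
  have hpar : Nat.bodd (i + 1) ≠ ρ := by
    rw [← hi, Nat.bodd_succ (i + 1)]; cases Nat.bodd (i + 1) <;> simp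
  have hpar' : Nat.bodd (i + 3) ≠ ρ := by
    rw [← hi, Nat.bodd_succ (i + 2)]; cases Nat.bodd (i + 2) <;> simp
  set q := incProj e (i + 2) with hq
  have hqp : IsStarProjection q := he.isStarProjection_incProj _
  have hqs := hqp.isSelfAdjoint
  have hqq : q * q = q := hqp.isIdempotentElem
  have hqn : ‖q‖ ≤ 1 := hqp.norm_le _
  set b := q * G (i + 2) * q with hb
  have hqb : q * b = b := by rw [hb, ← mul_assoc, ← mul_assoc, hqq]
  have hGn : ‖G (i + 2)‖ ≤ 1 := (CStarAlgebra.norm_le_one_iff_of_nonneg _ (hG0 _)).2 (hG1 _)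
  have hbn : ‖b‖ ≤ 1 := (norm_mul_le _ _).trans (mul_le_one₀ ((norm_mul_le _ _).trans
    (mul_le_one₀ hqn (norm_nonneg _) hGn)) (norm_nonneg _) hqn)
  have hinc : ∀ k, incProj e (k + 1) = unitProj e (k + 1) - unitProj e k := fun k => map_sub _ _ _
  -- `T` vanishes on the two neighbouring blocks, which have the other parity. So only blocks at
  -- distance at least two interact with block `i + 2`, and `hoff` bounds them.
  have hu1 : T * unitProj e (i + 1) = T * unitProj e i := by
    have := hTf' _ hpar
    rwa [hinc, mul_sub, sub_eq_zero] at this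
  have hu3 : T * unitProj e (i + 3) = T * unitProj e (i + 2) := by
    have := hTf' _ hpar'
    rwa [hinc, mul_sub, sub_eq_zero] at this
  have e1 : T * D * T * q = b * D * b + T * (unitProj e i * D * q) * b
      + T * ((1 - unitProj e (i + 3)) * D * q) * b := by
    have e2 : T = T * q + T * unitProj e i + T * (1 - unitProj e (i + 3)) := by
      rw [mul_sub, hu3, ← hu1, hq, hinc, mul_sub]; simp
    have e3 : ∀ x, T * (x * D) * b = T * (x * D * q) * b := fun x => by
      rw [mul_assoc T (x * D * q) b, mul_assoc (x * D) q b, hqb, mul_assoc]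
    calc T * D * T * q = T * D * b := by rw [mul_assoc, hTf _ hi]
      _ = (T * q + T * unitProj e i + T * (1 - unitProj e (i + 3))) * D * b := by rw [← e2]
      _ = T * q * D * b + T * (unitProj e i * D) * b + T * ((1 - unitProj e (i + 3)) * D) * b := by
          rw [add_mul, add_mul, add_mul, add_mul]; simp only [mul_assoc]
      _ = _ := by rw [show T * q = b from hTf _ hi, e3, e3]
  have hbDb : ‖b * D * b‖ ≤ (1 / 2) ^ i := by
    have e2 : b * D * b = q * (G (i + 2) * (q * D * q) * G (i + 2)) * q := by
      rw [hb]; simp only [mul_assoc]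
    rw [e2]
    calc _ ≤ ‖q‖ * ‖G (i + 2) * (q * D * q) * G (i + 2)‖ * ‖q‖ :=
          (norm_mul_le _ _).trans (by gcongr; exact norm_mul_le _ _)
      _ ≤ 1 * (1 / 2) ^ (i + 2) * 1 := by gcongr; exact hGD _
      _ ≤ (1 / 2) ^ i := by
          rw [one_mul, mul_one]
          exact pow_le_pow_of_le_one (by norm_num) (by norm_num) (by omega)
  have h3 : ‖unitProj e i * D * q‖ ≤ (1 / 2) ^ i := by
    have e2 : unitProj e i * D * q = unitProj e i * D * (1 - unitProj e (i + 1)) * q := by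
      rw [mul_assoc _ (1 - _) q, sub_mul, one_mul,
        he.unitProj_mul_incProj_of_lt (Nat.lt_succ_self (i + 1)), sub_zero]
    rw [e2]
    exact (norm_mul_le _ _).trans ((mul_le_of_le_one_right (norm_nonneg _) hqn).trans (hoff i))
  have h4 : ‖(1 - unitProj e (i + 3)) * D * q‖ ≤ (1 / 2) ^ i := by
    have hus : ∀ k, IsSelfAdjoint (unitProj e k) := fun k =>
      (he.isStarProjection_unitProj k).isSelfAdjoint
    have e2 : star ((1 - unitProj e (i + 3)) * D * q)
        = q * (unitProj e (i + 2) * D * (1 - unitProj e (i + 3))) := by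
      have e3 : q * unitProj e (i + 2) = q := by
        rw [← map_mul, he.increment_mul_of_le le_rfl]
      rw [star_mul, star_mul, star_sub, star_one, hqs.star_eq, hD.star_eq, (hus _).star_eq,
        ← mul_assoc, ← mul_assoc q, ← mul_assoc q, e3]
    rw [← norm_star, e2]
    refine (norm_mul_le _ _).trans ((mul_le_of_le_one_left (norm_nonneg _) hqn).trans
      ((hoff (i + 2)).trans ?_))
    exact pow_le_pow_of_le_one (by norm_num) (by norm_num) (by omega)
  have hTb : ∀ x : 𝓜(ℂ, A), ‖T * x * b‖ ≤ ‖x‖ := fun x =>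
    (norm_mul_le _ _).trans ((mul_le_of_le_one_right (norm_nonneg _) hbn).trans
      ((norm_mul_le _ _).trans (mul_le_of_le_one_left (norm_nonneg _) hT1)))
  rw [e1]
  calc _ ≤ ‖b * D * b‖ + ‖T * (unitProj e i * D * q) * b‖
        + ‖T * ((1 - unitProj e (i + 3)) * D * q) * b‖ := norm_add₃_le
    _ ≤ (1 / 2) ^ i + (1 / 2) ^ i + (1 / 2) ^ i :=
        add_le_add (add_le_add hbDb ((hTb _).trans h3)) ((hTb _).trans h4)
    _ = 3 * (1 / 2) ^ i := by ring

/-- At a P-point, a positive element at which the limit state vanishes is annihilated modulo the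
algebra by a contraction at which the limit state is one. -/
lemma exists_annihilator_of_isPPoint (he : IsSigmaUnitOfProjections e)
    {χ : ℕ → 𝓜(ℂ, A) →L[ℂ] ℂ}
    (hχ : ∀ n, χ n ∈ stateSpace 𝓜(ℂ, A)) (h1 : ∀ n, χ n (incProj e n) = 1)
    {U : Ultrafilter ℕ} (hU : (U : Filter ℕ) ≤ cofinite) (hP : IsPPoint U) {D : 𝓜(ℂ, A)}
    (hD : 0 ≤ D) (hD0 : Tendsto (fun n => χ n D) U (𝓝 0)) :
    ∃ T : 𝓜(ℂ, A), IsSelfAdjoint T ∧ ‖T‖ ≤ 1 ∧ (∃ a, toMultiplier A a = T * D * T) ∧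
      ∀ ε > 0, ∀ᶠ n in U, 1 - ε ≤ (χ n T).re := by
  have hst := fun n => mem_stateSpace_iff.1 (hχ n)
  have hDs : IsSelfAdjoint D := .of_nonneg hD
  have hre : Tendsto (fun n => (χ n D).re) U (𝓝 0) :=
    (Complex.continuous_re.tendsto _).comp hD0
  -- The P-point property turns the limit along `U` into decay along `Y`: each bound `1 / 4 ^ j`
  -- fails for only finitely many members of `Y`.
  obtain ⟨Y, hY, hYX⟩ := hP.2 (fun j => {n | (χ n D).re < (1 / 4) ^ j})
    fun j => hre.eventually_lt_const (by positivity)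
  obtain ⟨N, hN, hoff, hdec⟩ := he.exists_subsequence D
    (p := fun i n => n ∈ Y → (χ n D).re ≤ (1 / 4) ^ i) fun i => by
      rw [← Nat.cofinite_eq_atTop]
      refine (hYX i).subset fun n hn => ?_
      simp only [Set.mem_compl_iff, Set.mem_ofPred_eq, Classical.not_imp, not_le] at hn
      exact ⟨hn.1, fun h => lt_asymm h hn.2⟩
  have he' := he.comp_strictMono hN
  have hex : ∀ n, ∃ i, n ≤ N i := fun n => ⟨n, hN.id_le n⟩
  -- `κ n` is the index of the block that contains `n`.
  let κ : ℕ → ℕ := fun n => Nat.find (hex n)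
  have hκ1 : ∀ n, n ≤ N (κ n) := fun n => Nat.find_spec (hex n)
  have hκ2 : ∀ n, ∀ j < κ n, N j < n := fun n j hj => not_le.1 (Nat.find_min (hex n) hj)
  have hκ : Tendsto κ U atTop := by
    refine tendsto_atTop.2 fun j => ?_
    have : ∀ᶠ n in atTop, N j < n := eventually_gt_atTop _
    rw [← Nat.cofinite_eq_atTop] at this
    filter_upwards [hU this] with n hn
    by_contra hlt
    exact absurd (hκ1 n) (not_le.2 ((hN.monotone (not_le.1 hlt).le).trans_lt hn))
  obtain ⟨ρ, hρ⟩ := U.exists_eventually_eq fun n => Nat.bodd (κ n)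
  have hqs : ∀ i, IsSelfAdjoint (incProj (e ∘ N) i) := fun i =>
    (he'.isStarProjection_incProj i).isSelfAdjoint
  -- The cut-off level `2⁻ⁱ` is summable, yet much larger than the values of order `4⁻ⁱ` of the
  -- states at `D` in block `i`.
  choose G hG0 hG1 hG2 _ hG4 hG5 using fun i : ℕ =>
    exists_cutoff ((hqs i).conjugate_nonneg hD) (show (0 : ℝ) < (1 / 2) ^ i by positivity)
  classical
  obtain ⟨T, hT, hT1, hTf⟩ := he'.exists_blockDiagonal
    (fun i => if Nat.bodd i = ρ then G i else 0)
    (fun k => by split_ifs; exacts [hG0 k, le_rfl])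
    (fun k => by split_ifs; exacts [hG1 k, zero_le_one])
  have hTg : ∀ i, Nat.bodd i = ρ →
      T * incProj (e ∘ N) i = incProj (e ∘ N) i * G i * incProj (e ∘ N) i := fun i hi => by
    rw [hTf, if_pos hi]
  refine ⟨T, hT, hT1, ?_, ?_⟩
  · refine he'.exists_toMultiplier_eq_of_summable (he'.summable_norm_mul_mul hDs hT1 hoff hG0 hG1
      (fun i => ?_) hTg fun i hi => by rw [hTf, if_neg hi]; simp)
    exact (CStarAlgebra.norm_le_iff_le_algebraMap _ (by positivity) (hG4 i)).2 (hG5 i)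
  · intro ε hε
    -- The loss in block `κ` is at most `2 ^ κ * 4 ^ (-(κ - 2)) = 16 * 2 ^ (-κ)`; decay at rate
    -- `4⁻ⁱ` is only known from `N (i + 1)` on, which is where block `i + 2` begins.
    have hlim : Tendsto (fun n => 16 * (1 / 2 : ℝ) ^ (κ n)) U (𝓝 0) := by
      have := ((tendsto_pow_atTop_nhds_zero_of_lt_one (r := (1 / 2 : ℝ)) (by norm_num)
        (by norm_num)).comp hκ).const_mul 16
      rwa [mul_zero] at this
    filter_upwards [hρ, hY, hκ.eventually_ge_atTop 2, hlim.eventually_lt_const hε]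
      with n hn1 hn2 hn3 hn4
    set q := incProj (e ∘ N) (κ n) with hq
    have hqF : q * incProj e n = incProj e n :=
      he.incProj_comp_mul_incProj (hκ1 n) (hκ2 n)
    have hFq : incProj e n * q = incProj e n := by
      have := congrArg star hqF
      rwa [star_mul, (hqs _).star_eq, (he.isStarProjection_incProj n).isSelfAdjoint.star_eq] at this
    have hl : ∀ x, χ n (q * x) = χ n x := fun x => by
      rw [← he.apply_incProj_mul (hχ n) (h1 n), ← mul_assoc, hFq,
        he.apply_incProj_mul (hχ n) (h1 n)]
    have hr : ∀ x, χ n (x * q) = χ n x := fun x => by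
      rw [← he.apply_mul_incProj (hχ n) (h1 n), mul_assoc, hqF,
        he.apply_mul_incProj (hχ n) (h1 n)]
    rw [← hr T, hTg _ hn1, hr, hl]
    have h2 := (hst n).1.re_mono (hG2 (κ n))
    rw [map_sub, (hst n).2, ← Complex.coe_smul, map_smul, smul_eq_mul, Complex.sub_re,
      Complex.re_ofReal_mul, Complex.one_re, hr, hl] at h2
    obtain ⟨i, hi⟩ : ∃ i, κ n = i + 2 := ⟨κ n - 2, by omega⟩
    have h3 : (χ n D).re ≤ (1 / 4) ^ i :=
      hdec i n (hκ2 n (i + 1) (by omega)).le hn2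
    have h4 : ((1 / 2 : ℝ) ^ κ n)⁻¹ * (χ n D).re ≤ 16 * (1 / 2) ^ κ n := by
      rw [inv_mul_le_iff₀ (by positivity)]
      refine h3.trans (le_of_eq ?_)
      have e1 : (1 / 4 : ℝ) ^ i = (1 / 2) ^ i * (1 / 2) ^ i := by rw [← mul_pow]; norm_num
      rw [hi, e1, pow_add]
      ring
    linarith

end Order

/-- The countable family is coded by the single element `∑ 2⁻ⁿ (1 - b n)`, whose annihilation forces
the annihilation of each summand. -/
lemma isPState_of_isPPoint (he : IsSigmaUnitOfProjections e) {χ : ℕ → 𝓜(ℂ, A) →L[ℂ] ℂ}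
    (hχ : ∀ n, χ n ∈ stateSpace 𝓜(ℂ, A)) (h1 : ∀ n, χ n (incProj e n) = 1)
    {U : Ultrafilter ℕ} (hU : (U : Filter ℕ) ≤ cofinite) {Φ : Corona A →L[ℂ] ℂ}
    (hΦ : Φ ∈ pureStates (Corona A))
    (ht : ∀ m, Tendsto (fun n => χ n m) U (𝓝 (Φ (Corona.mk A m)))) (hP : IsPPoint U) :
    IsPState Φ := by
  let := CStarAlgebra.spectralOrder (Corona A)
  let := CStarAlgebra.spectralOrderedRing (Corona A)
  let := CStarAlgebra.spectralOrder 𝓜(ℂ, A)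
  let := CStarAlgebra.spectralOrderedRing 𝓜(ℂ, A)
  have hst := mem_stateSpace_iff.1 hΦ.1
  refine ⟨isMaximalQuantumFilter_of_pure hΦ, fun a ha b hb hab =>
    mem_quantumFilter_of_mulBelow hΦ.1 ha hb hab, fun b hb => ?_⟩
  have hb' := fun n => (mem_quantumFilter_iff hΦ.1).1 (hb n)
  have hterm : ∀ n, 0 ≤ ((1 / 2 : ℝ) ^ n) • (1 - b n) := fun n =>
    smul_nonneg (by positivity) (sub_nonneg.2 (hb' n).2.1)
  have hsum : Summable fun n => ((1 / 2 : ℝ) ^ n) • (1 - b n) := by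
    refine Summable.of_norm_bounded (g := fun n : ℕ => (1 / 2 : ℝ) ^ n)
      (summable_geometric_of_lt_one (by norm_num) (by norm_num)) fun n => ?_
    rw [norm_smul, Real.norm_of_nonneg (by positivity)]
    refine mul_le_of_le_one_right (by positivity) ?_
    rw [CStarAlgebra.norm_le_one_iff_of_nonneg _ (sub_nonneg.2 (hb' n).2.1)]
    exact sub_le_self 1 (hb' n).1
  set d := ∑' n, ((1 / 2 : ℝ) ^ n) • (1 - b n) with hd
  have hd0 : 0 ≤ d := tsum_nonneg hterm
  have hdΦ : Φ d = 0 := by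
    rw [hd, Φ.map_tsum hsum]
    refine (tsum_congr fun n => ?_).trans tsum_zero
    rw [← Complex.coe_smul, map_smul, map_sub, hst.2, (hb' n).2.2, sub_self, smul_zero]
  obtain ⟨x, hx⟩ := CStarAlgebra.nonneg_iff_eq_star_mul_self.1 hd0
  obtain ⟨m, rfl⟩ := Corona.mk_surjective x
  have hmk : Corona.mk A (star m * m) = d := by
    rw [map_mul, StarHomClass.map_star, hx]
  have hD0 : Tendsto (fun n => χ n (star m * m)) U (𝓝 0) := by
    have := ht (star m * m)
    rwa [hmk, hdΦ] at this
  obtain ⟨T, hT, hT1, ⟨a, ha⟩, hlow⟩ :=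
    he.exists_annihilator_of_isPPoint hχ h1 hU hP (star_mul_self_nonneg m) hD0
  set τ := Corona.mk A T with hτ
  have hτs : IsSelfAdjoint τ := hT.map (Corona.mk A)
  have hτn : ‖τ‖ ≤ 1 := (Corona.norm_mk_le T).trans hT1
  have hτd : τ * d * τ = 0 := by
    rw [← hmk, hτ, ← map_mul, ← map_mul]
    exact Corona.mk_eq_zero.2 ⟨a, ha⟩
  have hττ0 : 0 ≤ τ * τ := by simpa [hτs.star_eq] using star_mul_self_nonneg τ
  have hττ1 : τ * τ ≤ 1 := by
    rw [← CStarAlgebra.norm_le_one_iff_of_nonneg _ hττ0]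
    exact (norm_mul_le _ _).trans (mul_le_one₀ hτn (norm_nonneg _) hτn)
  have hτ1 : 1 ≤ (Φ τ).re := by
    have h2 : Tendsto (fun n => (χ n T).re) U (𝓝 (Φ τ).re) :=
      (Complex.continuous_re.tendsto _).comp (ht T)
    refine le_of_forall_pos_sub_le fun ε hε => ?_
    exact ge_of_tendsto h2 (hlow ε hε)
  have hnull : (Φ (star (1 - τ) * (1 - τ))).re = 0 := by
    refine le_antisymm ?_ (hst.1.self_re_nonneg _)
    have e1 : star (1 - τ) * (1 - τ) = 1 - (τ + τ) + τ * τ := by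
      rw [star_sub, star_one, hτs.star_eq]; noncomm_ring
    have h2 := hst.1.re_le_one hst.2 hττ1
    rw [e1, map_add, map_sub, map_add, hst.2]
    simp only [Complex.add_re, Complex.sub_re, Complex.one_re]
    linarith
  have hΦττ : Φ (τ * τ) = 1 := by
    have h2 := hst.1.mul_eq_zero_of_self hnull 1
    have h3 := hst.1.mul_eq_zero_of_self hnull τ
    rw [one_mul, map_sub, hst.2, sub_eq_zero] at h2
    rw [mul_sub, mul_one, map_sub, ← h2, sub_eq_zero] at h3
    exact h3.symm
  -- `τ` is only known to be self-adjoint; its square is positive.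
  refine ⟨τ * τ, (mem_quantumFilter_iff hΦ.1).2 ⟨hττ0, hττ1, hΦττ⟩, fun n => ?_⟩
  have hle : ((1 / 2 : ℝ) ^ n) • (1 - b n) ≤ d := hsum.le_tsum n fun k _ => hterm k
  have hz : τ * (1 - b n) * τ = 0 := by
    have h2 := hτs.conjugate_le_conjugate hle
    rw [hτd, mul_smul_comm, smul_mul_assoc] at h2
    have h3 : ((1 / 2 : ℝ) ^ n) • (τ * (1 - b n) * τ) = 0 :=
      le_antisymm h2 (smul_nonneg (by positivity)
        (hτs.conjugate_nonneg (sub_nonneg.2 (hb' n).2.1)))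
    exact (smul_eq_zero.1 h3).resolve_left (by positivity)
  -- Writing `1 - b n = star y * y` upgrades `τ * (1 - b n) * τ = 0` to the one-sided relation `τ *
  -- (1 - b n) = 0`.
  obtain ⟨y, hy⟩ := CStarAlgebra.nonneg_iff_eq_star_mul_self.1 (sub_nonneg.2 (hb' n).2.1)
  have hyτ : y * τ = 0 := by
    rw [← CStarRing.star_mul_self_eq_zero_iff, star_mul, hτs.star_eq, ← hz, hy]
    simp only [mul_assoc]
  have h4 : τ * (1 - b n) = 0 := by
    have h5 := congrArg star hyτ
    rw [star_mul, hτs.star_eq, star_zero] at h5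
    rw [hy, ← mul_assoc, h5, zero_mul]
  rw [mul_sub, mul_one, sub_eq_zero] at h4
  rw [MulBelow, mul_assoc, ← h4]

end IsSigmaUnitOfProjections

end PPoint

end

/-! ### Proof of the theorem -/

theorem mainTheorem6 {A : Type*} [NonUnitalCStarAlgebra A]
    (hA : ¬ ∃ u : A, ∀ a : A, u * a = a ∧ a * u = a)
    (e : ℕ → A) (he : IsSigmaUnitOfProjections e) :
    (∃ ψ : ℕ → A →L[ℂ] ℂ, ∀ n, ψ n ∈ pureStates A ∧ ψ n (increment e n) = 1) ∧
    ∀ ψ : ℕ → A →L[ℂ] ℂ, (∀ n, ψ n ∈ pureStates A ∧ ψ n (increment e n) = 1) →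
      ∃ ψ' : ℕ → 𝓜(ℂ, A) →L[ℂ] ℂ,
        (∀ n, ψ' n ∈ pureStates 𝓜(ℂ, A) ∧ (∀ a : A, ψ' n (toMultiplier A a) = ψ n a) ∧
          ∀ θ ∈ stateSpace 𝓜(ℂ, A), (∀ a : A, θ (toMultiplier A a) = ψ n a) → θ = ψ' n) ∧
        ∃ Φ : {U : Ultrafilter ℕ // ∀ n : ℕ, U ≠ pure n} → pureStates (Corona A),
          Function.Injective Φ ∧
          ∀ U : {U : Ultrafilter ℕ // ∀ n : ℕ, U ≠ pure n},
            (∀ m : 𝓜(ℂ, A), Tendsto (fun n => ψ' n m) (U : Ultrafilter ℕ)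
              (𝓝 ((Φ U : Corona A →L[ℂ] ℂ) (Corona.mk A m)))) ∧
            coronaSets e (Φ U : Corona A →L[ℂ] ℂ) = {X | X ∈ (U : Ultrafilter ℕ)} ∧
            (IsPState (Φ U : Corona A →L[ℂ] ℂ) ↔ IsPPoint (U : Ultrafilter ℕ)) := by
  refine ⟨?_, fun ψ hψ => ?_⟩
  · choose ψ h1 h2 using fun n =>
      exists_pureState_apply_eq_one (he.isStarProjection_increment n) (he.norm_increment n)
    exact ⟨ψ, fun n => ⟨h1 n, h2 n⟩⟩
  have hext : ∀ n a, (ψ n).comp (compress (increment e n)) (toMultiplier A a) = ψ n a :=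
    fun n a => he.state_apply_compress (hψ n).1.1 (hψ n).2 a
  have hpure : ∀ n, (ψ n).comp (compress (increment e n)) ∈ pureStates 𝓜(ℂ, A) := fun n =>
    he.comp_compress_mem_pureStates (hψ n).1 (hψ n).2
  have hone : ∀ n, (ψ n).comp (compress (increment e n)) (incProj e n) = 1 := fun n => by
    rw [hext, (hψ n).2]
  refine ⟨fun n => (ψ n).comp (compress (increment e n)), fun n => ⟨hpure n, hext n,
    fun θ hθ h => he.eq_comp_compress (hψ n).2 hθ h⟩, ?_⟩
  have hcof := fun U : {U : Ultrafilter ℕ // ∀ n : ℕ, U ≠ pure n} =>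
    Ultrafilter.le_cofinite_of_ne_pure U.2
  choose Φ hΦ ht using fun U : {U : Ultrafilter ℕ // ∀ n : ℕ, U ≠ pure n} =>
    he.exists_coronaState (fun n => (hpure n).1) hone (hcof U)
  have hΦp := fun U => he.mem_pureStates_of_tendsto hpure hone (hcof U) (hΦ U) (ht U)
  have hsets := fun U => he.coronaSets_eq (fun n => (hpure n).1) hone (ht U)
  refine ⟨fun U => ⟨Φ U, hΦp U⟩, fun U V hUV => ?_, fun U => ⟨ht U, hsets U, ?_, ?_⟩⟩
  · have h1 : Φ U = Φ V := congrArg Subtype.val hUV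
    have h2 : {X | X ∈ (U : Ultrafilter ℕ)} = {X | X ∈ (V : Ultrafilter ℕ)} := by
      rw [← hsets U, ← hsets V, h1]
    exact Subtype.ext (Ultrafilter.ext fun X => Set.ext_iff.1 h2 X)
  · exact he.isPPoint_of_isPState (fun n => (hpure n).1) hone (hcof U) (hΦ U) (ht U)
  · exact he.isPState_of_isPPoint (fun n => (hpure n).1) hone (hcof U) (hΦp U) (ht U)
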